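/- Fix a universal prefix machine $U$: a partial computable map $U:\{0,1\}^*\rightharpoonup\{0,1\}^*$ whose set of halting programs is prefix-free, and such that for every partial computable $V$ with prefix-free domain there is a string $s$ with $U(sp)=V(p)$ whenever $V(p)$ is defined. For a binary string $w$ let $K(w)$ be the length of a shortest program $p$ with $U(p)=w$. Let $\log$ be the logarithm in base $2$ and put $\log^*(x)=0$ for $x\le 1$ and $\log^*(x)=\log x+\log^*(\log x)$ for $x>1$. There is a constant $C'>0$, depending only on $U$, with the following property. Let $A=\{a_1,\dots,a_l\}$ be any finite alphabet whose letters are represented by distinct binary strings; $K(a_j)$ is the complexity of the string representing $a_j$, and $K(x_{1:n})$, for a word $x_{1:n}\in A^n$, is the complexity of the standard self-delimiting binary representation of the sequence of strings representing its letters. Put $\kappa=\max_{j\le l}K(a_j)$ (which is finite). There is a constant $\zeta\le C'+\kappa$ such that the following holds for every $m\ge 0$ and every stationary $m$-Markov process $\{X_i\}_{i\in\mathbb Z}$ with values in $A$ that satisfies * $M=\sup_n\ \sup\{|\log P(X_{1:n}=x)-\log P(X_{1:n}=x')| : x,x'\in A^n \text{ differ in at most one coordinate}\}<\infty$ (a difference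 with $\log 0=-\infty$ counts as $\infty$); * $\Delta=1+24\sum_{k\ge 0}\phi(k)<\infty$, where $\phi(k)=\sup_j\sup\{|P(B\mid E)-P(B)| : E\in\sigma(X_i,i\le j),\ P(E)>0,\ B\in\sigma(X_i,i\ge j+k)\}$. Let $H=H(X_1\mid X_0,\dots,X_{-m+1})$ and $H(X_1)$ be the entropies in bits, and put $$C_1(n)=C'+\log^*(m)+l\kappa+l^{m+1}\log^*(n)-m\log^*(l),\qquad \gamma_n=\frac{C_1(n)}{n}+\frac mn H+n^{-\frac12-\eta},$$ $$\gamma'(n)=\frac{C'+\log^*(m)+l\kappa+l^{m+1}\log^*(n)+m\log^*(l)+mH(X_1)}{n},$$ $$K_1=2M^2\Delta^2,\qquad K'_1(n)=2\Delta^2\,[C'+\log^*(n)+\kappa]^2 .$$ 1. For all $n\ge 1$ and $t>\gamma'(n)$, $$P\Big(\Big|\frac{K(X_{1:n})}{n}-H\Big|>t\Big)\le 2\exp\Big(-\frac{n(t-\gamma'(n))^2}{K'_1(n)}\Big).$$ Moreover, as $n\to\infty$, $\gamma'(n)=O(\log^*(n)/n)$, $K'_1(n)\sim 2\Delta^2\log^*(n)^2$,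 and for each fixed $t>0$ the exponent satisfies $\frac{n(t-\gamma'(n))^2}{K'_1(n)}\sim\frac{nt^2}{2\Delta^2\log^*(n)^2}$. 2. For all $\eta\in(0,\tfrac12)$, $n\ge 1$ and $t>\gamma_n$, $$P\Big(\Big|\frac{K(X_{1:n})}{n}-H\Big|\ge t\Big)\le 2\exp\Big(-\frac{n(t-\gamma_n)^2}{K_1}\Big)+n\,\zeta\,2^{-n^{\frac12-\eta}},$$ where the exponential is read as $0$ if $K_1=0$; and $\gamma_n=O(n^{-\frac12-\eta})$ as $n\to\infty$. -/

import Mathlib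

open MeasureTheory ProbabilityTheory Filter Asymptotics
open scoped ENNReal Topology

universe u v

/-! ## Kolmogorov complexity -/

/-- A self-delimiting (prefix) machine: a partial recursive map from binary programs to binary
strings such that no halting program is a proper prefix of another halting program. -/
structure IsPrefixMachine (V : List Bool →. List Bool) : Prop where
  partrec : Partrec V
  prefixFree : ∀ p q, (V p).Dom → (V q).Dom → p <+: q → p = q

/-- A universal prefix machine: it simulates every prefix machine `V`, by reading a fixed
description `s` of `V` and then the program of `V`. -/
structure IsUniversalPrefixMachine (U : List Bool →. List Bool) : Prop where
  isPrefixMachine : IsPrefixMachine U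
  simulates : ∀ V, IsPrefixMachine V → ∃ s : List Bool, ∀ p w, w ∈ V p → w ∈ U (s ++ p)

/-- The Kolmogorov complexity of a binary string: the least length of a program that makes `U`
print it and halt. For universal `U` the infimum is over a nonempty set
(`IsUniversalPrefixMachine.exists_program`). -/
noncomputable def kolmogorov (U : List Bool →. List Bool) (w : List Bool) : ℕ :=
  sInf {k | ∃ p : List Bool, w ∈ U p ∧ p.length = k}

theorem IsUniversalPrefixMachine.exists_program {U : List Bool →. List Bool}
    (hU : IsUniversalPrefixMachine U) (w : List Bool) : ∃ p, w ∈ U p := by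
  have key : IsPrefixMachine (fun p : List Bool => bif p.isEmpty then Part.some w else Part.none) := by
    refine ⟨?_, ?_⟩
    · have h1 : Computable (fun p : List Bool => p.isEmpty) := by
        have h2 : Primrec (fun p : List Bool => decide (p.length = 0)) :=
          (Primrec.eq.comp Primrec.list_length (Primrec.const 0)).decide
        refine (h2.to_comp).of_eq ?_
        intro p
        cases p <;> simp
      exact Partrec.cond h1 (Computable.const w).partrec Partrec.none
    · intro p q hp hq _
      cases p <;> cases q <;> simp_all
  obtain ⟨s, hs⟩ := hU.simulates _ key
  exact ⟨s ++ [], hs [] w (by simp)⟩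

/-- Binary representation of a finite sequence of binary strings: each bit `b` is written `1b`,
and each string is closed by `0`. -/
def binaryRep (ws : List (List Bool)) : List Bool :=
  ws.flatMap fun w => (w.flatMap fun b => [true, b]) ++ [false]

/-- The Kolmogorov complexity of a word `x` over an alphabet whose letter `a` is represented by
the binary string `rep a`. -/
noncomputable def wordComplexity (U : List Bool →. List Bool) {A : Type u} (rep : A → List Bool)
    {n : ℕ} (x : Fin n → A) : ℕ :=
  kolmogorov U (binaryRep (List.ofFn fun i => rep (x i)))

/-- The largest Kolmogorov complexity of a letter. -/
noncomputable def maxLetterComplexity (U : List Bool →. List Bool) {A : Type u} [Fintype A]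
    (rep : A → List Bool) : ℕ :=
  Finset.univ.sup fun a => kolmogorov U (rep a)

/-! ## The function `log*` -/

/-- `log* x = log₂ x + log₂ log₂ x + ⋯`, the sum stopping at the last positive term. -/
noncomputable def logStar (x : ℝ) : ℝ :=
  if 1 < x then Real.logb 2 x + logStar (Real.logb 2 x) else 0
termination_by ⌈x⌉₊
decreasing_by
  rename_i hx
  rcases le_or_gt x 2 with h2 | h2
  · have h3 : Real.logb 2 x ≤ 1 := by
      rw [Real.logb_le_iff_le_rpow (by norm_num) (by linarith)]
      simpa using h2
    have h4 : ⌈Real.logb 2 x⌉₊ ≤ 1 := by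
      rw [Nat.ceil_le]; simpa using h3
    have h5 : 1 < ⌈x⌉₊ := by
      rw [Nat.lt_ceil]; simpa using hx
    omega
  · have h3 : Real.logb 2 x ≤ x - 1 := by
      rw [Real.logb, div_le_iff₀ (Real.log_pos (by norm_num))]
      have h6 := Real.log_le_sub_one_of_pos (show (0:ℝ) < x / 2 by linarith)
      rw [Real.log_div (by linarith) (by norm_num)] at h6
      nlinarith [Real.log_two_gt_d9]
    have h4 : ⌈Real.logb 2 x⌉₊ ≤ ⌈x - 1⌉₊ := Nat.ceil_mono h3
    have h5 : ⌈x - 1⌉₊ < ⌈x⌉₊ := by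
      have h7 : ⌈x - 1⌉₊ = ⌈x⌉₊ - 1 := by simp
      have h8 : 0 < ⌈x⌉₊ := Nat.ceil_pos.mpr (by linarith)
      omega
    omega

/-! ## Processes `(X i)`, `i ∈ ℤ`, with values in a finite alphabet -/

section Stochastic

variable {Ω : Type v} [MeasurableSpace Ω] {A : Type u} [MeasurableSpace A]

/-- The `σ`-algebra generated by the `X i` with `i ∈ I`. -/
@[reducible] def sigmaOf (X : ℤ → Ω → A) (I : Set ℤ) : MeasurableSpace Ω :=
  ⨆ i ∈ I, MeasurableSpace.comap (X i) inferInstance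

/-- Stationarity: the law of the whole process is invariant under the shift. -/
def IsStationarySeq (P : Measure Ω) (X : ℤ → Ω → A) : Prop :=
  P.map (fun ω (i : ℤ) => X (i + 1) ω) = P.map (fun ω (i : ℤ) => X i ω)

/-- The `m`-Markov property: given the past `X j, X (j-1), …`, the conditional law of `X (j+1)`
depends only on the last `m` values `X j, …, X (j-m+1)`. -/
def IsMarkovOfOrder (P : Measure Ω) (X : ℤ → Ω → A) (m : ℕ) : Prop :=
  ∀ (j : ℤ) (a : A),
    P[(X (j + 1) ⁻¹' {a}).indicator (fun _ => (1 : ℝ)) | sigmaOf X (Set.Iic j)] =ᵐ[P]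
      P[(X (j + 1) ⁻¹' {a}).indicator (fun _ => (1 : ℝ)) | sigmaOf X (Set.Ioc (j - m) j)]

/-- The `φ`-mixing coefficient
`φ(k) = sup_j sup { |P(B | E) - P(B)| : E ∈ σ(X i, i ≤ j), P(E) > 0, B ∈ σ(X i, i ≥ j + k) }`. -/
noncomputable def phiMixing (P : Measure Ω) (X : ℤ → Ω → A) (k : ℕ) : ℝ :=
  sSup {r | ∃ (j : ℤ) (E B : Set Ω), MeasurableSet[sigmaOf X (Set.Iic j)] E ∧ P E ≠ 0 ∧
    MeasurableSet[sigmaOf X (Set.Ici (j + k))] B ∧ r = |P[|E].real B - P.real B|}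

/-- The word `X 1, …, X n`. -/
def wordOf (X : ℤ → Ω → A) (n : ℕ) (ω : Ω) : Fin n → A := fun i => X ((i : ℤ) + 1) ω

/-- The probability that `X 1, …, X n` is the word `x`. -/
noncomputable def wordProb (P : Measure Ω) (X : ℤ → Ω → A) {n : ℕ} (x : Fin n → A) : ℝ :=
  P.real {ω | wordOf X n ω = x}

open Classical in
/-- `|log₂ p - log₂ q|`, with value `∞` when one of the numbers vanishes (`log 0 = -∞`). -/
noncomputable def logDiff (p q : ℝ) : ℝ≥0∞ :=
  if p = 0 ∨ q = 0 then ⊤ else ENNReal.ofReal |Real.logb 2 p - Real.logb 2 q|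

/-- The stability coefficient: the supremum of `|log₂ P(X_{1:n} = x) - log₂ P(X_{1:n} = x')|` over
all `n` and all words `x`, `x'` of length `n` at Hamming distance at most one. -/
noncomputable def stabilityCoeff [DecidableEq A] (P : Measure Ω) (X : ℤ → Ω → A) : ℝ≥0∞ :=
  ⨆ (n : ℕ) (x : Fin n → A) (x' : Fin n → A) (_ : hammingDist x x' ≤ 1),
    logDiff (wordProb P X x) (wordProb P X x')

/-- The entropy `H(X_1)`, in bits. -/
noncomputable def entropyBits [Fintype A] (P : Measure Ω) (X : ℤ → Ω → A) : ℝ :=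
  ∑ a, Real.negMulLog (P.real {ω | X 1 ω = a}) / Real.log 2

/-- The conditional entropy `H(X_1 | X_0, …, X_{-m+1})`, in bits. -/
noncomputable def condEntropyBits [Fintype A] (P : Measure Ω) (X : ℤ → Ω → A) (m : ℕ) : ℝ :=
  ∑ u : Fin m → A, P.real {ω | ∀ i : Fin m, X (-(i : ℤ)) ω = u i} *
    ∑ a, Real.negMulLog (P[|{ω | ∀ i : Fin m, X (-(i : ℤ)) ω = u i}].real {ω | X 1 ω = a}) /
      Real.log 2

/-- `Δ = 1 + 24 ∑_{k ≥ 0} φ(k)`. -/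
noncomputable def mixingConst (P : Measure Ω) (X : ℤ → Ω → A) : ℝ :=
  1 + 24 * ∑' k : ℕ, phiMixing P X k

end Stochastic

/-! ## The constants of the bounds

Here `c` is the machine constant, `l` the size of the alphabet, `κ` the largest complexity of a
letter, `h` an entropy. -/

/-- `C₁(n) = c + log* m + l κ + l^(m+1) log* n - m log* l`. -/
noncomputable def overheadConst (c : ℝ) (m l κ n : ℕ) : ℝ :=
  c + logStar m + l * κ + (l : ℝ) ^ (m + 1) * logStar n - m * logStar l

/-- `γ_n = C₁(n)/n + (m/n) h + n^(-1/2-η)`, with `h = H(X_1 | X_0, …, X_{-m+1})`. -/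
noncomputable def gammaSeq (c : ℝ) (m l κ : ℕ) (h η : ℝ) (n : ℕ) : ℝ :=
  overheadConst c m l κ n / n + m / n * h + (n : ℝ) ^ (-(1 / 2 : ℝ) - η)

/-- `γ'(n) = (c + log* m + l κ + l^(m+1) log* n + m log* l + m h) / n`, with `h = H(X_1)`. -/
noncomputable def gammaPrime (c : ℝ) (m l κ : ℕ) (h : ℝ) (n : ℕ) : ℝ :=
  (c + logStar m + l * κ + (l : ℝ) ^ (m + 1) * logStar n + m * logStar l + m * h) / n

/-- `K'_1(n) = 2 Δ² (c + log* n + κ)²`. -/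
noncomputable def complexityVar (c : ℝ) (κ : ℕ) (Δ : ℝ) (n : ℕ) : ℝ :=
  2 * Δ ^ 2 * (c + logStar n + κ) ^ 2

open Classical in
/-- `exp (-s / K)` for `s > 0` and `K ≥ 0`, with the convention `exp (-s / 0) = exp (-∞) = 0`. -/
noncomputable def expNegDiv (s K : ℝ) : ℝ :=
  if K = 0 then 0 else Real.exp (-(s / K))

/-!
The complexity `K(x)` of a word `x` of length `n` is compared with its information content
`-log₂ P(x)`, whose mean `wordEntropy` lies between `n H` and `n H + m log₂ l` for a stationary
process of order `m` (`mul_condEntropyBits_le_wordEntropy`,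
`wordEntropy_le_mul_condEntropyBits_add`).

* *Lower bound.* The weights `2 ^ (-K(x))` have sum at most `1` by the Kraft inequality. So the mean
  of `K` is at least the entropy of the word (`wordEntropy_le_mean_wordComplexity`), and `K(x)` is
  less than `-log₂ P(x) - r` with probability at most `2 ^ (-r)`
  (`measureReal_wordComplexity_le`).

* *Upper bound.* The probability of a word is determined by its type, that is, by its first `m`
  letters and the numbers of its transitions, so a type class contains at most `1 / P(x)` words
  (`typeClassSize_mul_wordProb_le`). Describing the alphabet, the numbers `n`, `l` and `m`, the type
  and the position in the type class gives `IsUniversalPrefixMachine.exists_wordComplexity_le`.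
  The codes come from one coding theorem, `IsUniversalPrefixMachine.exists_complexity_le_log`, which
  turns a computable family of weights with sum at most `1` into programs of length `log₂` of the
  reciprocal weight. For natural numbers, the weight `1 / (n · ⌊log₂ n⌋ · ⌊log₂ ⌊log₂ n⌋⌋ ⋯)` gives
  `log* n`. A transition count costs `log₂ (n + 1)` bits in this code, but `log* n` in the bounds to
  be proved. The difference tends to infinity, so for `n` above a threshold that depends only on the
  machine it absorbs all other overheads, such as those of order `m log₂ l` (`overhead_le`). Below
  the threshold, the complexity is at most `l κ` plus a constant
  (`IsUniversalPrefixMachine.exists_wordComplexity_le_of_length_le`).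

* *Concentration.* A function of a word that changes by at most `c` when one letter is changed
  deviates from its mean by `s` with probability at most `exp (-s² / (2 n c² Δ²))`
  (`measureReal_deviation_le`). This is the Azuma–Hoeffding argument: revealing a letter changes the
  conditional mean by at most `c Δ`, as one sees by replacing the later letters one at a time and
  comparing the conditional law of the letters that remain with the unconditional law by means of
  `φ` (`abs_cellMean_sub_le`, `abs_cellMean_sub_le_phiMixing`).

The first bound applies the concentration inequality to `K`, for which `c` is the cost of describing
a position and a letter (`IsUniversalPrefixMachine.exists_abs_wordComplexity_sub_le`). The second
applies it to `-log₂ P(x)`, for which `c` is the stability coefficient, and pays `2 ^ (-r)` with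
`r = n ^ (1/2 - η)` for the words whose complexity is less than `-log₂ P(x) - r`; for short words it
holds because the error term `n ζ 2 ^ (-r)` is at least `1`.
-/

/-! ### Composition of prefix machines -/

section Machines

variable {α β γ : Type*} [Primcodable α] [Primcodable β] [Primcodable γ]

/-- Dovetailing: a computation of `f k b` for some `k` is found by a partial recursive search. -/
theorem Partrec₂.exists_dovetail {f : ℕ → α →. β} (hf : Partrec₂ f) :
    ∃ V : α →. β, Partrec V ∧ (∀ a w, w ∈ V a → ∃ k, w ∈ f k a) ∧
      ∀ a k, (f k a).Dom → (V a).Dom := by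
  obtain ⟨c, hc⟩ := Nat.Partrec.Code.exists_code.1 hf
  refine ⟨fun a => Nat.rfindOpt fun N => (Nat.Partrec.Code.evaln N.unpair.1 c
    (Encodable.encode (N.unpair.2, a))).bind fun n => (Encodable.decode n : Option β), ?_, ?_, ?_⟩
  · apply Partrec.rfindOpt
    apply Computable.option_bind
    · apply Primrec.to_comp
      refine Nat.Partrec.Code.primrec_evaln.comp (Primrec.pair (Primrec.pair ?_
        (Primrec.const c)) ?_)
      · exact Primrec.fst.comp (Primrec.unpair.comp Primrec.snd)
      · exact Primrec.encode.comp
          (Primrec.pair (Primrec.snd.comp (Primrec.unpair.comp Primrec.snd)) Primrec.fst)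
    · exact (Computable.decode.comp Computable.snd).to₂
  · intro a w hw
    obtain ⟨N, hN⟩ := Nat.rfindOpt_spec hw
    simp only [Option.mem_def, Option.bind_eq_some_iff] at hN
    obtain ⟨n, hn, hw'⟩ := hN
    have h := Nat.Partrec.Code.evaln_sound (Option.mem_def.2 hn)
    rw [hc] at h
    simp only [Encodable.encodek, Part.coe_some, Part.bind_some, Part.mem_map_iff] at h
    obtain ⟨w', h1, h2⟩ := h
    rw [← h2, Encodable.encodek] at hw'
    exact ⟨_, by simpa [← Option.some.inj hw'] using h1⟩
  · intro a k hk
    obtain ⟨w, hw⟩ := Part.dom_iff_mem.1 hk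
    rw [Nat.rfindOpt_dom]
    have h : Encodable.encode w ∈ Nat.Partrec.Code.eval c (Encodable.encode (k, a)) := by
      rw [hc]
      simp only [Encodable.encodek, Part.coe_some, Part.bind_some, Part.mem_map_iff]
      exact ⟨w, hw, rfl⟩
    obtain ⟨t, ht⟩ := Nat.Partrec.Code.evaln_complete.1 h
    refine ⟨Nat.pair t k, w, ?_⟩
    simp only [Nat.unpair_pair, Option.mem_def] at ht ⊢
    rw [ht]
    simp

variable {U : List Bool →. List Bool}

theorem kolmogorov_le_length {p w : List Bool} (h : w ∈ U p) : kolmogorov U w ≤ p.length :=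
  Nat.sInf_le ⟨p, h, rfl⟩

theorem IsUniversalPrefixMachine.exists_shortest_program (hU : IsUniversalPrefixMachine U)
    (w : List Bool) : ∃ p, w ∈ U p ∧ p.length = kolmogorov U w :=
  Nat.sInf_mem (s := {k | ∃ p : List Bool, w ∈ U p ∧ p.length = k})
    (let ⟨p, hp⟩ := hU.exists_program w; ⟨_, p, hp, rfl⟩)

theorem IsPrefixMachine.eq_of_prefix (hU : IsPrefixMachine U) {p q r : List Bool}
    (hp : (U p).Dom) (hq : (U q).Dom) (h1 : p <+: r) (h2 : q <+: r) : p = q := by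
  rcases List.prefix_or_prefix_of_prefix h1 h2 with h | h
  · exact hU.prefixFree _ _ hp hq h
  · exact (hU.prefixFree _ _ hq hp h).symm

/-- Prefix machines compose: a program that makes `U` print `w`, followed by a program of a prefix
machine `W w` which may depend on `w`, is a program of a prefix machine. -/
theorem IsPrefixMachine.exists_comp (hU : IsPrefixMachine U)
    {W : List Bool → List Bool →. List Bool} (hW : Partrec₂ W)
    (hfree : ∀ w p q, (W w p).Dom → (W w q).Dom → p <+: q → p = q) :
    ∃ V, IsPrefixMachine V ∧ ∀ p q w z, w ∈ U p → z ∈ W w q → z ∈ V (p ++ q) := by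
  have hf : Partrec₂ fun (k : ℕ) (p : List Bool) => (U (p.take k)).bind fun w =>
      W w (p.drop k) := by
    refine Partrec.bind (f := fun x : ℕ × List Bool => U (x.2.take x.1))
      (g := fun x w => W w (x.2.drop x.1)) ?_ ?_
    · exact hU.partrec.comp (Primrec.list_take.comp Primrec.fst Primrec.snd).to_comp
    · exact hW.comp Computable.snd ((Primrec.list_drop.comp (Primrec.fst.comp Primrec.fst)
        (Primrec.snd.comp Primrec.fst)).to_comp)
  obtain ⟨V, hV, hV1, hV2⟩ := hf.exists_dovetail
  have split : ∀ r z, z ∈ V r → ∃ p q w, r = p ++ q ∧ w ∈ U p ∧ z ∈ W w q := by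
    intro r z hz
    obtain ⟨k, hk⟩ := hV1 r z hz
    obtain ⟨w, hw, hz⟩ := Part.mem_bind_iff.1 hk
    exact ⟨_, _, w, (List.take_append_drop k r).symm, hw, hz⟩
  refine ⟨V, ⟨hV, ?_⟩, ?_⟩
  · intro r s hr hs hrs
    obtain ⟨z, hz⟩ := Part.dom_iff_mem.1 hr
    obtain ⟨z', hz'⟩ := Part.dom_iff_mem.1 hs
    obtain ⟨p, q, w, rfl, hw, hz⟩ := split _ _ hz
    obtain ⟨p', q', w', rfl, hw', hz'⟩ := split _ _ hz'
    obtain rfl : p = p' := hU.eq_of_prefix (Part.dom_iff_mem.2 ⟨_, hw⟩)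
      (Part.dom_iff_mem.2 ⟨_, hw'⟩) ((List.prefix_append p q).trans hrs) (List.prefix_append p' q')
    obtain rfl := Part.mem_unique hw hw'
    rw [List.prefix_append_right_inj] at hrs
    rw [hfree w q q' (Part.dom_iff_mem.2 ⟨_, hz⟩) (Part.dom_iff_mem.2 ⟨_, hz'⟩) hrs]
  · intro p q w z hw hz
    have hdom : (V (p ++ q)).Dom := by
      refine hV2 _ p.length (Part.dom_iff_mem.2 ⟨z, ?_⟩)
      rw [Part.mem_bind_iff]
      exact ⟨w, by simpa using hw, by simpa using hz⟩
    obtain ⟨z', hz'⟩ := Part.dom_iff_mem.1 hdom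
    obtain ⟨p', q', w', h, hw', hzz⟩ := split _ _ hz'
    obtain rfl : p = p' := hU.eq_of_prefix (Part.dom_iff_mem.2 ⟨_, hw⟩)
      (Part.dom_iff_mem.2 ⟨_, hw'⟩) (List.prefix_append p q) (h ▸ List.prefix_append p' q')
    obtain rfl := Part.mem_unique hw hw'
    obtain rfl := List.append_cancel_left h
    rwa [Part.mem_unique hz hzz]

/-! ### Complexity of elements of encodable types -/

/-- Complexity of an element of an encodable type: the complexity of its code number, written in
unary. -/
noncomputable def complexity (U : List Bool →. List Bool) (a : α) : ℕ :=
  kolmogorov U (List.replicate (Encodable.encode a) true)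

theorem computable_replicate_encode :
    Computable fun a : α => List.replicate (Encodable.encode a) true := by
  have h : Primrec fun n : ℕ => List.replicate n true := by
    refine (Primrec.list_map (g := fun _ _ => true) Primrec.list_range
      (Primrec.const true).to₂).of_eq fun n => ?_
    simp
  exact (h.comp Primrec.encode).to_comp

/-- A computable family of prefix codes for elements of `β`, indexed by `α`, bounds the complexity
of an element of `β` by that of the index plus the length of the codeword. -/
theorem IsUniversalPrefixMachine.exists_complexity_le_add_length (hU : IsUniversalPrefixMachine U)
    {W : α → List Bool →. β} (hW : Partrec₂ W)
    (hfree : ∀ a p q, (W a p).Dom → (W a q).Dom → p <+: q → p = q) :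
    ∃ C : ℕ, ∀ a b p, b ∈ W a p → complexity U b ≤ complexity U a + p.length + C := by
  have hW' : Partrec₂ fun (w p : List Bool) =>
      ((Encodable.decode w.length : Option α) : Part α).bind fun a =>
        (W a p).map fun b => List.replicate (Encodable.encode b) true := by
    refine Partrec.bind (f := fun x : List Bool × List Bool =>
      ((Encodable.decode x.1.length : Option α) : Part α))
      (g := fun x a => (W a x.2).map fun b => List.replicate (Encodable.encode b) true) ?_ ?_
    · exact (Computable.decode.comp (Computable.list_length.comp Computable.fst)).ofOption
    · refine Partrec.map (f := fun x : (List Bool × List Bool) × α => W x.2 x.1.2) ?_ ?_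
      · exact hW.comp Computable.snd (Computable.snd.comp Computable.fst)
      · exact (computable_replicate_encode.comp Computable.snd).to₂
  obtain ⟨V, hV, hV1⟩ := hU.isPrefixMachine.exists_comp hW' (by
    intro w p q hp hq hpq
    rcases h : (Encodable.decode w.length : Option α) with _ | a
    · simp [h] at hp
    · simp only [h, Part.coe_some, Part.bind_some, Part.map_Dom] at hp hq
      exact hfree a p q hp hq hpq)
  obtain ⟨s, hs⟩ := hU.simulates V hV
  refine ⟨s.length, fun a b p hb => ?_⟩
  obtain ⟨q, hq, hql⟩ := hU.exists_shortest_program (List.replicate (Encodable.encode a) true)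
  have h := hV1 q p _ (List.replicate (Encodable.encode b) true) hq (by
    simp only [List.length_replicate, Encodable.encodek, Part.coe_some, Part.bind_some]
    exact Part.mem_map _ hb)
  have h2 := kolmogorov_le_length (hs _ _ h)
  simp only [List.length_append, hql] at h2
  unfold complexity
  omega

theorem IsUniversalPrefixMachine.exists_complexity_map_le (hU : IsUniversalPrefixMachine U)
    {g : α →. β} (hg : Partrec g) :
    ∃ C : ℕ, ∀ a b, b ∈ g a → complexity U b ≤ complexity U a + C := by
  obtain ⟨C, hC⟩ := hU.exists_complexity_le_add_length
    (W := fun (a : α) (p : List Bool) => bif p.isEmpty then g a else Part.none) (by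
      refine Partrec.cond (c := fun x : α × List Bool => x.2.isEmpty) ?_
        (hg.comp Computable.fst) Partrec.none
      have h2 : Primrec (fun p : List Bool => decide (p.length = 0)) :=
        (Primrec.eq.comp Primrec.list_length (Primrec.const 0)).decide
      refine (h2.to_comp.comp Computable.snd).of_eq fun x => ?_
      cases x.2 <;> simp) (by
      intro a p q hp hq _
      cases p <;> cases q <;> simp_all)
  exact ⟨C, fun a b hb => by simpa using hC a b [] (by simpa using hb)⟩

theorem IsUniversalPrefixMachine.exists_complexity_map_le' (hU : IsUniversalPrefixMachine U)
    {g : α → β} (hg : Computable g) :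
    ∃ C : ℕ, ∀ a, complexity U (g a) ≤ complexity U a + C := by
  obtain ⟨C, hC⟩ := hU.exists_complexity_map_le hg.partrec
  exact ⟨C, fun a => hC a (g a) (by simp)⟩

/-- Since `U` is self-delimiting, a shortest program for `a` followed by one for `b` describes the
pair `(a, b)`. -/
theorem IsUniversalPrefixMachine.exists_complexity_pair_le (hU : IsUniversalPrefixMachine U) :
    ∃ C : ℕ, ∀ (a : α) (b : β),
      complexity U (a, b) ≤ complexity U a + complexity U b + C := by
  obtain ⟨C, hC⟩ := hU.exists_complexity_le_add_length
    (W := fun (a : α) (p : List Bool) => (U p).bind fun w =>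
      (((Encodable.decode w.length : Option β).map fun b => (a, b) : Option (α × β)) :
        Part (α × β))) (by
      refine Partrec.bind (f := fun x : α × List Bool => U x.2)
        (g := fun x w => (((Encodable.decode w.length : Option β).map fun b => (x.1, b) :
          Option (α × β)) : Part (α × β)))
        (hU.isPrefixMachine.partrec.comp Computable.snd) ?_
      refine Computable.ofOption ?_
      refine Computable.option_map (f := fun x : (α × List Bool) × List Bool =>
        (Encodable.decode x.2.length : Option β)) (g := fun x b => (x.1.1, b)) ?_ ?_
      · exact Computable.decode.comp (Computable.list_length.comp Computable.snd)
      · exact (Computable.pair (Computable.fst.comp (Computable.fst.comp Computable.fst))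
          Computable.snd).to₂) (by
      intro a p q hp hq hpq
      exact hU.isPrefixMachine.prefixFree p q (Part.Dom.of_bind hp) (Part.Dom.of_bind hq) hpq)
  refine ⟨C, fun a b => ?_⟩
  obtain ⟨p, hp, hpl⟩ := hU.exists_shortest_program (List.replicate (Encodable.encode b) true)
  have h := hC a (a, b) p (by
    rw [Part.mem_bind_iff]
    exact ⟨_, hp, by simp⟩)
  rwa [hpl] at h

theorem IsUniversalPrefixMachine.exists_complexity_le_kolmogorov
    (hU : IsUniversalPrefixMachine U) :
    ∃ C : ℕ, ∀ w : List Bool, complexity U w ≤ kolmogorov U w + C := by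
  obtain ⟨C, hC⟩ := hU.exists_complexity_le_add_length (α := Unit) (W := fun _ p => U p)
    (hU.isPrefixMachine.partrec.comp Computable.snd) fun _ => hU.isPrefixMachine.prefixFree
  refine ⟨complexity U () + C, fun w => ?_⟩
  obtain ⟨p, hp, hpl⟩ := hU.exists_shortest_program w
  have h := hC () w p hp
  omega

theorem IsUniversalPrefixMachine.exists_kolmogorov_le_complexity
    (hU : IsUniversalPrefixMachine U) :
    ∃ C : ℕ, ∀ w : List Bool, kolmogorov U w ≤ complexity U w + C := by
  obtain ⟨V, hV, hV1⟩ := hU.isPrefixMachine.exists_comp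
    (W := fun w p => bif p.isEmpty then ((Encodable.decode w.length : Option (List Bool)) :
      Part (List Bool)) else Part.none) (by
      refine Partrec.cond (c := fun x : List Bool × List Bool => x.2.isEmpty) ?_
        (Computable.decode.comp (Computable.list_length.comp Computable.fst)).ofOption
        Partrec.none
      have h2 : Primrec (fun p : List Bool => decide (p.length = 0)) :=
        (Primrec.eq.comp Primrec.list_length (Primrec.const 0)).decide
      refine (h2.to_comp.comp Computable.snd).of_eq fun x => ?_
      cases x.2 <;> simp) (by
      intro a p q hp hq _
      cases p <;> cases q <;> simp_all)
  obtain ⟨s, hs⟩ := hU.simulates V hV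
  refine ⟨s.length, fun w => ?_⟩
  obtain ⟨p, hp, hpl⟩ := hU.exists_shortest_program (List.replicate (Encodable.encode w) true)
  have h := kolmogorov_le_length (hs _ _ (hV1 p [] _ w hp (by simp)))
  simp only [List.length_append, hpl, List.length_nil] at h
  unfold complexity
  omega

/-- The inverse of a computable injection is found by unbounded search, so an injective computable
encoding does not lower the complexity by more than a constant. -/
theorem IsUniversalPrefixMachine.exists_complexity_le_of_injective
    (hU : IsUniversalPrefixMachine U) {e : α → β} (he : Computable e)
    (hinj : Function.Injective e) :
    ∃ C : ℕ, ∀ a, complexity U a ≤ complexity U (e a) + C := by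
  classical
  have hg : Partrec fun b : β => Nat.rfindOpt fun n =>
      (Encodable.decode n : Option α).bind fun a =>
        bif decide (Encodable.encode (e a) = Encodable.encode b) then some a else none := by
    refine Partrec.rfindOpt ?_
    refine Computable.option_bind (f := fun x : β × ℕ => (Encodable.decode x.2 : Option α))
      (g := fun x a => bif decide (Encodable.encode (e a) = Encodable.encode x.1) then some a
        else none) (Computable.decode.comp Computable.snd) ?_
    refine Computable.cond (c := fun x : (β × ℕ) × α =>
      decide (Encodable.encode (e x.2) = Encodable.encode x.1.1)) ?_
      (Computable.option_some.comp Computable.snd) (Computable.const none)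
    exact (Primrec.eq (α := ℕ)).decide.to_comp.comp
      (Computable.encode.comp (he.comp Computable.snd))
      (Computable.encode.comp (Computable.fst.comp Computable.fst))
  obtain ⟨C, hC⟩ := hU.exists_complexity_map_le hg
  refine ⟨C, fun a => hC (e a) a ?_⟩
  have hmem : ∀ a' n, a' ∈ ((Encodable.decode n : Option α).bind fun a' =>
      bif decide (Encodable.encode (e a') = Encodable.encode (e a)) then some a' else none) →
      a' = a := by
    intro a' n h
    simp only [Option.mem_def, Option.bind_eq_some_iff] at h
    obtain ⟨b, _, h⟩ := h
    by_cases hb : Encodable.encode (e b) = Encodable.encode (e a)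
    · simp only [hb, decide_true, cond_true, Option.some.injEq] at h
      exact h ▸ hinj (Encodable.encode_injective hb)
    · simp [hb] at h
  have hdom : (Nat.rfindOpt fun n => (Encodable.decode n : Option α).bind fun a' =>
      bif decide (Encodable.encode (e a') = Encodable.encode (e a)) then some a'
        else none).Dom := by
    rw [Nat.rfindOpt_dom]
    exact ⟨Encodable.encode a, a, by simp⟩
  obtain ⟨a', ha'⟩ := Part.dom_iff_mem.1 hdom
  obtain ⟨n, hn⟩ := Nat.rfindOpt_spec ha'
  rwa [hmem a' n hn] at ha'

end Machines

/-! ### Primitive recursive functions -/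

attribute [fun_prop] Primrec
attribute [fun_prop] Primrec.id Primrec.const Primrec.comp Primrec.pair

section PrimrecClosure

variable {α β σ : Type*} [Primcodable α] [Primcodable β] [Primcodable σ]

@[fun_prop]
theorem Primrec.fst_comp {f : σ → α × β} (hf : Primrec f) : Primrec fun x => (f x).1 :=
  Primrec.fst.comp hf

@[fun_prop]
theorem Primrec.snd_comp {f : σ → α × β} (hf : Primrec f) : Primrec fun x => (f x).2 :=
  Primrec.snd.comp hf

@[fun_prop]
theorem Primrec.add_comp {f g : σ → ℕ} (hf : Primrec f) (hg : Primrec g) :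
    Primrec fun x => f x + g x :=
  Primrec.nat_add.comp hf hg

@[fun_prop]
theorem Primrec.sub_comp {f g : σ → ℕ} (hf : Primrec f) (hg : Primrec g) :
    Primrec fun x => f x - g x :=
  Primrec.nat_sub.comp hf hg

@[fun_prop]
theorem Primrec.mul_comp {f g : σ → ℕ} (hf : Primrec f) (hg : Primrec g) :
    Primrec fun x => f x * g x :=
  Primrec.nat_mul.comp hf hg

@[fun_prop]
theorem Primrec.div_comp {f g : σ → ℕ} (hf : Primrec f) (hg : Primrec g) :
    Primrec fun x => f x / g x :=
  Primrec.nat_div.comp hf hg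

@[fun_prop]
theorem Primrec.mod_comp {f g : σ → ℕ} (hf : Primrec f) (hg : Primrec g) :
    Primrec fun x => f x % g x :=
  Primrec.nat_mod.comp hf hg

@[fun_prop]
theorem Primrec.pow_comp {f g : σ → ℕ} (hf : Primrec f) (hg : Primrec g) :
    Primrec fun x => f x ^ g x :=
  (Primrec₂.unpaired'.1 Nat.Primrec.pow).comp hf hg

@[fun_prop]
theorem Primrec.decide_eq_comp [DecidableEq α] {f g : σ → α} (hf : Primrec f) (hg : Primrec g) :
    Primrec fun x => decide (f x = g x) :=
  Primrec.eq.decide.comp hf hg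

@[fun_prop]
theorem Primrec.ite_eq_comp [DecidableEq α] {f g : σ → α} {u v : σ → β} (hf : Primrec f)
    (hg : Primrec g) (hu : Primrec u) (hv : Primrec v) :
    Primrec fun x => if f x = g x then u x else v x :=
  Primrec.ite (Primrec.eq.comp hf hg) hu hv

@[fun_prop]
theorem Primrec.ite_lt_comp {f g : σ → ℕ} {u v : σ → β} (hf : Primrec f)
    (hg : Primrec g) (hu : Primrec u) (hv : Primrec v) :
    Primrec fun x => if f x < g x then u x else v x :=
  Primrec.ite (Primrec.nat_lt.comp hf hg) hu hv

@[fun_prop]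
theorem Primrec.sum_range_comp {f : σ → ℕ} {g : σ → ℕ → ℕ} (hf : Primrec f)
    (hg : Primrec fun x : σ × ℕ => g x.1 x.2) :
    Primrec fun x => ∑ i ∈ Finset.range (f x), g x i := by
  refine (Primrec.nat_rec' (g := fun _ => 0) (h := fun x p => p.2 + g x p.1) hf
    (by fun_prop) ?_).of_eq fun x => ?_
  · change Primrec _
    fun_prop
  · induction f x with
    | zero => simp
    | succ n ih => rw [Finset.sum_range_succ, ← ih]

@[fun_prop]
theorem Primrec.list_map_comp {f : σ → List α} {g : σ → α → β} (hf : Primrec f)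
    (hg : Primrec fun x : σ × α => g x.1 x.2) : Primrec fun x => (f x).map (g x) :=
  Primrec.list_map hf hg

@[fun_prop]
theorem Primrec.list_range_comp {f : σ → ℕ} (hf : Primrec f) :
    Primrec fun x => List.range (f x) :=
  Primrec.list_range.comp hf

@[fun_prop]
theorem Primrec.list_flatMap_comp {f : σ → List α} {g : σ → α → List β} (hf : Primrec f)
    (hg : Primrec fun x : σ × α => g x.1 x.2) : Primrec fun x => (f x).flatMap (g x) :=
  Primrec.list_flatMap hf hg

@[fun_prop]
theorem Primrec.list_append_comp {f g : σ → List α} (hf : Primrec f) (hg : Primrec g) :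
    Primrec fun x => f x ++ g x :=
  Primrec.list_append.comp hf hg

@[fun_prop]
theorem Primrec.list_cons_comp {f : σ → α} {g : σ → List α} (hf : Primrec f) (hg : Primrec g) :
    Primrec fun x => f x :: g x :=
  Primrec.list_cons.comp hf hg

@[fun_prop]
theorem Primrec.list_getD_comp {f : σ → List α} {g : σ → ℕ} (d : α) (hf : Primrec f)
    (hg : Primrec g) : Primrec fun x => (f x).getD (g x) d :=
  (Primrec.list_getD d).comp hf hg

@[fun_prop]
theorem Primrec.list_set_comp {f : σ → List α} {g : σ → ℕ} {h : σ → α} (hf : Primrec f)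
    (hg : Primrec g) (hh : Primrec h) : Primrec fun x => (f x).set (g x) (h x) :=
  Primrec.list_set.comp hf (hg.pair hh)

@[fun_prop]
theorem Primrec.natLog_comp {f : σ → ℕ} (hf : Primrec f) : Primrec fun x => Nat.log 2 (f x) := by
  have h : Primrec fun n : ℕ => Nat.findGreatest (fun k => 2 ^ k ≤ n) n :=
    Primrec.nat_findGreatest (p := fun n k => 2 ^ k ≤ n) Primrec.id
      (Primrec.nat_le.comp (by fun_prop : Primrec fun x : ℕ × ℕ => 2 ^ x.2) Primrec.fst)
  refine (h.comp hf).of_eq fun x => ?_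
  rcases Nat.eq_zero_or_pos (f x) with h0 | h0
  · simp [h0]
  · rw [Nat.findGreatest_eq_iff]
    refine ⟨Nat.log_le_self 2 _, fun _ => Nat.pow_log_le_self 2 h0.ne', fun k hk _ => ?_⟩
    exact not_le.2 (Nat.lt_pow_of_log_lt (by norm_num) hk)

end PrimrecClosure

/-! ### Coding with a computable sub-probability -/

section Coding

/-- The `L` lowest binary digits of `v`, the most significant one first. -/
def binaryDigits (L v : ℕ) : List Bool :=
  (List.range L).map fun i => decide (v / 2 ^ (L - 1 - i) % 2 = 1)

theorem length_binaryDigits (L v : ℕ) : (binaryDigits L v).length = L := by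
  simp [binaryDigits]

theorem div_eq_of_binaryDigits_prefix {L L' v v' : ℕ} (hv : v < 2 ^ L) (hv' : v' < 2 ^ L')
    (h : binaryDigits L v <+: binaryDigits L' v') : L ≤ L' ∧ v' / 2 ^ (L' - L) = v := by
  have hL : L ≤ L' := by simpa [length_binaryDigits] using h.length_le
  refine ⟨hL, Nat.eq_of_testBit_eq fun j => ?_⟩
  have hlt : v' / 2 ^ (L' - L) < 2 ^ L := by
    rw [Nat.div_lt_iff_lt_mul (by positivity), ← pow_add]
    rwa [show L + (L' - L) = L' by omega]
  rcases le_or_gt L j with hj | hj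
  · have hp : 2 ^ L ≤ 2 ^ j := Nat.pow_le_pow_right (by norm_num) hj
    rw [Nat.testBit_lt_two_pow (hlt.trans_le hp), Nat.testBit_lt_two_pow (hv.trans_le hp)]
  · have h1 := h.getElem (i := L - 1 - j) (by rw [length_binaryDigits]; omega)
    simp only [binaryDigits, List.getElem_map, List.getElem_range] at h1
    rw [show L - 1 - (L - 1 - j) = j by omega,
      show L' - 1 - (L - 1 - j) = (L' - L) + j by omega, pow_add, ← Nat.div_div_eq_div_mul] at h1
    rw [Nat.testBit_eq_decide_div_mod_eq, Nat.testBit_eq_decide_div_mod_eq, ← h1]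

/-- Numerator and denominator of `∑_{Y < N} 1 / d Y`, with the convention `1 / 0 = 0`. -/
def cumulative (d : ℕ → ℕ) (N : ℕ) : ℕ × ℕ :=
  Nat.rec (0, 1) (fun Y p => if d Y = 0 then p else (p.1 * d Y + p.2, p.2 * d Y)) N

theorem cumulative_spec (d : ℕ → ℕ) (N : ℕ) :
    0 < (cumulative d N).2 ∧
      ((cumulative d N).1 : ℝ) / (cumulative d N).2 = ∑ Y ∈ Finset.range N, (d Y : ℝ)⁻¹ := by
  induction N with
  | zero => simp [cumulative]
  | succ N ih =>
    have h : cumulative d (N + 1) = if d N = 0 then cumulative d N else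
      ((cumulative d N).1 * d N + (cumulative d N).2, (cumulative d N).2 * d N) := rfl
    rw [h, Finset.sum_range_succ, ← ih.2]
    split_ifs with h0
    · simp [h0, ih.1]
    · have h1 : ((cumulative d N).2 : ℝ) ≠ 0 := by exact_mod_cast ih.1.ne'
      have h2 : (d N : ℝ) ≠ 0 := by exact_mod_cast h0
      refine ⟨Nat.mul_pos ih.1 (Nat.pos_of_ne_zero h0), ?_⟩
      push_cast
      field_simp

/-- The length of the codeword of `X` in the Shannon–Fano–Elias code. -/
def codeLength (d : ℕ → ℕ) (X : ℕ) : ℕ := Nat.log 2 (d X) + 2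

/-- The left end point, in units of `2 ^ (- codeLength d X)`, of a dyadic interval contained in
`[F, F + 1 / d X)`, where `F = ∑_{Y < X} 1 / d Y`. -/
def codeValue (d : ℕ → ℕ) (X : ℕ) : ℕ :=
  (cumulative d X).1 * 2 ^ codeLength d X / (cumulative d X).2 + 1

/-- The Shannon–Fano–Elias code of the sub-probability `X ↦ 1 / d X`; the numbers with `d X = 0`
have no codeword. -/
def codeword (d : ℕ → ℕ) (X : ℕ) : Option (List Bool) :=
  if d X = 0 then none else some (binaryDigits (codeLength d X) (codeValue d X))

theorem codeValue_bounds (d : ℕ → ℕ) (X : ℕ) :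
    (∑ Y ∈ Finset.range X, (d Y : ℝ)⁻¹) * 2 ^ codeLength d X < codeValue d X ∧
      (codeValue d X : ℝ) ≤ (∑ Y ∈ Finset.range X, (d Y : ℝ)⁻¹) * 2 ^ codeLength d X + 1 := by
  obtain ⟨h0, h1⟩ := cumulative_spec d X
  have h0' : (0 : ℝ) < (cumulative d X).2 := by exact_mod_cast h0
  rw [← h1, div_mul_eq_mul_div]
  unfold codeValue
  have h2 := Nat.floor_div_eq_div (K := ℝ) ((cumulative d X).1 * 2 ^ codeLength d X)
    (cumulative d X).2
  push_cast at h2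
  rw [← h2]
  push_cast
  exact ⟨Nat.lt_floor_add_one _, by gcongr; exact Nat.floor_le (by positivity)⟩

theorem two_le_two_pow_codeLength_div (d : ℕ → ℕ) {X : ℕ} (hX : d X ≠ 0) :
    2 ≤ (d X : ℝ)⁻¹ * 2 ^ codeLength d X := by
  have h := Nat.lt_pow_succ_log_self (b := 2) (by norm_num) (d X)
  have hd : (0 : ℝ) < d X := by exact_mod_cast Nat.pos_of_ne_zero hX
  rw [inv_mul_eq_div, le_div_iff₀ hd]
  have h' : 2 * d X ≤ 2 ^ codeLength d X := by
    unfold codeLength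
    rw [pow_succ, mul_comm]
    exact Nat.mul_le_mul_right 2 h.le
  exact_mod_cast h'

theorem codeValue_lt (d : ℕ → ℕ) (hd : ∀ N, ∑ Y ∈ Finset.range N, (d Y : ℝ)⁻¹ ≤ 1) {X : ℕ}
    (hX : d X ≠ 0) : codeValue d X < 2 ^ codeLength d X := by
  have h1 := (codeValue_bounds d X).2
  have h2 := two_le_two_pow_codeLength_div d hX
  have h3 := hd (X + 1)
  rw [Finset.sum_range_succ] at h3
  have h4 : (0 : ℝ) < 2 ^ codeLength d X := by positivity
  have h5 := mul_le_mul_of_nonneg_right h3 h4.le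
  have : (codeValue d X : ℝ) < 2 ^ codeLength d X := by nlinarith
  exact_mod_cast this

/-- The Shannon–Fano–Elias code is prefix-free, as the dyadic intervals of distinct codewords are
disjoint. -/
theorem eq_of_codeword_prefix (d : ℕ → ℕ) (hd : ∀ N, ∑ Y ∈ Finset.range N, (d Y : ℝ)⁻¹ ≤ 1)
    {X X' : ℕ} {p p' : List Bool} (h : codeword d X = some p) (h' : codeword d X' = some p')
    (hp : p <+: p') : X = X' := by
  have hX : d X ≠ 0 := fun h0 => by simp [codeword, h0] at h
  have hX' : d X' ≠ 0 := fun h0 => by simp [codeword, h0] at h'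
  simp only [codeword, hX, hX', if_false, Option.some.injEq] at h h'
  subst h h'
  obtain ⟨hL, hv⟩ := div_eq_of_binaryDigits_prefix (codeValue_lt d hd hX) (codeValue_lt d hd hX') hp
  obtain ⟨e, he⟩ := Nat.exists_eq_add_of_le hL
  rw [he, Nat.add_sub_cancel_left] at hv
  have hb := codeValue_bounds d X
  have hb' := codeValue_bounds d X'
  have ht := two_le_two_pow_codeLength_div d hX
  have ht' := two_le_two_pow_codeLength_div d hX'
  have hmono : ∀ a b : ℕ, a < b →
      (∑ Y ∈ Finset.range a, (d Y : ℝ)⁻¹) + (d a : ℝ)⁻¹ ≤ ∑ Y ∈ Finset.range b, (d Y : ℝ)⁻¹ := by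
    intro a b hab
    rw [← Finset.sum_range_succ]
    exact Finset.sum_le_sum_of_subset_of_nonneg (Finset.range_mono hab)
      fun _ _ _ => by positivity
  have hpe : (0 : ℝ) < 2 ^ e := by positivity
  have hpL : (0 : ℝ) < 2 ^ codeLength d X := by positivity
  have hlow : (codeValue d X : ℝ) * 2 ^ e ≤ codeValue d X' := by
    have := Nat.div_mul_le_self (codeValue d X') (2 ^ e)
    rw [hv] at this
    exact_mod_cast this
  have hup : (codeValue d X' : ℝ) < (codeValue d X + 1) * 2 ^ e := by
    have := Nat.lt_div_mul_add (a := codeValue d X') (b := 2 ^ e) (by positivity)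
    rw [hv] at this
    have h2 : codeValue d X' < (codeValue d X + 1) * 2 ^ e := by rw [add_mul, one_mul]; exact this
    exact_mod_cast h2
  rw [he, pow_add] at hb' ht'
  rcases lt_trichotomy X X' with hlt | heq | hlt
  · exfalso
    have h1 := mul_le_mul_of_nonneg_right (hmono _ _ hlt) (mul_pos hpL hpe).le
    have h2 := mul_le_mul_of_nonneg_right hb.2 hpe.le
    have h3 := mul_le_mul_of_nonneg_right ht hpe.le
    nlinarith [hb'.1]
  · exact heq
  · exfalso
    have h1 := mul_le_mul_of_nonneg_right (hmono _ _ hlt) (mul_pos hpL hpe).le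
    have h2 := mul_lt_mul_of_pos_right hb.1 hpe
    nlinarith [hb'.2]

theorem primrec_codeword {α : Type*} [Primcodable α] {d : α → ℕ → ℕ}
    (hd : Primrec fun x : α × ℕ => d x.1 x.2) :
    Primrec fun x : α × ℕ => codeword (d x.1) x.2 := by
  have hcum : Primrec fun x : α × ℕ => cumulative (d x.1) x.2 := by
    refine Primrec.nat_rec' (f := fun x : α × ℕ => x.2) (g := fun _ => (0, 1))
      (h := fun x q => if d x.1 q.1 = 0 then q.2 else
        (q.2.1 * d x.1 q.1 + q.2.2, q.2.2 * d x.1 q.1)) (by fun_prop) (by fun_prop) ?_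
    change Primrec _
    have h : Primrec fun x : (α × ℕ) × ℕ × ℕ × ℕ => d x.1.1 x.2.1 :=
      hd.comp (by fun_prop : Primrec fun x : (α × ℕ) × ℕ × ℕ × ℕ => (x.1.1, x.2.1))
    fun_prop
  have hlen : Primrec fun x : α × ℕ => codeLength (d x.1) x.2 := by
    unfold codeLength
    fun_prop
  have hval : Primrec fun x : α × ℕ => codeValue (d x.1) x.2 := by
    unfold codeValue
    fun_prop
  have hbin : Primrec fun x : ℕ × ℕ => binaryDigits x.1 x.2 := by
    unfold binaryDigits
    fun_prop
  have hdig : Primrec fun x : α × ℕ =>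
      binaryDigits (codeLength (d x.1) x.2) (codeValue (d x.1) x.2) :=
    hbin.comp (hlen.pair hval)
  unfold codeword
  exact Primrec.ite (Primrec.eq.comp hd (Primrec.const 0)) (Primrec.const none)
    (Primrec.option_some.comp hdig)

/-- Coding theorem: if `∑ X, 1 / d a X ≤ 1` for every `a`, then the pair `(a, X)` has complexity at
most `log₂ (d a X)`, up to the complexity of `a` and a constant. -/
theorem IsUniversalPrefixMachine.exists_complexity_le_log {U : List Bool →. List Bool}
    (hU : IsUniversalPrefixMachine U) {α : Type*} [Primcodable α] {d : α → ℕ → ℕ}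
    (hd : Primrec fun x : α × ℕ => d x.1 x.2)
    (hsum : ∀ a N, ∑ X ∈ Finset.range N, (d a X : ℝ)⁻¹ ≤ 1) :
    ∃ C : ℕ, ∀ a X, d a X ≠ 0 →
      complexity U (a, X) ≤ complexity U a + Nat.log 2 (d a X) + C := by
  obtain ⟨C, hC⟩ := hU.exists_complexity_le_add_length
    (W := fun (a : α) (p : List Bool) => (Nat.rfind fun X =>
      Part.some (decide (codeword (d a) X = some p))).map fun X => (a, X)) (by
      refine Partrec.map (f := fun x : α × List Bool => Nat.rfind fun X =>
        Part.some (decide (codeword (d x.1) X = some x.2))) (g := fun x X => (x.1, X))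
        (Partrec.rfind ?_) ((Computable.fst.comp Computable.fst).pair Computable.snd).to₂
      change Partrec _
      refine Computable.partrec (f := fun x : (α × List Bool) × ℕ =>
        decide (codeword (d x.1.1) x.2 = some x.1.2)) (Primrec.to_comp ?_)
      refine Primrec.decide_eq_comp ?_ (Primrec.option_some.comp (by fun_prop))
      exact (primrec_codeword hd).comp
        (by fun_prop : Primrec fun x : (α × List Bool) × ℕ => (x.1.1, x.2))) (by
      intro a p q hp hq hpq
      obtain ⟨X, hX⟩ := Part.dom_iff_mem.1 (show (Nat.rfind _).Dom from hp)
      obtain ⟨Y, hY⟩ := Part.dom_iff_mem.1 (show (Nat.rfind _).Dom from hq)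
      have hX := Nat.rfind_spec hX
      have hY := Nat.rfind_spec hY
      simp only [Part.mem_some_iff, true_eq_decide_iff] at hX hY
      obtain rfl := eq_of_codeword_prefix (d a) (hsum a) hX hY hpq
      exact Option.some.inj (hX.symm.trans hY))
  refine ⟨C + 2, fun a X hX => ?_⟩
  have hc : codeword (d a) X = some (binaryDigits (codeLength (d a) X) (codeValue (d a) X)) := by
    simp [codeword, hX]
  have h := hC a (a, X) (binaryDigits (codeLength (d a) X) (codeValue (d a) X)) (by
    refine Part.mem_map (fun X => (a, X)) ?_
    refine Nat.mem_rfind.2 ⟨by simpa using hc, fun {Y} hY => ?_⟩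
    simp only [Part.mem_some_iff, false_eq_decide_iff]
    intro hYc
    exact hY.ne (eq_of_codeword_prefix (d a) (hsum a) hYc hc List.prefix_rfl))
  rw [length_binaryDigits] at h
  unfold codeLength at h
  omega

end Coding

/-! ### The function `log*` and the complexity of natural numbers -/

section LogStar

theorem logStar_of_le_one {x : ℝ} (hx : x ≤ 1) : logStar x = 0 := by
  rw [logStar, if_neg (not_lt.2 hx)]

theorem logStar_of_one_lt {x : ℝ} (hx : 1 < x) :
    logStar x = Real.logb 2 x + logStar (Real.logb 2 x) := by
  rw [logStar, if_pos hx]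

theorem logStar_nonneg (x : ℝ) : 0 ≤ logStar x := by
  induction x using logStar.induct with
  | case1 x hx ih =>
    rw [logStar_of_one_lt hx]
    have := Real.logb_pos (b := 2) (by norm_num) hx
    linarith
  | case2 x hx => rw [logStar_of_le_one (not_lt.1 hx)]

theorem logStar_mono : Monotone logStar := by
  intro x
  induction x using logStar.induct with
  | case1 x hx ih =>
    intro y hxy
    rw [logStar_of_one_lt hx, logStar_of_one_lt (hx.trans_le hxy)]
    have h := Real.logb_le_logb_of_le (b := 2) (by norm_num) (by linarith) hxy
    exact add_le_add h (ih h)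
  | case2 x hx =>
    intro y _
    rw [logStar_of_le_one (not_lt.1 hx)]
    exact logStar_nonneg y

theorem logb_two_le_logStar {x : ℝ} (hx : 1 ≤ x) : Real.logb 2 x ≤ logStar x := by
  rcases hx.eq_or_lt with rfl | hx
  · simp [logStar_nonneg]
  · rw [logStar_of_one_lt hx]
    linarith [logStar_nonneg (Real.logb 2 x)]

theorem logb_two_le {x : ℝ} (hx : 0 < x) : Real.logb 2 x ≤ 3 / 4 * x := by
  rw [Real.logb, div_le_iff₀ (Real.log_pos (by norm_num))]
  have h6 := Real.log_le_sub_one_of_pos (show (0:ℝ) < x / 2 by linarith)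
  rw [Real.log_div (by linarith) (by norm_num)] at h6
  nlinarith [Real.log_two_gt_d9, Real.log_two_lt_d9]

theorem logStar_le {x : ℝ} (hx : 0 ≤ x) : logStar x ≤ 3 * x := by
  induction x using logStar.induct with
  | case1 x hx1 ih =>
    rw [logStar_of_one_lt hx1]
    have h1 := ih (Real.logb_nonneg (by norm_num) hx1.le)
    have h2 := logb_two_le (x := x) (by linarith)
    linarith
  | case2 x hx1 =>
    rw [logStar_of_le_one (not_lt.1 hx1)]
    linarith

theorem logStar_le_mul_logb {x : ℝ} (hx : 1 ≤ x) : logStar x ≤ 4 * Real.logb 2 x := by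
  rcases hx.eq_or_lt with rfl | hx
  · simp [logStar_of_le_one]
  · rw [logStar_of_one_lt hx]
    linarith [logStar_le (Real.logb_nonneg (b := 2) (by norm_num) hx.le)]

/-- The second term `log₂ log₂ n` of `log* n` exceeds any given bound for large `n`; this is the
slack that pays for the overheads of the code for words. -/
theorem logb_add_one_add_le_logStar {n B : ℕ} (hn : 2 ^ 2 ^ (B + 1) ≤ n) :
    Real.logb 2 (n + 1) + B ≤ logStar n := by
  have h2n : 2 ≤ n := by
    have : 2 ^ 1 ≤ 2 ^ 2 ^ (B + 1) := Nat.pow_le_pow_right (by norm_num) (Nat.one_le_two_pow)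
    omega
  have hn0 : (2 : ℝ) ≤ n := by exact_mod_cast h2n
  have h1 : Real.logb 2 (n + 1) ≤ Real.logb 2 n + 1 := by
    have h2 : Real.logb 2 ((n : ℝ) * 2) = Real.logb 2 n + 1 := by
      rw [Real.logb_mul (by linarith) (by norm_num), Real.logb_self_eq_one (by norm_num)]
    rw [← h2]
    exact Real.logb_le_logb_of_le (by norm_num) (by linarith) (by linarith)
  have h2 : (2 : ℝ) ^ (B + 1) ≤ Real.logb 2 n := by
    rw [Real.le_logb_iff_rpow_le (by norm_num) (by linarith)]
    have : ((2 ^ 2 ^ (B + 1) : ℕ) : ℝ) ≤ n := by exact_mod_cast hn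
    refine le_trans (le_of_eq ?_) this
    push_cast
    rw [← Real.rpow_natCast 2 (2 ^ (B + 1))]
    norm_num
  have h3 : ((B + 1 : ℕ) : ℝ) ≤ Real.logb 2 (Real.logb 2 n) := by
    rw [Real.le_logb_iff_rpow_le (by norm_num) (lt_of_lt_of_le (by positivity) h2),
      Real.rpow_natCast]
    exact h2
  have h4 : 1 ≤ Real.logb 2 (n : ℝ) := le_trans (one_le_pow₀ (by norm_num)) h2
  rw [logStar_of_one_lt (by linarith)]
  have := logb_two_le_logStar h4
  push_cast at h3
  linarith

/-- The integer analogue `n · ⌊log₂ n⌋ · ⌊log₂ ⌊log₂ n⌋⌋ ⋯` of `2 ^ log* n`. -/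
def iteratedLogProd (n : ℕ) : ℕ :=
  if _h : n < 2 then 1 else n * iteratedLogProd (Nat.log 2 n)
termination_by n
decreasing_by exact Nat.log_lt_self 2 (by omega)

theorem iteratedLogProd_of_lt {n : ℕ} (h : n < 2) : iteratedLogProd n = 1 := by
  rw [iteratedLogProd, dif_pos h]

theorem iteratedLogProd_of_le {n : ℕ} (h : 2 ≤ n) :
    iteratedLogProd n = n * iteratedLogProd (Nat.log 2 n) := by
  rw [iteratedLogProd, dif_neg (by omega)]

theorem iteratedLogProd_pos (n : ℕ) : 0 < iteratedLogProd n := by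
  induction n using Nat.strong_induction_on with
  | _ n ih =>
    rcases lt_or_ge n 2 with h | h
    · rw [iteratedLogProd_of_lt h]; norm_num
    · rw [iteratedLogProd_of_le h]
      exact Nat.mul_pos (by omega) (ih _ (Nat.log_lt_self 2 (by omega)))

theorem logb_iteratedLogProd_le (n : ℕ) : Real.logb 2 (iteratedLogProd n) ≤ logStar n := by
  induction n using Nat.strong_induction_on with
  | _ n ih =>
    rcases lt_or_ge n 2 with h | h
    · rw [iteratedLogProd_of_lt h]; simpa using logStar_nonneg n
    · rw [iteratedLogProd_of_le h]
      have hn : (2 : ℝ) ≤ n := by exact_mod_cast h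
      have hp : (0 : ℝ) < iteratedLogProd (Nat.log 2 n) := by exact_mod_cast iteratedLogProd_pos _
      push_cast
      rw [Real.logb_mul (by linarith) hp.ne', logStar_of_one_lt (by linarith)]
      have h1 := ih _ (Nat.log_lt_self 2 (by omega))
      have h2 := logStar_mono (Real.natLog_le_logb n 2)
      push_cast at h2
      linarith

theorem primrec_iteratedLogProd : Primrec iteratedLogProd := by
  have h := Primrec.nat_strong_rec (α := Unit) (fun _ => iteratedLogProd)
    (g := fun _ l => some (if l.length < 2 then 1 else
      l.length * l.getD (Nat.log 2 l.length) 1)) (by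
      change Primrec _
      have hl : Primrec fun x : Unit × List ℕ => x.2.length := Primrec.list_length.comp Primrec.snd
      refine Primrec.option_some.comp ?_
      fun_prop) (by
      intro _ n
      simp only [List.length_map, List.length_range, Option.some.injEq]
      split_ifs with hn
      · rw [iteratedLogProd_of_lt hn]
      · rw [iteratedLogProd_of_le (by omega), List.getD_eq_getElem?_getD, List.getElem?_map,
          List.getElem?_range (Nat.log_lt_self 2 (by omega))]
        simp)
  exact h.comp (Primrec.const ()) Primrec.id

theorem sum_Ico_two_mul (g : ℕ → ℝ) {a b : ℕ} (hab : a ≤ b) :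
    ∑ n ∈ Finset.Ico (2 * a) (2 * b), g n = ∑ j ∈ Finset.Ico a b, (g (2 * j) + g (2 * j + 1)) := by
  induction b, hab using Nat.le_induction with
  | base => simp
  | succ b hb ih =>
    rw [Finset.sum_Ico_succ_top hb, ← ih, show 2 * (b + 1) = 2 * b + 1 + 1 by ring,
      Finset.sum_Ico_succ_top (by omega), Finset.sum_Ico_succ_top (by omega), add_assoc]

theorem sum_inv_dyadic_block_le {k : ℕ} (hk : 1 ≤ k) :
    ∑ n ∈ Finset.Ico (2 ^ k : ℕ) (2 ^ (k + 1)), (n : ℝ)⁻¹ ≤ 5 / 6 := by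
  induction k, hk using Nat.le_induction with
  | base =>
    norm_num [Finset.sum_Ico_succ_top]
  | succ k hk ih =>
    rw [pow_succ' 2 k, pow_succ' 2 (k + 1), sum_Ico_two_mul _
      (Nat.pow_le_pow_right (n := 2) (by norm_num) (Nat.le_succ k))]
    refine le_trans (Finset.sum_le_sum fun j hj => ?_) ih
    have hj1 : 1 ≤ j := le_trans Nat.one_le_two_pow (Finset.mem_Ico.1 hj).1
    have hj0 : (0 : ℝ) < j := by exact_mod_cast hj1
    have h1 : ((2 * j + 1 : ℕ) : ℝ)⁻¹ ≤ ((2 * j : ℕ) : ℝ)⁻¹ := by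
      apply inv_anti₀
      · push_cast; linarith
      · push_cast; linarith
    have h2 : ((2 * j : ℕ) : ℝ)⁻¹ = (j : ℝ)⁻¹ / 2 := by
      push_cast
      field_simp
    linarith

/-- The numbers of bit length `k + 1` together have at most `5 / 6` of the weight of `k`, since the
sum of `1 / n` over them decreases with `k` from `1 / 2 + 1 / 3`; so the total weight is finite. -/
theorem sum_inv_iteratedLogProd_le (N : ℕ) :
    ∑ n ∈ Finset.range N, (iteratedLogProd n : ℝ)⁻¹ ≤ 8 := by
  have hnn : ∀ n, 0 ≤ (iteratedLogProd n : ℝ)⁻¹ := fun n => by positivity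
  have hblock : ∀ k, 1 ≤ k → ∑ n ∈ Finset.Ico (2 ^ k) (2 ^ (k + 1)), (iteratedLogProd n : ℝ)⁻¹ ≤
      5 / 6 * (iteratedLogProd k : ℝ)⁻¹ := by
    intro k hk
    refine le_trans (le_of_eq ?_)
      (mul_le_mul_of_nonneg_right (sum_inv_dyadic_block_le hk) (hnn k))
    rw [Finset.sum_mul]
    refine Finset.sum_congr rfl fun n hn => ?_
    rw [Finset.mem_Ico] at hn
    have hlog : Nat.log 2 n = k := Nat.log_eq_of_pow_le_of_lt_pow hn.1 hn.2
    have h2 : 2 ≤ n := le_trans (by simpa using Nat.pow_le_pow_right (n := 2) (by norm_num) hk) hn.1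
    rw [iteratedLogProd_of_le h2, hlog]
    push_cast
    rw [mul_inv]
  have hsum : ∀ M, 1 ≤ M → ∑ n ∈ Finset.Ico 2 (2 ^ M), (iteratedLogProd n : ℝ)⁻¹ ≤
      5 / 6 * ∑ k ∈ Finset.Ico 1 M, (iteratedLogProd k : ℝ)⁻¹ := by
    intro M hM
    induction M, hM using Nat.le_induction with
    | base => simp
    | succ M hM ih =>
      have h2 : 2 ≤ 2 ^ M := by simpa using Nat.pow_le_pow_right (n := 2) (by norm_num) hM
      rw [← Finset.sum_Ico_consecutive _ h2 (Nat.pow_le_pow_right (by norm_num) (Nat.le_succ M)),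
        Finset.sum_Ico_succ_top hM, mul_add]
      exact add_le_add ih (hblock M hM)
  have hfin : ∑ n ∈ Finset.Ico 2 (2 ^ (N + 2)), (iteratedLogProd n : ℝ)⁻¹ ≤ 5 := by
    have h1 := hsum (N + 2) (by omega)
    have h2 : ∑ k ∈ Finset.Ico 1 (N + 2), (iteratedLogProd k : ℝ)⁻¹ ≤
        1 + ∑ n ∈ Finset.Ico 2 (2 ^ (N + 2)), (iteratedLogProd n : ℝ)⁻¹ := by
      rw [Finset.sum_eq_sum_Ico_succ_bot (by omega), iteratedLogProd_of_lt (by norm_num)]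
      simp only [Nat.cast_one, inv_one, add_le_add_iff_left]
      exact Finset.sum_le_sum_of_subset_of_nonneg
        (Finset.Ico_subset_Ico le_rfl (Nat.lt_two_pow_self).le) fun _ _ _ => hnn _
    linarith
  have hsub : Finset.range N ⊆ Finset.range 2 ∪ Finset.Ico 2 (2 ^ (N + 2)) := by
    intro n hn
    have h1 : n < N := Finset.mem_range.1 hn
    have h2 : N + 2 < 2 ^ (N + 2) := Nat.lt_two_pow_self
    simp only [Finset.mem_union, Finset.mem_range, Finset.mem_Ico]
    omega
  refine le_trans (Finset.sum_le_sum_of_subset_of_nonneg hsub fun _ _ _ => hnn _) ?_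
  rw [Finset.sum_union (by
    rw [Finset.disjoint_left]
    intro n h1 h2
    rw [Finset.mem_range] at h1
    rw [Finset.mem_Ico] at h2
    omega)]
  have h01 : ∑ n ∈ Finset.range 2, (iteratedLogProd n : ℝ)⁻¹ = 2 := by
    rw [Finset.sum_range_succ, Finset.sum_range_one, iteratedLogProd_of_lt (by norm_num),
      iteratedLogProd_of_lt (by norm_num)]
    norm_num
  linarith

/-- The coding theorem for weights proportional to `1 / (n · ⌊log₂ n⌋ · ⌊log₂ ⌊log₂ n⌋⌋ ⋯)`. -/
theorem IsUniversalPrefixMachine.exists_complexity_nat_le {U : List Bool →. List Bool}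
    (hU : IsUniversalPrefixMachine U) :
    ∃ C : ℕ, ∀ n : ℕ, (complexity U n : ℝ) ≤ logStar n + C := by
  obtain ⟨C, hC⟩ := hU.exists_complexity_le_log (α := Unit)
    (d := fun _ n => 8 * iteratedLogProd n) (by
      have := primrec_iteratedLogProd
      fun_prop) (by
      intro _ N
      have := sum_inv_iteratedLogProd_le N
      simp only [Nat.cast_mul, mul_inv, ← Finset.mul_sum]
      push_cast
      linarith)
  obtain ⟨C', hC'⟩ := hU.exists_complexity_map_le' (g := fun x : Unit × ℕ => x.2) Computable.snd
  refine ⟨complexity U () + C + C' + 3, fun n => ?_⟩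
  have hpos := iteratedLogProd_pos n
  have h := hC () n (by omega)
  have h1 : (complexity U n : ℝ) ≤
      complexity U () + Nat.log 2 (8 * iteratedLogProd n) + C + C' := by
    exact_mod_cast (hC' ((), n)).trans (Nat.add_le_add_right h C')
  have h2 := Real.natLog_le_logb (8 * iteratedLogProd n) 2
  push_cast at h2
  have hp : (0 : ℝ) < iteratedLogProd n := by exact_mod_cast hpos
  rw [Real.logb_mul (by norm_num) hp.ne'] at h2
  have h3 : Real.logb 2 8 = 3 := by
    rw [show (8 : ℝ) = 2 ^ (3 : ℝ) by norm_num, Real.logb_rpow (by norm_num) (by norm_num)]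
  have h4 := logb_iteratedLogProd_le n
  push_cast
  linarith

end LogStar

/-! ### Complexity of sequences of strings -/

section Sequences

theorem flatMap_append_false_inj {w w' r r' : List Bool}
    (h : (w.flatMap fun b => [true, b]) ++ false :: r =
      (w'.flatMap fun b => [true, b]) ++ false :: r') : w = w' ∧ r = r' := by
  induction w generalizing w' with
  | nil => cases w' <;> simp_all
  | cons b w ih =>
    cases w' with
    | nil => simp at h
    | cons b' w' =>
      simp only [List.flatMap_cons, List.cons_append, List.nil_append, List.cons.injEq,
        true_and] at h
      obtain ⟨h1, h2⟩ := ih h.2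
      exact ⟨by rw [h.1, h1], h2⟩

theorem binaryRep_cons (w : List Bool) (ws : List (List Bool)) :
    binaryRep (w :: ws) = (w.flatMap fun b => [true, b]) ++ false :: binaryRep ws := by
  simp [binaryRep]

theorem binaryRep_injective : Function.Injective binaryRep := by
  intro ws
  induction ws with
  | nil =>
    intro ws' h
    cases ws' with
    | nil => rfl
    | cons w ws' =>
      rw [binaryRep_cons] at h
      simp [binaryRep] at h
  | cons w ws ih =>
    intro ws' h
    cases ws' with
    | nil =>
      rw [binaryRep_cons] at h
      simp [binaryRep] at h
    | cons w' ws' =>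
      rw [binaryRep_cons, binaryRep_cons] at h
      obtain ⟨h1, h2⟩ := flatMap_append_false_inj h
      rw [h1, ih h2]

theorem primrec_binaryRep : Primrec binaryRep := by
  unfold binaryRep
  fun_prop

variable {U : List Bool →. List Bool}

/-- A list of strings is coded by concatenating shortest programs of its entries. -/
theorem IsUniversalPrefixMachine.exists_complexity_list_le (hU : IsUniversalPrefixMachine U) :
    ∃ C : ℕ, ∀ L : List (List Bool),
      complexity U L ≤ (L.map fun w => kolmogorov U w + C).sum + C := by
  obtain ⟨C1, h1⟩ := hU.exists_complexity_pair_le (α := List Bool) (β := List (List Bool))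
  obtain ⟨C2, h2⟩ := hU.exists_complexity_map_le'
    (g := fun x : List Bool × List (List Bool) => x.1 :: x.2) (Primrec.to_comp (by fun_prop))
  obtain ⟨C3, h3⟩ := hU.exists_complexity_le_kolmogorov
  have key : ∀ L : List (List Bool), complexity U L ≤
      (L.map fun w => kolmogorov U w + (C1 + C2 + C3)).sum +
        complexity U ([] : List (List Bool)) := by
    intro L
    induction L with
    | nil => simp
    | cons w L ih =>
      have h2' := h2 (w, L)
      have h1' := h1 w L
      have h3' := h3 w
      simp only [List.map_cons, List.sum_cons] at h2' ⊢
      omega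
  refine ⟨C1 + C2 + C3 + complexity U ([] : List (List Bool)), fun L => (key L).trans ?_⟩
  gcongr ?_ + ?_
  · exact List.sum_le_sum fun w _ => by omega
  · omega

/-- A sequence of strings is described by a list of strings and the sequence of their indices. -/
theorem IsUniversalPrefixMachine.exists_kolmogorov_binaryRep_le (hU : IsUniversalPrefixMachine U) :
    ∃ C : ℕ, ∀ (L : List (List Bool)) (I : List ℕ),
      kolmogorov U (binaryRep (I.map fun i => L.getD i [])) ≤
        (L.map fun w => kolmogorov U w + C).sum + complexity U I + C := by
  obtain ⟨C1, h1⟩ := hU.exists_complexity_list_le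
  obtain ⟨C2, h2⟩ := hU.exists_complexity_pair_le (α := List (List Bool)) (β := List ℕ)
  obtain ⟨C3, h3⟩ := hU.exists_complexity_map_le'
    (g := fun x : List (List Bool) × List ℕ => binaryRep (x.2.map fun i => x.1.getD i []))
    (Primrec.to_comp (primrec_binaryRep.comp (by fun_prop)))
  obtain ⟨C4, h4⟩ := hU.exists_kolmogorov_le_complexity
  refine ⟨C1 + C2 + C3 + C4, fun L I => ?_⟩
  have e1 := h1 L
  have e2 := h2 L I
  have e3 := h3 (L, I)
  have e4 := h4 (binaryRep (I.map fun i => L.getD i []))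
  have e5 : (L.map fun w => kolmogorov U w + C1).sum ≤
      (L.map fun w => kolmogorov U w + (C1 + C2 + C3 + C4)).sum :=
    List.sum_le_sum fun w _ => by omega
  simp only at e3
  omega

/-- Replacing one string of a sequence costs a description of its position and of the new string. -/
theorem IsUniversalPrefixMachine.exists_kolmogorov_set_le (hU : IsUniversalPrefixMachine U) :
    ∃ C : ℕ, ∀ (ws : List (List Bool)) (i : ℕ) (w : List Bool),
      (kolmogorov U (binaryRep (ws.set i w)) : ℝ) ≤
        kolmogorov U (binaryRep ws) + kolmogorov U w + logStar i + C := by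
  obtain ⟨C1, h1⟩ := hU.exists_complexity_nat_le
  obtain ⟨C2, h2⟩ := hU.exists_complexity_pair_le (α := List (List Bool)) (β := ℕ × List Bool)
  obtain ⟨C3, h3⟩ := hU.exists_complexity_pair_le (α := ℕ) (β := List Bool)
  obtain ⟨C4, h4⟩ := hU.exists_kolmogorov_le_complexity
  obtain ⟨C5, h5⟩ := hU.exists_complexity_le_kolmogorov
  obtain ⟨C6, h6⟩ := hU.exists_complexity_le_of_injective primrec_binaryRep.to_comp
    binaryRep_injective
  obtain ⟨C7, h7⟩ := hU.exists_complexity_map_le'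
    (g := fun x : List (List Bool) × ℕ × List Bool => binaryRep (x.1.set x.2.1 x.2.2))
    (Primrec.to_comp (primrec_binaryRep.comp (by fun_prop)))
  refine ⟨C1 + C2 + C3 + C4 + 2 * C5 + C6 + C7, fun ws i w => ?_⟩
  have e1 := h1 i
  have e2 := h2 ws (i, w)
  have e3 := h3 i w
  have e4 := h4 (binaryRep (ws.set i w))
  have e5 := h5 w
  have e5' := h5 (binaryRep ws)
  have e6 := h6 ws
  have e7 := h7 (ws, i, w)
  have e8 : kolmogorov U (binaryRep (ws.set i w)) ≤ kolmogorov U (binaryRep ws) +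
      kolmogorov U w + complexity U i + (C2 + C3 + C4 + 2 * C5 + C6 + C7) := by
    simp only at e7
    omega
  have e9 : (kolmogorov U (binaryRep (ws.set i w)) : ℝ) ≤ kolmogorov U (binaryRep ws) +
      kolmogorov U w + complexity U i + (C2 + C3 + C4 + 2 * C5 + C6 + C7) := by
    exact_mod_cast e8
  push_cast
  linarith

end Sequences

/-! ### The Kraft inequality -/

section Kraft

theorem uniquelyDecodable_of_prefixFree {S : Set (List Bool)} (hnil : [] ∉ S)
    (hS : ∀ p ∈ S, ∀ q ∈ S, p <+: q → p = q) : InformationTheory.UniquelyDecodable S := by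
  intro L₁
  induction L₁ with
  | nil =>
    intro L₂ _ h2 h
    cases L₂ with
    | nil => rfl
    | cons q L₂ =>
      have hq := h2 q (by simp)
      have h0 : q = [] := by simpa using (List.append_eq_nil_iff.1 h.symm).1
      exact absurd (h0 ▸ hq) hnil
  | cons p L₁ ih =>
    intro L₂ h1 h2 h
    cases L₂ with
    | nil =>
      have hp := h1 p (by simp)
      have h0 : p = [] := by simpa using (List.append_eq_nil_iff.1 h).1
      exact absurd (h0 ▸ hp) hnil
    | cons q L₂ =>
      have hp := h1 p (by simp)
      have hq := h2 q (by simp)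
      simp only [List.flatten_cons] at h
      have hpq : p = q := by
        rcases List.prefix_or_prefix_of_prefix (List.prefix_append p L₁.flatten)
          (h ▸ List.prefix_append q L₂.flatten) with h' | h'
        · exact hS p hp q hq h'
        · exact (hS q hq p hp h').symm
      subst hpq
      rw [ih L₂ (fun w hw => h1 w (by simp [hw])) (fun w hw => h2 w (by simp [hw]))
        (List.append_cancel_left h)]

theorem IsUniversalPrefixMachine.sum_two_pow_neg_kolmogorov_le {U : List Bool →. List Bool}
    (hU : IsUniversalPrefixMachine U) {ι : Type*} (S : Finset ι) {f : ι → List Bool}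
    (hf : Function.Injective f) : ∑ i ∈ S, (1 / 2 : ℝ) ^ kolmogorov U (f i) ≤ 1 := by
  classical
  choose p hp hpl using fun i => hU.exists_shortest_program (f i)
  have hinj : Function.Injective p := by
    intro i j hij
    have h := hp i
    rw [hij] at h
    exact hf (Part.mem_unique h (hp j))
  -- an empty program would be the only program, but `U` has more than one output
  have hnil : ∀ w, w ∉ U [] := by
    intro w hw
    obtain ⟨q, hq⟩ := hU.exists_program (true :: w)
    have h := hU.isPrefixMachine.prefixFree [] q (Part.dom_iff_mem.2 ⟨_, hw⟩)
      (Part.dom_iff_mem.2 ⟨_, hq⟩) List.nil_prefix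
    rw [← h] at hq
    have := congrArg List.length (Part.mem_unique hw hq)
    simp at this
  have hud : InformationTheory.UniquelyDecodable ((S.image p : Finset (List Bool)) :
      Set (List Bool)) := by
    apply uniquelyDecodable_of_prefixFree
    · intro h
      simp only [Finset.coe_image, Set.mem_image] at h
      obtain ⟨i, _, hi⟩ := h
      exact hnil (f i) (hi ▸ hp i)
    · intro q hq r hr hqr
      simp only [Finset.coe_image, Set.mem_image] at hq hr
      obtain ⟨i, _, rfl⟩ := hq
      obtain ⟨j, _, rfl⟩ := hr
      exact hU.isPrefixMachine.prefixFree _ _ (Part.dom_iff_mem.2 ⟨_, hp i⟩)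
        (Part.dom_iff_mem.2 ⟨_, hp j⟩) hqr
  have h := InformationTheory.kraft_mcmillan_inequality hud
  rw [Finset.sum_image hinj.injOn] at h
  simpa [hpl] using h

end Kraft

/-! ### Coding by empirical transition counts -/

section Types

/-- The number of positions `t < N` at which the `m + 1` base-`l` digits of `X` from `t` on form the
number `w`. -/
def windowCount (N l m X w : ℕ) : ℕ :=
  ((Finset.range N).filter fun t => X / l ^ t % l ^ (m + 1) = w).card

/-- A number that determines the transition counts of the word of length `n` over `{0, …, l - 1}`
with the base-`l` digits of `X`, together with the first `m` letters: the counts are digits in base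
`n + 1`. As their sum is known, the count of the window `0` is dropped. -/
def typeIndex (n l m X : ℕ) : ℕ :=
  X % l ^ m + l ^ m * ((∑ t ∈ Finset.range (n - m), (n + 1) ^ (X / l ^ t % l ^ (m + 1))) / (n + 1))

/-- The number of values allowed for `typeIndex`. -/
def typeBound (n l m : ℕ) : ℕ := l ^ m * (n + 1) ^ (l ^ (m + 1) - 1)

/-- The number of words with the same type as `X`. -/
def typeClassSize (n l m X : ℕ) : ℕ :=
  ∑ Y ∈ Finset.range (l ^ n), if typeIndex n l m Y = typeIndex n l m X then 1 else 0

/-- The reciprocal of the probability of `X` when the type is uniform among all types, and the word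
is uniform in its type class. -/
def typeWeight (n l m X : ℕ) : ℕ :=
  if 0 < l then if X < l ^ n then typeBound n l m * typeClassSize n l m X else 0 else 0

theorem primrec_typeWeight :
    Primrec fun x : (ℕ × ℕ × ℕ) × ℕ => typeWeight x.1.1 x.1.2.1 x.1.2.2 x.2 := by
  unfold typeWeight typeBound typeClassSize typeIndex
  fun_prop

theorem sum_mul_pow_lt {B k : ℕ} {c : ℕ → ℕ} (hc : ∀ w, c w < B) :
    ∑ w ∈ Finset.range k, c w * B ^ w < B ^ k := by
  induction k with
  | zero => simp
  | succ k ih =>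
    rw [Finset.sum_range_succ, pow_succ']
    have h : (c k + 1) * B ^ k ≤ B * B ^ k := Nat.mul_le_mul_right _ (hc k)
    rw [add_mul, one_mul] at h
    omega

theorem sum_mul_pow_div {B k : ℕ} {c : ℕ → ℕ} (hc : ∀ w, c w < B) :
    (∑ w ∈ Finset.range (k + 1), c w * B ^ w) / B = ∑ w ∈ Finset.range k, c (w + 1) * B ^ w := by
  have hB : 0 < B := (Nat.zero_le _).trans_lt (hc 0)
  rw [Finset.sum_range_succ']
  have h : ∀ w, c (w + 1) * B ^ (w + 1) = B * (c (w + 1) * B ^ w) := fun w => by ring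
  simp only [h, ← Finset.mul_sum, pow_zero, mul_one]
  rw [Nat.mul_add_div hB, Nat.div_eq_of_lt (hc 0), add_zero]

theorem eq_of_sum_mul_pow_eq {B : ℕ} : ∀ {k : ℕ} {c c' : ℕ → ℕ}, (∀ w, c w < B) →
    (∀ w, c' w < B) → ∑ w ∈ Finset.range k, c w * B ^ w = ∑ w ∈ Finset.range k, c' w * B ^ w →
    ∀ w < k, c w = c' w
  | 0, _, _, _, _, _, _, hw => absurd hw (Nat.not_lt_zero _)
  | k + 1, c, c', hc, hc', h, w, hw => by
    have h1 := congrArg (· / B) h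
    simp only [sum_mul_pow_div hc, sum_mul_pow_div hc'] at h1
    have ih := eq_of_sum_mul_pow_eq (fun w => hc (w + 1)) (fun w => hc' (w + 1)) h1
    rcases w with _ | w
    · rw [Finset.sum_range_succ', Finset.sum_range_succ' (fun w => c' w * B ^ w)] at h
      rw [Finset.sum_congr rfl fun w hw => by rw [ih w (Finset.mem_range.1 hw)]] at h
      simpa using h
    · exact ih w (by omega)

theorem sum_pow_window (n l m X N : ℕ) (hl : 0 < l) :
    ∑ t ∈ Finset.range N, (n + 1) ^ (X / l ^ t % l ^ (m + 1)) =
      ∑ w ∈ Finset.range (l ^ (m + 1)), windowCount N l m X w * (n + 1) ^ w := by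
  rw [← Finset.sum_fiberwise_of_maps_to (t := Finset.range (l ^ (m + 1)))
    (g := fun t => X / l ^ t % l ^ (m + 1))
    (fun t _ => Finset.mem_range.2 (Nat.mod_lt _ (by positivity)))]
  refine Finset.sum_congr rfl fun w _ => ?_
  rw [Finset.sum_congr rfl fun t ht => by rw [(Finset.mem_filter.1 ht).2], Finset.sum_const,
    smul_eq_mul, windowCount]

theorem windowCount_lt (n l m X w : ℕ) : windowCount (n - m) l m X w < n + 1 := by
  have h := Finset.card_filter_le (Finset.range (n - m)) fun t => X / l ^ t % l ^ (m + 1) = w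
  rw [Finset.card_range] at h
  unfold windowCount
  omega

theorem typeIndex_eq (n l m X : ℕ) (hl : 0 < l) : typeIndex n l m X = X % l ^ m + l ^ m *
    ∑ w ∈ Finset.range (l ^ (m + 1) - 1), windowCount (n - m) l m X (w + 1) * (n + 1) ^ w := by
  have hk : l ^ (m + 1) = l ^ (m + 1) - 1 + 1 := (Nat.sub_add_cancel (Nat.pow_pos hl)).symm
  rw [typeIndex, sum_pow_window n l m X _ hl]
  congr 2
  conv_lhs => rw [hk]
  exact sum_mul_pow_div (windowCount_lt n l m X)

theorem typeIndex_lt (n l m X : ℕ) (hl : 0 < l) : typeIndex n l m X < typeBound n l m := by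
  rw [typeIndex_eq n l m X hl, typeBound]
  have h1 := sum_mul_pow_lt (k := l ^ (m + 1) - 1) (fun w => windowCount_lt n l m X (w + 1))
  have h2 : X % l ^ m < l ^ m := Nat.mod_lt _ (Nat.pow_pos hl)
  calc _ < l ^ m * (∑ w ∈ Finset.range (l ^ (m + 1) - 1),
        windowCount (n - m) l m X (w + 1) * (n + 1) ^ w + 1) := by rw [mul_add, mul_one]; omega
    _ ≤ _ := Nat.mul_le_mul_left _ h1

theorem sum_windowCount (N l m X : ℕ) (hl : 0 < l) :
    ∑ w ∈ Finset.range (l ^ (m + 1)), windowCount N l m X w = N := by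
  have h := Finset.card_eq_sum_card_fiberwise (s := Finset.range N)
    (t := Finset.range (l ^ (m + 1))) (f := fun t => X / l ^ t % l ^ (m + 1))
    (fun t _ => by simpa using Nat.mod_lt _ (Nat.pow_pos hl))
  rw [Finset.card_range] at h
  exact h.symm

/-- The type index determines all the counts: those of the nonzero windows are its digits, and that
of the window `0` follows from the total number of windows. -/
theorem windowCount_eq_of_typeIndex_eq {n l m X Y : ℕ} (hl : 0 < l)
    (h : typeIndex n l m X = typeIndex n l m Y) :
    X % l ^ m = Y % l ^ m ∧
      ∀ w < l ^ (m + 1), windowCount (n - m) l m X w = windowCount (n - m) l m Y w := by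
  rw [typeIndex_eq n l m X hl, typeIndex_eq n l m Y hl] at h
  have hlm : 0 < l ^ m := Nat.pow_pos hl
  have h1 : X % l ^ m = Y % l ^ m := by
    have h' := congrArg (· % l ^ m) h
    simpa [Nat.add_mul_mod_self_left] using h'
  rw [h1, add_right_inj] at h
  have h3 := eq_of_sum_mul_pow_eq (fun w => windowCount_lt n l m X (w + 1))
    (fun w => windowCount_lt n l m Y (w + 1)) (Nat.eq_of_mul_eq_mul_left hlm h)
  have hk : l ^ (m + 1) = l ^ (m + 1) - 1 + 1 := (Nat.sub_add_cancel (Nat.pow_pos hl)).symm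
  refine ⟨h1, fun w hw => ?_⟩
  rcases w with _ | w
  · have hX := sum_windowCount (n - m) l m X hl
    have hY := sum_windowCount (n - m) l m Y hl
    rw [hk, Finset.sum_range_succ'] at hX hY
    rw [Finset.sum_congr rfl fun w hw => h3 w (Finset.mem_range.1 hw)] at hX
    omega
  · exact h3 w (by omega)

theorem sum_inv_typeWeight_le (n l m N : ℕ) :
    ∑ X ∈ Finset.range N, (typeWeight n l m X : ℝ)⁻¹ ≤ 1 := by
  rcases Nat.eq_zero_or_pos l with hl | hl
  · simp [typeWeight, hl]
  have hT : 0 < typeBound n l m := (Nat.zero_le _).trans_lt (typeIndex_lt n l m 0 hl)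
  have h1 : ∑ X ∈ Finset.range N, (typeWeight n l m X : ℝ)⁻¹ ≤
      ∑ X ∈ Finset.range (l ^ n), (typeWeight n l m X : ℝ)⁻¹ := by
    rw [← Finset.sum_filter_of_ne (s := Finset.range N) (p := fun X => X < l ^ n)]
    · refine Finset.sum_le_sum_of_subset_of_nonneg ?_ fun _ _ _ => by positivity
      intro X hX
      exact Finset.mem_range.2 (Finset.mem_filter.1 hX).2
    · intro X _ hX
      by_contra hlt
      simp [typeWeight, hlt] at hX
  refine h1.trans ?_
  rw [← Finset.sum_fiberwise_of_maps_to (t := Finset.range (typeBound n l m))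
    (g := fun X => typeIndex n l m X) (fun X _ => Finset.mem_range.2 (typeIndex_lt n l m X hl))]
  have h2 : ∀ s ∈ Finset.range (typeBound n l m),
      ∑ X ∈ (Finset.range (l ^ n)).filter (fun X => typeIndex n l m X = s),
        (typeWeight n l m X : ℝ)⁻¹ ≤ (typeBound n l m : ℝ)⁻¹ := by
    intro s _
    set F := (Finset.range (l ^ n)).filter (fun X => typeIndex n l m X = s) with hF
    have h3 : ∀ X ∈ F, (typeWeight n l m X : ℝ)⁻¹ = ((typeBound n l m : ℝ) * F.card)⁻¹ := by
      intro X hX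
      obtain ⟨hX1, hX2⟩ := Finset.mem_filter.1 hX
      rw [typeWeight, if_pos hl, if_pos (Finset.mem_range.1 hX1), typeClassSize, hX2, hF,
        Finset.card_filter]
      push_cast
      rfl
    rw [Finset.sum_congr rfl h3, Finset.sum_const, nsmul_eq_mul, mul_inv, mul_left_comm]
    have h4 : (F.card : ℝ) * (F.card : ℝ)⁻¹ ≤ 1 := mul_inv_le_one
    have h5 : (0 : ℝ) ≤ (typeBound n l m : ℝ)⁻¹ := by positivity
    nlinarith
  refine (Finset.sum_le_sum h2).trans ?_
  rw [Finset.sum_const, Finset.card_range, nsmul_eq_mul]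
  exact mul_inv_le_one

/-- The coding theorem for `typeWeight`: a word is described by its length, the alphabet size, the
order, its type and its position within the type class. -/
theorem IsUniversalPrefixMachine.exists_complexity_digits_le {U : List Bool →. List Bool}
    (hU : IsUniversalPrefixMachine U) :
    ∃ C : ℕ, ∀ n l m X : ℕ, 0 < l → X < l ^ n →
      (complexity U ((List.range n).map fun t => X / l ^ t % l) : ℝ) ≤
        logStar n + logStar l + logStar m + Real.logb 2 (typeBound n l m) +
          Real.logb 2 (typeClassSize n l m X) + C := by
  obtain ⟨C1, h1⟩ := hU.exists_complexity_le_log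
    (d := fun a : ℕ × ℕ × ℕ => typeWeight a.1 a.2.1 a.2.2) primrec_typeWeight
    fun a N => sum_inv_typeWeight_le a.1 a.2.1 a.2.2 N
  obtain ⟨C2, h2⟩ := hU.exists_complexity_nat_le
  obtain ⟨C3, h3⟩ := hU.exists_complexity_pair_le (α := ℕ) (β := ℕ × ℕ)
  obtain ⟨C4, h4⟩ := hU.exists_complexity_pair_le (α := ℕ) (β := ℕ)
  obtain ⟨C5, h5⟩ := hU.exists_complexity_map_le'
    (g := fun x : (ℕ × ℕ × ℕ) × ℕ => (List.range x.1.1).map fun t => x.2 / x.1.2.1 ^ t % x.1.2.1)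
    (Primrec.to_comp (by fun_prop))
  refine ⟨C1 + 3 * C2 + C3 + C4 + C5, fun n l m X hl hX => ?_⟩
  have hT : 0 < typeBound n l m := (Nat.zero_le _).trans_lt (typeIndex_lt n l m 0 hl)
  have hS : 0 < typeClassSize n l m X :=
    Finset.sum_pos' (fun _ _ => Nat.zero_le _) ⟨X, Finset.mem_range.2 hX, by simp⟩
  have hw : typeWeight n l m X = typeBound n l m * typeClassSize n l m X := by
    rw [typeWeight, if_pos hl, if_pos hX]
  have e1 := h1 (n, l, m) X (by simp only [hw]; positivity)
  have e3 := h3 n (l, m)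
  have e4 := h4 l m
  have e5 := h5 ((n, l, m), X)
  have e2n := h2 n
  have e2l := h2 l
  have e2m := h2 m
  have e6 := Real.natLog_le_logb (typeWeight n l m X) 2
  have hT' : (0 : ℝ) < typeBound n l m := by exact_mod_cast hT
  have hS' : (0 : ℝ) < typeClassSize n l m X := by exact_mod_cast hS
  rw [hw] at e6
  push_cast at e6
  rw [Real.logb_mul hT'.ne' hS'.ne'] at e6
  simp only [hw] at e1 e5
  have e7 : complexity U ((List.range n).map fun t => X / l ^ t % l) ≤
      complexity U n + complexity U l + complexity U m +
        Nat.log 2 (typeBound n l m * typeClassSize n l m X) + (C1 + C3 + C4 + C5) := by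
    omega
  have e8 : (complexity U ((List.range n).map fun t => X / l ^ t % l) : ℝ) ≤
      complexity U n + complexity U l + complexity U m +
        Nat.log 2 (typeBound n l m * typeClassSize n l m X) + (C1 + C3 + C4 + C5) := by
    exact_mod_cast e7
  push_cast
  linarith

end Types

/-! ### Averages over the cells of a partition of a finite probability space -/

section CellMean

variable {W : Type*} [Fintype W]

open Classical in
/-- The mass of the cell of `x` in the partition given by the equivalence relation `r`. -/
noncomputable def cellMass (p : W → ℝ) (r : W → W → Prop) (x : W) : ℝ :=
  ∑ y, if r x y then p y else 0

open Classical in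
/-- The mean of `g` over the cell of `x`: the conditional expectation of `g`, evaluated at `x`. -/
noncomputable def cellMean (p : W → ℝ) (r : W → W → Prop) (g : W → ℝ) (x : W) : ℝ :=
  (∑ y, if r x y then p y * g y else 0) / cellMass p r x

variable {p : W → ℝ} {r s : W → W → Prop}

theorem cellMass_pos (hp : ∀ y, 0 < p y) (hr : Equivalence r) (x : W) : 0 < cellMass p r x := by
  unfold cellMass
  refine Finset.sum_pos' (fun y _ => ?_) ⟨x, Finset.mem_univ x, ?_⟩
  · split_ifs
    · exact (hp y).le
    · exact le_rfl
  · rw [if_pos (hr.refl x)]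
    exact hp x

theorem cellMass_congr (hr : Equivalence r) {x y : W} (h : r x y) :
    cellMass p r x = cellMass p r y := by
  classical
  have : ∀ z, r x z ↔ r y z := fun z => ⟨hr.trans (hr.symm h), hr.trans h⟩
  exact Finset.sum_congr rfl fun z _ => if_congr (this z) rfl rfl

theorem cellMean_congr {g g' : W → ℝ} {x : W} (h : ∀ y, r x y → g y = g' y) :
    cellMean p r g x = cellMean p r g' x := by
  unfold cellMean
  congr 1
  refine Finset.sum_congr rfl fun y _ => ?_
  split_ifs with hy
  · rw [h y hy]
  · rfl

theorem cellMean_const (hp : ∀ y, 0 < p y) (hr : Equivalence r) (a : ℝ) (x : W) :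
    cellMean p r (fun _ => a) x = a := by
  classical
  have h := cellMass_pos hp hr x
  have h1 : (∑ y, if r x y then p y * a else 0) = cellMass p r x * a := by
    rw [cellMass, Finset.sum_mul]
    exact Finset.sum_congr rfl fun y _ => by split_ifs <;> simp
  unfold cellMean
  rw [h1, mul_div_cancel_left₀ _ h.ne']

theorem cellMean_add (g g' : W → ℝ) (x : W) :
    cellMean p r (fun y => g y + g' y) x = cellMean p r g x + cellMean p r g' x := by
  unfold cellMean
  rw [← add_div, ← Finset.sum_add_distrib]
  congr 1
  exact Finset.sum_congr rfl fun y _ => by split_ifs <;> ring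

theorem cellMean_const_mul (a : ℝ) (g : W → ℝ) (x : W) :
    cellMean p r (fun y => a * g y) x = a * cellMean p r g x := by
  unfold cellMean
  rw [← mul_div_assoc, Finset.mul_sum]
  congr 1
  exact Finset.sum_congr rfl fun y _ => by split_ifs <;> ring

theorem cellMean_sum {ι : Type*} (S : Finset ι) (g : ι → W → ℝ) (x : W) :
    cellMean p r (fun y => ∑ j ∈ S, g j y) x = ∑ j ∈ S, cellMean p r (g j) x := by
  classical
  induction S using Finset.induction_on with
  | empty => simp [cellMean]
  | insert a S ha ih =>
    simp only [Finset.sum_insert ha]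
    rw [cellMean_add, ih]

theorem cellMean_mono (hp : ∀ y, 0 < p y) (hr : Equivalence r) {g g' : W → ℝ} {x : W}
    (h : ∀ y, r x y → g y ≤ g' y) : cellMean p r g x ≤ cellMean p r g' x := by
  unfold cellMean
  have := cellMass_pos hp hr x
  gcongr with y _
  split_ifs with hy
  · exact mul_le_mul_of_nonneg_left (h y hy) (hp y).le
  · exact le_rfl

theorem cellMean_tower (hp : ∀ y, 0 < p y) (hr : Equivalence r) (hs : Equivalence s)
    (hsr : ∀ x y, s x y → r x y) (g : W → ℝ) (x : W) :
    cellMean p r (cellMean p s g) x = cellMean p r g x := by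
  classical
  unfold cellMean
  congr 1
  have h1 : ∀ y, (if r x y then p y * ((∑ z, if s y z then p z * g z else 0) / cellMass p s y)
      else 0) = ∑ z, if r x z then (if s z y then p y else 0) * (p z * g z) / cellMass p s z
        else 0 := by
    intro y
    split_ifs with hy
    · rw [← mul_div_assoc, Finset.mul_sum, Finset.sum_div]
      refine Finset.sum_congr rfl fun z _ => ?_
      by_cases hz : s y z
      · rw [if_pos hz, if_pos (hr.trans hy (hsr _ _ hz)), if_pos (hs.symm hz),
          cellMass_congr hs hz]
      · rw [if_neg hz, if_neg fun h => hz (hs.symm h)]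
        simp
    · symm
      refine Finset.sum_eq_zero fun z _ => ?_
      by_cases hz : s z y
      · rw [if_neg fun h => hy (hr.trans h (hsr _ _ hz))]
      · simp [hz]
  simp only [h1]
  rw [Finset.sum_comm]
  refine Finset.sum_congr rfl fun z _ => ?_
  split_ifs with hz
  · rw [← Finset.sum_div, ← Finset.sum_mul]
    have h := cellMass_pos hp hs z
    change cellMass p s z * (p z * g z) / cellMass p s z = _
    rw [mul_div_cancel_left₀ _ h.ne']
  · simp

theorem cellMean_top (hsum : ∑ y, p y = 1) (g : W → ℝ) (x : W) :
    cellMean p (fun _ _ => True) g x = ∑ y, p y * g y := by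
  simp [cellMean, cellMass, hsum]

theorem sum_mul_cellMean (hp : ∀ y, 0 < p y) (hsum : ∑ y, p y = 1) (hs : Equivalence s)
    (g : W → ℝ) : ∑ x, p x * cellMean p s g x = ∑ x, p x * g x := by
  rcases isEmpty_or_nonempty W with hW | ⟨⟨x⟩⟩
  · simp
  rw [← cellMean_top hsum _ x, ← cellMean_top hsum _ x]
  exact cellMean_tower hp ⟨fun _ => trivial, fun _ => trivial, fun _ _ => trivial⟩ hs
    (fun _ _ _ => trivial) g x

/-- Hoeffding's lemma in a cell on which `g` oscillates by at most `b`. -/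
theorem cellMean_exp_le (hp : ∀ y, 0 < p y) (hr : Equivalence r) {g : W → ℝ} {x : W} {b : ℝ}
    (hb : 0 ≤ b) (h : ∀ y z, r x y → r x z → |g y - g z| ≤ b) (a : ℝ) :
    cellMean p r (fun y => Real.exp (a * g y)) x ≤
      Real.exp ((a * b) ^ 2 / 2) * Real.exp (a * cellMean p r g x) := by
  set μ := cellMean p r g x with hμ
  have hdev : ∀ y, r x y → |g y - μ| ≤ b := by
    intro y hy
    rw [abs_le]
    have h1 : cellMean p r g x ≤ cellMean p r (fun _ => g y + b) x :=
      cellMean_mono hp hr fun z hz => by have := abs_le.1 (h y z hy hz); linarith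
    have h2 : cellMean p r (fun _ => g y - b) x ≤ cellMean p r g x :=
      cellMean_mono hp hr fun z hz => by have := abs_le.1 (h y z hy hz); linarith
    rw [cellMean_const hp hr] at h1 h2
    constructor <;> linarith
  rcases hb.eq_or_lt with rfl | hb
  · rw [cellMean_congr (g' := fun _ => Real.exp (a * μ)) fun y hy => by
      have := abs_nonpos_iff.1 (hdev y hy)
      rw [sub_eq_zero.1 this], cellMean_const hp hr]
    simp
  · have h1 : ∀ y, r x y → Real.exp (a * g y) ≤ Real.exp (a * μ) * Real.cosh (a * b) +
        Real.exp (a * μ) * (Real.sinh (a * b) / b) * (g y + -μ) := by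
      intro y hy
      have h2 := Real.exp_mul_le_cosh_add_mul_sinh (t := (g y - μ) / b) (by
        rw [abs_div, abs_of_pos hb, div_le_one hb]
        exact hdev y hy) (a * b)
      have h3 : Real.exp (a * g y) =
          Real.exp (a * μ) * Real.exp ((g y - μ) / b * (a * b)) := by
        rw [← Real.exp_add]
        congr 1
        field_simp
        ring
      rw [h3]
      refine (mul_le_mul_of_nonneg_left h2 (Real.exp_pos _).le).trans (le_of_eq ?_)
      ring
    refine (cellMean_mono hp hr h1).trans ?_
    rw [cellMean_add, cellMean_const hp hr, cellMean_const_mul, cellMean_add,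
      cellMean_const hp hr, ← hμ, add_neg_cancel, mul_zero, add_zero, mul_comm]
    exact mul_le_mul_of_nonneg_right (Real.cosh_le_exp_half_sq _) (Real.exp_pos _).le

end CellMean

/-! ### Concentration for functions of words -/

section Concentration

variable {A : Type*} {n : ℕ}

/-- The words `x` and `y` have the same first `i` letters. -/
def AgreeBelow (i : ℕ) (x y : Fin n → A) : Prop := ∀ k : Fin n, (k : ℕ) < i → x k = y k

theorem agreeBelow_equivalence (i : ℕ) : Equivalence (AgreeBelow (A := A) (n := n) i) :=
  ⟨fun _ _ _ => rfl, fun h k hk => (h k hk).symm, fun h h' k hk => (h k hk).trans (h' k hk)⟩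

variable [Fintype A]

/-- Azuma's inequality for the Doob martingale `i ↦ E [f | first i letters]`. -/
theorem sum_mul_exp_le {p : (Fin n → A) → ℝ} (hp : ∀ y, 0 < p y) (hsum : ∑ y, p y = 1)
    {f : (Fin n → A) → ℝ} {b : ℝ} (hb : 0 ≤ b)
    (hf : ∀ i < n, ∀ z z', AgreeBelow i z z' →
      |cellMean p (AgreeBelow (i + 1)) f z - cellMean p (AgreeBelow (i + 1)) f z'| ≤ b) (a : ℝ) :
    ∑ y, p y * Real.exp (a * f y) ≤
      Real.exp (n * ((a * b) ^ 2 / 2)) * Real.exp (a * ∑ y, p y * f y) := by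
  have key : ∀ i ≤ n, ∑ y, p y * Real.exp (a * cellMean p (AgreeBelow i) f y) ≤
      Real.exp (i * ((a * b) ^ 2 / 2)) * Real.exp (a * ∑ y, p y * f y) := by
    intro i
    induction i with
    | zero =>
      intro _
      have h : ∀ y, cellMean p (AgreeBelow 0) f y = ∑ y, p y * f y := by
        intro y
        have h0 : AgreeBelow (A := A) (n := n) 0 = fun _ _ => True := by
          funext x y
          simp [AgreeBelow]
        rw [h0, cellMean_top hsum]
      simp only [h]
      rw [← Finset.sum_mul, hsum]
      simp
    | succ i ih =>
      intro hi
      rw [← sum_mul_cellMean hp hsum (agreeBelow_equivalence i)]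
      have hstep : ∀ y, cellMean p (AgreeBelow i)
          (fun y => Real.exp (a * cellMean p (AgreeBelow (i + 1)) f y)) y ≤
          Real.exp ((a * b) ^ 2 / 2) * Real.exp (a * cellMean p (AgreeBelow i) f y) := by
        intro y
        have h := cellMean_exp_le hp (agreeBelow_equivalence i) (x := y) hb
          (g := cellMean p (AgreeBelow (i + 1)) f) (fun z z' hz hz' => hf i (by omega) z z'
            ((agreeBelow_equivalence i).trans ((agreeBelow_equivalence i).symm hz) hz')) a
        rwa [cellMean_tower hp (agreeBelow_equivalence i) (agreeBelow_equivalence (i + 1))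
          (fun x y h k hk => h k (by omega))] at h
      calc _ ≤ ∑ y, p y * (Real.exp ((a * b) ^ 2 / 2) *
            Real.exp (a * cellMean p (AgreeBelow i) f y)) :=
            Finset.sum_le_sum fun y _ => mul_le_mul_of_nonneg_left (hstep y) (hp y).le
        _ = Real.exp ((a * b) ^ 2 / 2) *
            ∑ y, p y * Real.exp (a * cellMean p (AgreeBelow i) f y) := by
            rw [Finset.mul_sum]
            exact Finset.sum_congr rfl fun y _ => by ring
        _ ≤ Real.exp ((a * b) ^ 2 / 2) * (Real.exp (i * ((a * b) ^ 2 / 2)) *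
            Real.exp (a * ∑ y, p y * f y)) :=
            mul_le_mul_of_nonneg_left (ih (by omega)) (Real.exp_pos _).le
        _ = _ := by
            rw [← mul_assoc, ← Real.exp_add]
            push_cast
            ring_nf
  have hn : ∀ y, cellMean p (AgreeBelow n) f y = f y := by
    intro y
    rw [cellMean_congr (g' := fun _ => f y), cellMean_const hp (agreeBelow_equivalence n)]
    intro z hz
    rw [show y = z from funext fun k => hz k k.2]
  have h := key n le_rfl
  simpa only [hn] using h

open Classical in
/-- The Chernoff bound for `sum_mul_exp_le`: a function whose conditional means move by at most `b`
when one more letter is revealed is subgaussian. -/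
theorem sum_tail_le {p : (Fin n → A) → ℝ} (hp : ∀ y, 0 < p y) (hsum : ∑ y, p y = 1)
    {f : (Fin n → A) → ℝ} {b : ℝ} (hb : 0 ≤ b) (hn : 1 ≤ n)
    (hf : ∀ i < n, ∀ z z', AgreeBelow i z z' →
      |cellMean p (AgreeBelow (i + 1)) f z - cellMean p (AgreeBelow (i + 1)) f z'| ≤ b)
    {s : ℝ} (hs : 0 < s) :
    ∑ y with s ≤ f y - ∑ y, p y * f y, p y ≤ expNegDiv (s ^ 2) (2 * n * b ^ 2) := by
  set μ := ∑ y, p y * f y with hμ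
  have chernoff : ∀ a : ℝ, 0 ≤ a → ∑ y with s ≤ f y - μ, p y ≤
      Real.exp (n * ((a * b) ^ 2 / 2) - a * s) := by
    intro a ha
    have h1 := sum_mul_exp_le hp hsum hb hf a
    have h2 : (∑ y with s ≤ f y - μ, p y) * Real.exp (a * (μ + s)) ≤
        ∑ y, p y * Real.exp (a * f y) := by
      rw [Finset.sum_mul]
      refine le_trans (Finset.sum_le_sum fun y hy => ?_)
        (Finset.sum_le_sum_of_subset_of_nonneg (Finset.filter_subset _ _) fun y _ _ =>
          mul_nonneg (hp y).le (Real.exp_pos _).le)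
      have hy' := (Finset.mem_filter.1 hy).2
      exact mul_le_mul_of_nonneg_left
        (Real.exp_le_exp.2 (mul_le_mul_of_nonneg_left (by linarith) ha)) (hp y).le
    have h3 := h2.trans h1
    rw [← le_div_iff₀ (Real.exp_pos _), ← Real.exp_add, ← Real.exp_sub] at h3
    refine h3.trans (le_of_eq ?_)
    rw [← hμ]
    ring_nf
  have hn0 : (0 : ℝ) < n := by exact_mod_cast hn
  unfold expNegDiv
  rcases hb.eq_or_lt with rfl | hb
  · rw [if_pos (by simp)]
    have hlim : Tendsto (fun a : ℝ => Real.exp (n * ((a * 0) ^ 2 / 2) - a * s)) atTop (𝓝 0) := by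
      refine Real.tendsto_exp_atBot.comp ?_
      have h : (fun a : ℝ => (n : ℝ) * ((a * 0) ^ 2 / 2) - a * s) = fun a => -(a * s) := by
        funext a
        ring
      rw [h]
      exact tendsto_neg_atTop_atBot.comp (tendsto_id.atTop_mul_const hs)
    refine ge_of_tendsto hlim ?_
    filter_upwards [eventually_ge_atTop 0] with a ha using chernoff a ha
  · rw [if_neg (by positivity)]
    -- the exponent is smallest at `a = s / (n b²)`
    refine (chernoff (s / (n * b ^ 2)) (by positivity)).trans (le_of_eq ?_)
    congr 1
    field_simp
    ring

/-- The word with the first `j` letters of `x` and the other letters of `y`. -/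
def glue (j : ℕ) (x y : Fin n → A) : Fin n → A := fun k => if (k : ℕ) < j then x k else y k

/-- The increments of the Doob martingale of a function with bounded differences `c`, when
conditioning on the first `i` letters changes the mean of a function of the letters after the first
`j` by at most `2 φ (j + 1 - i)` times its bound. Replacing the letters after the revealed ones one
by one decomposes `f` into such functions. -/
theorem abs_cellMean_sub_le {p : (Fin n → A) → ℝ} (hp : ∀ y, 0 < p y) (hsum : ∑ y, p y = 1)
    {φ : ℕ → ℝ} {c S : ℝ} (hS : ∀ N, ∑ k ∈ Finset.range N, φ (k + 1) ≤ S)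
    (hmix : ∀ i j, i ≤ j → j < n → ∀ x, ∀ g : (Fin n → A) → ℝ, (∀ y, |g y| ≤ c) →
      (∀ y y', (∀ k : Fin n, j ≤ k → y k = y' k) → g y = g y') →
      |cellMean p (AgreeBelow i) g x - ∑ y, p y * g y| ≤ 2 * c * φ (j + 1 - i))
    {f : (Fin n → A) → ℝ} (hc : 0 ≤ c)
    (hf : ∀ y y' k, (∀ j, j ≠ k → y j = y' j) → |f y - f y'| ≤ c)
    {i : ℕ} (hi : i < n) {z z' : Fin n → A} (hz : AgreeBelow i z z') :
    |cellMean p (AgreeBelow (i + 1)) f z - cellMean p (AgreeBelow (i + 1)) f z'| ≤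
      c * (1 + 4 * S) := by
  have decouple : ∀ x, |cellMean p (AgreeBelow (i + 1)) f x -
      ∑ y, p y * f (glue (i + 1) x y)| ≤ 2 * c * S := by
    intro x
    set g : ℕ → (Fin n → A) → ℝ := fun j y => f (glue j x y) - f (glue (j + 1) x y) with hg
    have hglue : ∀ y, f (glue (i + 1) x y) = f x + ∑ j ∈ Finset.Ico (i + 1) n, g j y := by
      intro y
      have h := Finset.sum_Ico_sub (fun j => f (glue j x y)) (show i + 1 ≤ n by omega)
      have h1 : ∑ j ∈ Finset.Ico (i + 1) n, g j y =
          -∑ j ∈ Finset.Ico (i + 1) n, (f (glue (j + 1) x y) - f (glue j x y)) := by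
        rw [← Finset.sum_neg_distrib]
        exact Finset.sum_congr rfl fun j _ => by simp [hg]
      have h2 : glue n x y = x := funext fun k => if_pos k.2
      rw [h1, h, h2]
      ring
    have h1 : cellMean p (AgreeBelow (i + 1)) f x =
        cellMean p (AgreeBelow (i + 1)) (fun y => f (glue (i + 1) x y)) x := by
      refine cellMean_congr fun y hy => ?_
      congr 1
      funext k
      unfold glue
      split_ifs with hk
      · exact (hy k hk).symm
      · rfl
    have h2 : ∑ y, p y * f (glue (i + 1) x y) =
        f x + ∑ j ∈ Finset.Ico (i + 1) n, ∑ y, p y * g j y := by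
      simp only [hglue, mul_add, Finset.sum_add_distrib, ← Finset.sum_mul, hsum, one_mul,
        Finset.mul_sum]
      rw [Finset.sum_comm]
    rw [h1, h2]
    simp only [hglue]
    rw [cellMean_add, cellMean_const hp (agreeBelow_equivalence _), cellMean_sum,
      add_sub_add_left_eq_sub, ← Finset.sum_sub_distrib]
    refine (Finset.abs_sum_le_sum_abs _ _).trans ?_
    have hterm : ∀ j ∈ Finset.Ico (i + 1) n, |cellMean p (AgreeBelow (i + 1)) (g j) x -
        ∑ y, p y * g j y| ≤ 2 * c * φ (j + 1 - (i + 1)) := by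
      intro j hj
      rw [Finset.mem_Ico] at hj
      refine hmix (i + 1) j hj.1 hj.2 x (g j) (fun y => ?_) fun y y' hyy => ?_
      · refine hf _ _ ⟨j, hj.2⟩ fun k hk => ?_
        have hk' : (k : ℕ) ≠ j := fun h => hk (Fin.ext h)
        unfold glue
        by_cases h : (k : ℕ) < j
        · rw [if_pos h, if_pos (by omega)]
        · rw [if_neg h, if_neg (by omega)]
      · have h3 : ∀ j', j ≤ j' → glue j' x y = glue j' x y' := by
          intro j' hj'
          funext k
          unfold glue
          split_ifs with hk
          · rfl
          · exact hyy k (by omega)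
        simp only [hg, h3 j le_rfl, h3 (j + 1) (Nat.le_succ j)]
    refine (Finset.sum_le_sum hterm).trans ?_
    rw [← Finset.mul_sum, Finset.sum_Ico_eq_sum_range]
    refine mul_le_mul_of_nonneg_left (le_trans (le_of_eq ?_) (hS (n - (i + 1)))) (by linarith)
    exact Finset.sum_congr rfl fun k _ => by congr 1; omega
  have hmid : |∑ y, p y * f (glue (i + 1) z y) - ∑ y, p y * f (glue (i + 1) z' y)| ≤ c := by
    rw [← Finset.sum_sub_distrib]
    refine (Finset.abs_sum_le_sum_abs _ _).trans ?_
    calc _ ≤ ∑ y, p y * c := by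
          refine Finset.sum_le_sum fun y _ => ?_
          rw [← mul_sub, abs_mul, abs_of_pos (hp y)]
          refine mul_le_mul_of_nonneg_left (hf _ _ ⟨i, hi⟩ fun k hk => ?_) (hp y).le
          have hk' : (k : ℕ) ≠ i := fun h => hk (Fin.ext h)
          unfold glue
          split_ifs with h
          · exact hz k (by omega)
          · rfl
      _ = c := by rw [← Finset.sum_mul, hsum, one_mul]
  have hd := decouple z
  have hd' := decouple z'
  rw [abs_le] at *
  constructor <;> linarith [hd.1, hd.2, hd'.1, hd'.2, hmid.1, hmid.2]

end Concentration

/-! ### Concentration under `φ`-mixing -/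

section Mixing

variable {Ω : Type v} {A : Type u} [MeasurableSpace A] {X : ℤ → Ω → A}

theorem measurable_sigmaOf {I : Set ℤ} {i : ℤ} (hi : i ∈ I) : Measurable[sigmaOf X I] (X i) := by
  rw [measurable_iff_comap_le]
  exact le_iSup₂_of_le i hi le_rfl

variable [MeasurableSpace Ω] {P : Measure Ω}

theorem sigmaOf_le (hX : ∀ i, Measurable (X i)) (I : Set ℤ) : sigmaOf X I ≤ ‹MeasurableSpace Ω› :=
  iSup₂_le fun i _ => (hX i).comap_le

theorem measurable_wordOf (hX : ∀ i, Measurable (X i)) (n : ℕ) : Measurable (wordOf X n) :=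
  measurable_pi_iff.2 fun _ => hX _

theorem measureReal_cond {E : Set Ω} (hE : MeasurableSet E) (B : Set Ω) :
    P[|E].real B = P.real (E ∩ B) / P.real E := by
  rw [Measure.real, cond_apply hE, ENNReal.toReal_mul, ENNReal.toReal_inv, inv_mul_eq_div]
  rfl

theorem bddAbove_phiMixing (P : Measure Ω) [IsProbabilityMeasure P] (X : ℤ → Ω → A) (k : ℕ) :
    BddAbove {r | ∃ (j : ℤ) (E B : Set Ω), MeasurableSet[sigmaOf X (Set.Iic j)] E ∧ P E ≠ 0 ∧
      MeasurableSet[sigmaOf X (Set.Ici (j + k))] B ∧ r = |P[|E].real B - P.real B|} := by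
  refine ⟨1, ?_⟩
  rintro r ⟨j, E, B, _, hE, _, rfl⟩
  have : IsProbabilityMeasure P[|E] := cond_isProbabilityMeasure hE
  have h1 : P[|E].real B ≤ 1 := measureReal_le_one
  have h2 : P.real B ≤ 1 := measureReal_le_one
  have h3 : 0 ≤ P[|E].real B := measureReal_nonneg
  have h4 : 0 ≤ P.real B := measureReal_nonneg
  rw [abs_le]
  constructor <;> linarith

theorem abs_cond_sub_le_phiMixing [IsProbabilityMeasure P] {j : ℤ} {k : ℕ} {E B : Set Ω}
    (hE : MeasurableSet[sigmaOf X (Set.Iic j)] E) (hE0 : P E ≠ 0)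
    (hB : MeasurableSet[sigmaOf X (Set.Ici (j + k))] B) :
    |P[|E].real B - P.real B| ≤ phiMixing P X k :=
  le_csSup (bddAbove_phiMixing P X k) ⟨j, E, B, hE, hE0, hB, rfl⟩

theorem phiMixing_nonneg (k : ℕ) : 0 ≤ phiMixing P X k := by
  refine Real.sSup_nonneg ?_
  rintro r ⟨j, E, B, _, _, _, rfl⟩
  exact abs_nonneg _

theorem one_le_mixingConst : 1 ≤ mixingConst P X := by
  have : 0 ≤ ∑' k, phiMixing P X k := tsum_nonneg phiMixing_nonneg
  unfold mixingConst
  linarith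

variable [Fintype A] [MeasurableSingletonClass A]

open Classical in
theorem measureReal_wordOf [IsFiniteMeasure P] (hX : ∀ i, Measurable (X i)) {n : ℕ}
    (Q : (Fin n → A) → Prop) :
    P.real {ω | Q (wordOf X n ω)} = ∑ x, if Q x then wordProb P X x else 0 := by
  rw [← Finset.sum_filter]
  have h : {ω | Q (wordOf X n ω)} =
      ⋃ x ∈ Finset.univ.filter Q, {ω | wordOf X n ω = x} := by
    ext ω
    simp
  rw [h, measureReal_biUnion_finset]
  · rfl
  · intro x _ y _ hxy
    rw [Function.onFun, Set.disjoint_left]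
    intro ω h1 h2
    exact hxy (h1.symm.trans h2)
  · intro x _
    exact measurable_wordOf hX n (measurableSet_singleton x)

theorem sum_wordProb [IsProbabilityMeasure P] (hX : ∀ i, Measurable (X i)) (n : ℕ) :
    ∑ x : Fin n → A, wordProb P X x = 1 := by
  have h := measureReal_wordOf (P := P) hX (n := n) fun _ => True
  simpa using h.symm

/-- Conditioning on the first `i` letters changes the mean of a function of the letters after the
`j`-th by at most twice the mixing coefficient times its bound. -/
theorem abs_cellMean_sub_le_phiMixing [IsProbabilityMeasure P]
    (hX : ∀ i, Measurable (X i)) {n : ℕ}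
    (hpos : ∀ x : Fin n → A, 0 < wordProb P X x) {i j : ℕ} (hij : i ≤ j)
    (x : Fin n → A) {c : ℝ} {g : (Fin n → A) → ℝ} (hg : ∀ y, |g y| ≤ c)
    (hdep : ∀ y y', (∀ k : Fin n, j ≤ k → y k = y' k) → g y = g y') :
    |cellMean (wordProb P X) (AgreeBelow i) g x - ∑ y, wordProb P X y * g y| ≤
      2 * c * phiMixing P X (j + 1 - i) := by
  classical
  set p : (Fin n → A) → ℝ := wordProb P X with hp
  set D : ((Fin n → A) → ℝ) → ℝ :=
    fun h => cellMean p (AgreeBelow i) h x - ∑ y, p y * h y with hD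
  have hc : 0 ≤ c := (abs_nonneg _).trans (hg x)
  have hevent : ∀ T : Set (Fin n → A),
      |D fun y => if glue j x y ∈ T then 1 else 0| ≤ phiMixing P X (j + 1 - i) := by
    intro T
    set E : Set Ω := {ω | AgreeBelow i x (wordOf X n ω)} with hE
    set B : Set Ω := {ω | glue j x (wordOf X n ω) ∈ T} with hB
    have hEm : MeasurableSet[sigmaOf X (Set.Iic (i : ℤ))] E := by
      have h : E = ⋂ k : Fin n, {ω | (k : ℕ) < i → x k = X ((k : ℤ) + 1) ω} := by
        ext ω
        simp [hE, AgreeBelow, wordOf]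
      rw [h]
      refine MeasurableSet.iInter fun k => ?_
      by_cases hk : (k : ℕ) < i
      · have hm : Measurable[sigmaOf X (Set.Iic (i : ℤ))] (X ((k : ℤ) + 1)) :=
          measurable_sigmaOf (by rw [Set.mem_Iic]; omega)
        have h2 : {ω | (k : ℕ) < i → x k = X ((k : ℤ) + 1) ω} = X ((k : ℤ) + 1) ⁻¹' {x k} := by
          ext ω
          simp [hk, eq_comm]
        rw [h2]
        exact hm (measurableSet_singleton _)
      · have h2 : {ω | (k : ℕ) < i → x k = X ((k : ℤ) + 1) ω} = Set.univ := by
          ext ω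
          simp [hk]
        rw [h2]
        exact MeasurableSet.univ
    have hBm : MeasurableSet[sigmaOf X (Set.Ici ((i : ℤ) + (j + 1 - i : ℕ)))] B := by
      have hm : Measurable[sigmaOf X (Set.Ici ((i : ℤ) + (j + 1 - i : ℕ)))]
          fun ω => glue j x (wordOf X n ω) := by
        refine @measurable_pi_lambda Ω (Fin n) (fun _ => A) (_) _ _ fun k => ?_
        unfold glue
        split_ifs with hk
        · exact measurable_const
        · exact measurable_sigmaOf (by rw [Set.mem_Ici]; omega)
      exact hm (Set.toFinite T).measurableSet
    have hEreal : P.real E = cellMass p (AgreeBelow i) x := by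
      rw [cellMass, hE, measureReal_wordOf hX]
    have hE0 : 0 < P.real E := by
      rw [hEreal]
      exact cellMass_pos hpos (agreeBelow_equivalence i) x
    have h := abs_cond_sub_le_phiMixing (P := P) hEm
      (fun h0 => hE0.ne' (by simp [Measure.real, h0])) hBm
    refine le_trans (le_of_eq ?_) h
    have h1 : P[|E].real B = cellMean p (AgreeBelow i)
        (fun y => if glue j x y ∈ T then 1 else 0) x := by
      rw [measureReal_cond (sigmaOf_le hX _ _ hEm), hEreal, cellMean]
      congr 1
      have h2 : E ∩ B = {ω | AgreeBelow i x (wordOf X n ω) ∧ glue j x (wordOf X n ω) ∈ T} := rfl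
      rw [h2, measureReal_wordOf hX fun y => AgreeBelow i x y ∧ glue j x y ∈ T]
      refine Finset.sum_congr rfl fun y _ => ?_
      by_cases h3 : AgreeBelow i x y <;> by_cases h4 : glue j x y ∈ T <;> simp [h3, h4, hp]
    have h2 : P.real B = ∑ y, p y * if glue j x y ∈ T then 1 else 0 := by
      rw [hB, measureReal_wordOf hX fun y => glue j x y ∈ T]
      refine Finset.sum_congr rfl fun y _ => ?_
      split_ifs <;> simp [hp]
    rw [h1, h2]
  have hDsum : ∀ a : (Fin n → A) → ℝ, ∀ S : Finset (Fin n → A),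
      D (fun y => ∑ w ∈ S, a w * if glue j x y = w then 1 else 0) =
        ∑ w ∈ S, a w * D fun y => if glue j x y = w then 1 else 0 := by
    intro a S
    simp only [hD]
    rw [cellMean_sum]
    simp only [cellMean_const_mul, Finset.mul_sum, mul_sub, Finset.sum_sub_distrib]
    congr 1
    rw [Finset.sum_comm]
    refine Finset.sum_congr rfl fun w _ => Finset.sum_congr rfl fun y _ => ?_
    ring
  set d : (Fin n → A) → ℝ := fun w => D fun y => if glue j x y = w then 1 else 0 with hd
  have hgeq : g = fun y => ∑ w, g w * if glue j x y = w then 1 else 0 := by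
    funext y
    have : g y = g (glue j x y) := hdep _ _ fun k hk => by
      unfold glue
      rw [if_neg (by omega)]
    simp [this]
  have hset : ∀ S : Finset (Fin n → A), |∑ w ∈ S, d w| ≤ phiMixing P X (j + 1 - i) := by
    intro S
    have h := hevent (S : Set (Fin n → A))
    have h1 := hDsum (fun _ => 1) S
    simp only [one_mul, Finset.sum_ite_eq] at h1
    rw [hd, ← h1]
    simpa using h
  change |D g| ≤ _
  rw [hgeq, hDsum]
  -- split the words according to the sign of `d`
  calc |∑ w, g w * d w| ≤ ∑ w, c * |d w| := by
        refine (Finset.abs_sum_le_sum_abs _ _).trans (Finset.sum_le_sum fun w _ => ?_)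
        rw [abs_mul]
        exact mul_le_mul_of_nonneg_right (hg w) (abs_nonneg _)
    _ = c * (∑ w with 0 ≤ d w, d w - ∑ w with ¬0 ≤ d w, d w) := by
        rw [← Finset.mul_sum, ← Finset.sum_filter_add_sum_filter_not Finset.univ (fun w => 0 ≤ d w),
          sub_eq_add_neg, ← Finset.sum_neg_distrib]
        congr 2
        · exact Finset.sum_congr rfl fun w hw => abs_of_nonneg (Finset.mem_filter.1 hw).2
        · exact Finset.sum_congr rfl fun w hw =>
            abs_of_neg (not_le.1 (Finset.mem_filter.1 hw).2)
    _ ≤ c * (2 * phiMixing P X (j + 1 - i)) := by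
        refine mul_le_mul_of_nonneg_left ?_ hc
        have h1 := abs_le.1 (hset (Finset.univ.filter fun w => 0 ≤ d w))
        have h2 := abs_le.1 (hset (Finset.univ.filter fun w => ¬0 ≤ d w))
        linarith [h1.2, h2.1]
    _ = _ := by ring

/-- Concentration of a function with bounded differences `c` of the letters of a `φ`-mixing
process. -/
theorem measureReal_deviation_le [IsProbabilityMeasure P] (hX : ∀ i, Measurable (X i))
    (hφ : Summable (phiMixing P X))
    {n : ℕ} (hn : 1 ≤ n) (hpos : ∀ x : Fin n → A, 0 < wordProb P X x) {f : (Fin n → A) → ℝ} {c : ℝ}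
    (hc : 0 ≤ c) (hf : ∀ y y' k, (∀ j, j ≠ k → y j = y' j) → |f y - f y'| ≤ c)
    {s : ℝ} (hs : 0 < s) :
    P.real {ω | s ≤ f (wordOf X n ω) - ∑ y, wordProb P X y * f y} ≤
      expNegDiv (s ^ 2) (2 * n * (c * mixingConst P X) ^ 2) := by
  classical
  have hS : ∀ N, ∑ k ∈ Finset.range N, phiMixing P X (k + 1) ≤ ∑' k, phiMixing P X k := by
    intro N
    have h := hφ.sum_le_tsum (Finset.range (N + 1)) fun k _ => phiMixing_nonneg k
    rw [Finset.sum_range_succ'] at h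
    linarith [phiMixing_nonneg (P := P) (X := X) 0]
  have htsum : 0 ≤ ∑' k, phiMixing P X k := tsum_nonneg phiMixing_nonneg
  have h := sum_tail_le hpos (sum_wordProb hX n) (f := f) (b := c * mixingConst P X)
    (mul_nonneg hc (zero_le_one.trans one_le_mixingConst)) hn (by
      intro i hi z z' hz
      refine (abs_cellMean_sub_le hpos (sum_wordProb hX n) hS (fun i j hij hj x g hg hdep =>
        abs_cellMean_sub_le_phiMixing hX hpos hij x hg hdep) hc hf hi hz).trans ?_
      refine mul_le_mul_of_nonneg_left ?_ hc
      unfold mixingConst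
      linarith) hs
  rw [measureReal_wordOf hX fun y => s ≤ f y - ∑ y, wordProb P X y * f y, ← Finset.sum_filter]
  convert h

end Mixing

/-! ### Word probabilities of stationary Markov processes -/

section Words

variable {Ω : Type v} {A : Type u} {X : ℤ → Ω → A}

theorem sum_fin_snoc [Fintype A] {n : ℕ} (F : (Fin (n + 1) → A) → ℝ) :
    ∑ y, F y = ∑ x : Fin n → A, ∑ a, F (Fin.snoc x a) := by
  rw [← (Fin.snocEquiv fun _ : Fin (n + 1) => A).sum_comp, Fintype.sum_prod_type,
    Finset.sum_comm]
  rfl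

theorem sum_fin_cons [Fintype A] {n : ℕ} (F : (Fin (n + 1) → A) → ℝ) :
    ∑ y, F y = ∑ b, ∑ x : Fin n → A, F (Fin.cons b x) := by
  rw [← (Fin.consEquiv fun _ : Fin (n + 1) => A).sum_comp, Fintype.sum_prod_type]
  rfl

theorem setOf_word_snoc {n : ℕ} (x : Fin n → A) (a : A) (k : ℤ) :
    {ω | ∀ i : Fin (n + 1), X ((i : ℤ) + k) ω = (Fin.snoc x a : Fin (n + 1) → A) i} =
      {ω | ∀ i : Fin n, X ((i : ℤ) + k) ω = x i} ∩ X (n + k) ⁻¹' {a} := by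
  ext ω
  simp [Fin.forall_fin_succ']

theorem setOf_word_cons {n : ℕ} (b : A) (x : Fin n → A) (k : ℤ) :
    {ω | ∀ i : Fin (n + 1), X ((i : ℤ) + k) ω = (Fin.cons b x : Fin (n + 1) → A) i} =
      {ω | ∀ i : Fin n, X ((i : ℤ) + (k + 1)) ω = x i} ∩ X k ⁻¹' {b} := by
  ext ω
  simp only [Fin.forall_fin_succ, Fin.cons_zero, Fin.cons_succ, Set.mem_ofPred_eq, Fin.val_zero,
    Fin.val_succ, Set.mem_inter_iff, Set.mem_preimage, Set.mem_singleton_iff]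
  push_cast
  simp only [zero_add, add_assoc, add_comm (1 : ℤ) k]
  exact and_comm

/-- An event in the `σ`-algebra of the `X i`, `i ∈ I`, depends on these variables only. -/
theorem mem_iff_of_measurableSet_sigmaOf [MeasurableSpace A] {I : Set ℤ} {S : Set Ω}
    (hS : MeasurableSet[sigmaOf X I] S) {ω ω' : Ω} (h : ∀ i ∈ I, X i ω = X i ω') :
    ω ∈ S ↔ ω' ∈ S := by
  have hle : sigmaOf X I ≤ MeasurableSpace.comap (fun ω (i : I) => X i ω) inferInstance := by
    refine iSup₂_le fun i hi => ?_
    rw [← measurable_iff_comap_le]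
    exact (measurable_pi_apply (X := fun _ : I => A) ⟨i, hi⟩).comp (comap_measurable _)
  obtain ⟨T, _, rfl⟩ := hle _ hS
  have : (fun i : I => X i ω) = fun i : I => X i ω' := funext fun i => h i i.2
  simp only [Set.mem_preimage, this]

end Words

section StationaryWords

variable {Ω : Type v} [MeasurableSpace Ω] {A : Type u} [MeasurableSpace A]
  [MeasurableSingletonClass A] {P : Measure Ω} {X : ℤ → Ω → A}

theorem measurableSet_word (hX : ∀ i, Measurable (X i)) {n : ℕ} (k : ℤ) (x : Fin n → A) :
    MeasurableSet {ω | ∀ i : Fin n, X ((i : ℤ) + k) ω = x i} := by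
  rw [Set.ofPred_forall]
  exact MeasurableSet.iInter fun i => hX _ (measurableSet_singleton _)

theorem IsStationarySeq.measureReal_word (hst : IsStationarySeq P X)
    (hX : ∀ i, Measurable (X i)) {n : ℕ} (x : Fin n → A) (k : ℤ) :
    P.real {ω | ∀ i : Fin n, X ((i : ℤ) + k) ω = x i} = wordProb P X x := by
  have step : ∀ k : ℤ, P.real {ω | ∀ i : Fin n, X ((i : ℤ) + (k + 1)) ω = x i} =
      P.real {ω | ∀ i : Fin n, X ((i : ℤ) + k) ω = x i} := by
    intro k
    have hS : MeasurableSet {z : ℤ → A | ∀ i : Fin n, z ((i : ℤ) + k) = x i} := by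
      rw [Set.ofPred_forall]
      exact MeasurableSet.iInter fun i => measurable_pi_apply _ (measurableSet_singleton _)
    have h := congrArg (fun μ => μ.real {z : ℤ → A | ∀ i : Fin n, z ((i : ℤ) + k) = x i}) hst
    beta_reduce at h
    rw [map_measureReal_apply (measurable_pi_lambda _ fun i => hX _) hS,
      map_measureReal_apply (measurable_pi_lambda _ fun i => hX _) hS] at h
    simpa only [Set.preimage_ofPred_eq, add_assoc] using h
  have h1 : wordProb P X x = P.real {ω | ∀ i : Fin n, X ((i : ℤ) + (0 + 1)) ω = x i} := by
    unfold wordProb wordOf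
    congr 1
    ext ω
    simp [funext_iff]
  rw [h1, step]
  induction k using Int.induction_on with
  | zero => rfl
  | succ i ih => rw [step, ih]
  | pred i ih => rw [← ih, ← step, sub_add_cancel]

/-- The Markov property: given at least `m` consecutive letters, the letter before them and the
letter after them are independent. -/
theorem IsMarkovOfOrder.wordProb_mul_wordProb [IsProbabilityMeasure P] {m : ℕ}
    (hM : IsMarkovOfOrder P X m) (hst : IsStationarySeq P X) (hX : ∀ i, Measurable (X i)) {n : ℕ}
    (hmn : m ≤ n) (b : A) (x : Fin n → A) (a : A) :
    wordProb P X (Fin.cons b (Fin.snoc x a : Fin (n + 1) → A) : Fin (n + 2) → A) *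
        wordProb P X x =
      wordProb P X (Fin.cons b x : Fin (n + 1) → A) *
        wordProb P X (Fin.snoc x a : Fin (n + 1) → A) := by
  set F : Set Ω := {ω | ∀ i : Fin n, X ((i : ℤ) + 1) ω = x i} with hF
  have hFm : MeasurableSet[sigmaOf X (Set.Iic (n : ℤ))] F := by
    rw [hF, Set.ofPred_forall]
    refine MeasurableSet.iInter fun i => ?_
    have h : Measurable[sigmaOf X (Set.Iic (n : ℤ))] (X ((i : ℤ) + 1)) :=
      measurable_sigmaOf (by rw [Set.mem_Iic]; omega)
    exact h (measurableSet_singleton _)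
  have hBm : MeasurableSet[sigmaOf X (Set.Iic (n : ℤ))] (X 0 ⁻¹' {b}) := by
    have h : Measurable[sigmaOf X (Set.Iic (n : ℤ))] (X 0) :=
      measurable_sigmaOf (by rw [Set.mem_Iic]; omega)
    exact h (measurableSet_singleton _)
  set g := P[(X ((n : ℤ) + 1) ⁻¹' {a}).indicator (fun _ => (1 : ℝ)) |
    sigmaOf X (Set.Ioc ((n : ℤ) - m) n)] with hg
  have hint : ∀ E, MeasurableSet[sigmaOf X (Set.Iic (n : ℤ))] E →
      P.real (E ∩ X ((n : ℤ) + 1) ⁻¹' {a}) = ∫ ω in E, g ω ∂P := by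
    intro E hE
    have h1 : Integrable ((X ((n : ℤ) + 1) ⁻¹' {a}).indicator fun _ => (1 : ℝ)) P :=
      (integrable_const 1).indicator (hX _ (measurableSet_singleton _))
    have h2 := setIntegral_condExp (sigmaOf_le hX _) h1 hE
    rw [← setIntegral_congr_ae₀ ((sigmaOf_le hX _ _ hE).nullMeasurableSet)
      ((hM (n : ℤ) a).mono fun ω h _ => h), h2,
      integral_indicator (hX _ (measurableSet_singleton _)),
      Measure.restrict_restrict (hX _ (measurableSet_singleton _))]
    simp [Set.inter_comm]
  have hconst : ∀ ω ∈ F, ∀ ω' ∈ F, g ω = g ω' := by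
    intro ω hω ω' hω'
    have hgm : Measurable[sigmaOf X (Set.Ioc ((n : ℤ) - m) n)] g :=
      stronglyMeasurable_condExp.measurable
    have h := mem_iff_of_measurableSet_sigmaOf (hgm (measurableSet_singleton (g ω')))
      (ω := ω) (ω' := ω') (fun i hi => by
        rw [Set.mem_Ioc] at hi
        have h1 := hω ⟨(i - 1).toNat, by omega⟩
        have h2 := hω' ⟨(i - 1).toNat, by omega⟩
        have h3 : (((i - 1).toNat : ℕ) : ℤ) + 1 = i := by omega
        simp only [h3] at h1 h2
        rw [h1, h2])
    simpa using h
  obtain ⟨c, hc⟩ : ∃ c, ∀ ω ∈ F, g ω = c := by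
    by_cases h : F.Nonempty
    · obtain ⟨ω₀, h0⟩ := h
      exact ⟨g ω₀, fun ω hω => hconst ω hω ω₀ h0⟩
    · exact ⟨0, fun ω hω => absurd ⟨ω, hω⟩ h⟩
  have hint' : ∀ E ⊆ F, MeasurableSet[sigmaOf X (Set.Iic (n : ℤ))] E →
      P.real (E ∩ X ((n : ℤ) + 1) ⁻¹' {a}) = P.real E * c := by
    intro E hEF hE
    rw [hint E hE, setIntegral_congr_fun (sigmaOf_le hX _ _ hE) fun ω hω => hc ω (hEF hω)]
    simp
  have e1 := hint' F le_rfl hFm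
  have e2 := hint' (F ∩ X 0 ⁻¹' {b}) Set.inter_subset_left (hFm.inter hBm)
  rw [← hst.measureReal_word hX _ 0, ← hst.measureReal_word hX x 1,
    ← hst.measureReal_word hX (Fin.cons b x : Fin (n + 1) → A) 0,
    ← hst.measureReal_word hX (Fin.snoc x a : Fin (n + 1) → A) 1,
    setOf_word_cons, setOf_word_cons, zero_add, setOf_word_snoc, ← hF, Set.inter_right_comm, e1, e2]
  ring

variable [Fintype A]

theorem sum_measureReal_inter_preimage [IsFiniteMeasure P] (hX : ∀ i, Measurable (X i)) {S : Set Ω}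
    (hS : MeasurableSet S) (k : ℤ) : ∑ a, P.real (S ∩ X k ⁻¹' {a}) = P.real S := by
  rw [← measureReal_biUnion_finset]
  · congr 1
    ext ω
    simp
  · intro a _ b _ hab
    rw [Function.onFun, Set.disjoint_left]
    intro ω h1 h2
    exact hab (h1.2.symm.trans h2.2)
  · exact fun a _ => hS.inter (hX k (measurableSet_singleton a))

theorem IsStationarySeq.sum_wordProb_snoc [IsFiniteMeasure P] (hst : IsStationarySeq P X)
    (hX : ∀ i, Measurable (X i)) {n : ℕ} (x : Fin n → A) :
    ∑ a, wordProb P X (Fin.snoc x a : Fin (n + 1) → A) = wordProb P X x := by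
  simp only [← hst.measureReal_word hX _ 0, setOf_word_snoc]
  exact sum_measureReal_inter_preimage hX (measurableSet_word hX _ _) _

theorem IsStationarySeq.sum_wordProb_cons [IsFiniteMeasure P] (hst : IsStationarySeq P X)
    (hX : ∀ i, Measurable (X i)) {n : ℕ} (x : Fin n → A) :
    ∑ b, wordProb P X (Fin.cons b x : Fin (n + 1) → A) = wordProb P X x := by
  simp only [← hst.measureReal_word hX _ 0, setOf_word_cons]
  rw [sum_measureReal_inter_preimage hX (measurableSet_word hX _ _) _,
    hst.measureReal_word hX, hst.measureReal_word hX]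

end StationaryWords

/-! ### Entropy of words -/

section Entropy

theorem one_sub_inv_le_log_mul {a b : ℝ} (ha : 0 < a) (hb : 0 < b) :
    a * (Real.logb 2 b - Real.logb 2 a) ≤ (b - a) / Real.log 2 := by
  have h2 : 0 < Real.log 2 := Real.log_pos (by norm_num)
  rw [Real.logb, Real.logb, ← sub_div, ← mul_div_assoc]
  refine div_le_div_of_nonneg_right ?_ h2.le
  have h := Real.log_le_sub_one_of_pos (div_pos hb ha)
  rw [Real.log_div hb.ne' ha.ne'] at h
  calc a * (Real.log b - Real.log a) ≤ a * (b / a - 1) := mul_le_mul_of_nonneg_left h ha.le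
    _ = b - a := by field_simp

/-- Gibbs' inequality. -/
theorem gibbs_inequality {W : Type*} [Fintype W] {p q : W → ℝ} (hp : ∀ x, 0 < p x)
    (hq : ∀ x, 0 < q x) (hsum : ∑ x, q x ≤ ∑ x, p x) :
    ∑ x, p x * -Real.logb 2 (p x) ≤ ∑ x, p x * -Real.logb 2 (q x) := by
  have h2 : 0 < Real.log 2 := Real.log_pos (by norm_num)
  have h : ∑ x, p x * (Real.logb 2 (q x) - Real.logb 2 (p x)) ≤ 0 := by
    refine (Finset.sum_le_sum fun x _ => one_sub_inv_le_log_mul (hp x) (hq x)).trans ?_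
    rw [← Finset.sum_div, Finset.sum_sub_distrib]
    exact div_nonpos_of_nonpos_of_nonneg (by linarith) h2.le
  have h3 : ∑ x, p x * (Real.logb 2 (q x) - Real.logb 2 (p x)) =
      ∑ x, p x * -Real.logb 2 (p x) - ∑ x, p x * -Real.logb 2 (q x) := by
    rw [← Finset.sum_sub_distrib]
    exact Finset.sum_congr rfl fun x _ => by ring
  linarith

variable {Ω : Type v} [MeasurableSpace Ω] {A : Type u} [MeasurableSpace A]
  [MeasurableSingletonClass A] [Fintype A] {P : Measure Ω} {X : ℤ → Ω → A}

/-- The entropy of the first `n` letters, in bits. -/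
noncomputable def wordEntropy (P : Measure Ω) (X : ℤ → Ω → A) (n : ℕ) : ℝ :=
  ∑ x : Fin n → A, wordProb P X x * -Real.logb 2 (wordProb P X x)

/-- The entropy of a letter given the `n` letters before it. -/
noncomputable def nextEntropy (P : Measure Ω) (X : ℤ → Ω → A) (n : ℕ) : ℝ :=
  ∑ x : Fin n → A, ∑ a, wordProb P X (Fin.snoc x a : Fin (n + 1) → A) *
    (Real.logb 2 (wordProb P X x) - Real.logb 2 (wordProb P X (Fin.snoc x a : Fin (n + 1) → A)))

theorem wordEntropy_succ [IsProbabilityMeasure P] (hst : IsStationarySeq P X)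
    (hX : ∀ i, Measurable (X i)) (n : ℕ) :
    wordEntropy P X (n + 1) = wordEntropy P X n + nextEntropy P X n := by
  unfold wordEntropy nextEntropy
  rw [sum_fin_snoc, ← Finset.sum_add_distrib]
  refine Finset.sum_congr rfl fun x _ => ?_
  conv_rhs => enter [1, 1]; rw [← hst.sum_wordProb_snoc hX x]
  rw [Finset.sum_mul, ← Finset.sum_add_distrib]
  exact Finset.sum_congr rfl fun a _ => by ring

theorem wordEntropy_zero [IsProbabilityMeasure P] (hX : ∀ i, Measurable (X i)) :
    wordEntropy P X 0 = 0 := by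
  have h := sum_wordProb (P := P) hX 0
  rw [Fintype.sum_unique] at h
  unfold wordEntropy
  rw [Fintype.sum_unique, h]
  simp

/-- The difference is the mutual information of the two ends of a word of length `n + 2` given the
letters between them. -/
theorem nextEntropy_sub_nextEntropy_succ [IsProbabilityMeasure P] (hst : IsStationarySeq P X)
    (hX : ∀ i, Measurable (X i))
    (n : ℕ) : nextEntropy P X n - nextEntropy P X (n + 1) =
      ∑ b, ∑ x : Fin n → A, ∑ a,
        wordProb P X (Fin.cons b (Fin.snoc x a : Fin (n + 1) → A) : Fin (n + 2) → A) *
        (Real.logb 2 (wordProb P X x) +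
          Real.logb 2 (wordProb P X (Fin.cons b (Fin.snoc x a : Fin (n + 1) → A) : Fin (n + 2) → A))
          - Real.logb 2 (wordProb P X (Fin.snoc x a : Fin (n + 1) → A))
          - Real.logb 2 (wordProb P X (Fin.cons b x : Fin (n + 1) → A))) := by
  have h1 : nextEntropy P X n = ∑ b, ∑ x : Fin n → A, ∑ a,
      wordProb P X (Fin.cons b (Fin.snoc x a : Fin (n + 1) → A) : Fin (n + 2) → A) *
      (Real.logb 2 (wordProb P X x) -
        Real.logb 2 (wordProb P X (Fin.snoc x a : Fin (n + 1) → A))) := by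
    unfold nextEntropy
    conv_rhs => rw [Finset.sum_comm]
    refine Finset.sum_congr rfl fun x _ => ?_
    conv_rhs => rw [Finset.sum_comm]
    refine Finset.sum_congr rfl fun a _ => ?_
    rw [← Finset.sum_mul, hst.sum_wordProb_cons hX]
  have h2 : nextEntropy P X (n + 1) = ∑ b, ∑ x : Fin n → A, ∑ a,
      wordProb P X (Fin.cons b (Fin.snoc x a : Fin (n + 1) → A) : Fin (n + 2) → A) *
      (Real.logb 2 (wordProb P X (Fin.cons b x : Fin (n + 1) → A)) -
        Real.logb 2 (wordProb P X
          (Fin.cons b (Fin.snoc x a : Fin (n + 1) → A) : Fin (n + 2) → A))) := by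
    unfold nextEntropy
    rw [sum_fin_cons]
    refine Finset.sum_congr rfl fun b _ => Finset.sum_congr rfl fun x _ =>
      Finset.sum_congr rfl fun a _ => ?_
    rw [Fin.cons_snoc_eq_snoc_cons]
  rw [h1, h2, ← Finset.sum_sub_distrib]
  refine Finset.sum_congr rfl fun b _ => ?_
  rw [← Finset.sum_sub_distrib]
  refine Finset.sum_congr rfl fun x _ => ?_
  rw [← Finset.sum_sub_distrib]
  exact Finset.sum_congr rfl fun a _ => by ring

/-- Conditioning on one more letter does not increase the entropy. -/
theorem nextEntropy_antitone [IsProbabilityMeasure P] (hst : IsStationarySeq P X)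
    (hX : ∀ i, Measurable (X i))
    (hpos : ∀ n, ∀ x : Fin n → A, 0 < wordProb P X x) : Antitone (nextEntropy P X) := by
  refine antitone_nat_of_succ_le fun n => ?_
  rw [← sub_nonneg, nextEntropy_sub_nextEntropy_succ hst hX]
  have h2 : 0 < Real.log 2 := Real.log_pos (by norm_num)
  have key : ∀ (b : A) (x : Fin n → A) (a : A),
      (wordProb P X (Fin.cons b (Fin.snoc x a : Fin (n + 1) → A) : Fin (n + 2) → A) -
        wordProb P X (Fin.snoc x a : Fin (n + 1) → A) *
          wordProb P X (Fin.cons b x : Fin (n + 1) → A) / wordProb P X x) / Real.log 2 ≤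
      wordProb P X (Fin.cons b (Fin.snoc x a : Fin (n + 1) → A) : Fin (n + 2) → A) *
        (Real.logb 2 (wordProb P X x) +
          Real.logb 2 (wordProb P X (Fin.cons b (Fin.snoc x a : Fin (n + 1) → A) : Fin (n + 2) → A))
          - Real.logb 2 (wordProb P X (Fin.snoc x a : Fin (n + 1) → A))
          - Real.logb 2 (wordProb P X (Fin.cons b x : Fin (n + 1) → A))) := by
    intro b x a
    have hx := hpos n x
    have hxa := hpos _ (Fin.snoc x a : Fin (n + 1) → A)
    have hbx := hpos _ (Fin.cons b x : Fin (n + 1) → A)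
    have hbxa := hpos _ (Fin.cons b (Fin.snoc x a : Fin (n + 1) → A) : Fin (n + 2) → A)
    have h := one_sub_inv_le_log_mul hbxa (div_pos (mul_pos hxa hbx) hx)
    rw [Real.logb_div (mul_pos hxa hbx).ne' hx.ne', Real.logb_mul hxa.ne' hbx.ne'] at h
    rw [← neg_sub, neg_div, neg_le, ← mul_neg]
    refine le_trans (le_of_eq ?_) h
    ring
  refine le_trans (le_of_eq ?_) (Finset.sum_le_sum fun b _ => Finset.sum_le_sum fun x _ =>
    Finset.sum_le_sum fun a _ => key b x a)
  simp only [← Finset.sum_div, Finset.sum_sub_distrib]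
  symm
  refine div_eq_zero_iff.2 (Or.inl (sub_eq_zero.2 ?_))
  refine Finset.sum_congr rfl fun b _ => Finset.sum_congr rfl fun x _ => ?_
  rw [← Finset.sum_mul, hst.sum_wordProb_snoc hX, mul_div_cancel_left₀ _ (hpos n x).ne',
    ← hst.sum_wordProb_snoc hX (Fin.cons b x : Fin (n + 1) → A)]
  exact Finset.sum_congr rfl fun a _ => by rw [Fin.cons_snoc_eq_snoc_cons]

/-- For a process of order `m` the ends of a word of length `n + 2 > m + 1` are conditionally
independent given the letters between them. -/
theorem nextEntropy_eq_of_le [IsProbabilityMeasure P] {m : ℕ}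
    (hM : IsMarkovOfOrder P X m) (hst : IsStationarySeq P X)
    (hX : ∀ i, Measurable (X i)) (hpos : ∀ n, ∀ x : Fin n → A, 0 < wordProb P X x) {n : ℕ}
    (hn : m ≤ n) : nextEntropy P X n = nextEntropy P X m := by
  induction n, hn using Nat.le_induction with
  | base => rfl
  | succ n hn ih =>
    rw [← ih, eq_comm, ← sub_eq_zero, nextEntropy_sub_nextEntropy_succ hst hX]
    refine Finset.sum_eq_zero fun b _ => Finset.sum_eq_zero fun x _ =>
      Finset.sum_eq_zero fun a _ => mul_eq_zero_of_right _ ?_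
    have h := congrArg (Real.logb 2) (hM.wordProb_mul_wordProb hst hX hn b x a)
    rw [Real.logb_mul (hpos _ _).ne' (hpos _ _).ne',
      Real.logb_mul (hpos _ _).ne' (hpos _ _).ne'] at h
    linarith

/-- By stationarity, the letters `X (-m+1), …, X 0, X 1` may be replaced by `X 1, …, X (m+1)`. -/
theorem condEntropyBits_eq_nextEntropy (hst : IsStationarySeq P X) (hX : ∀ i, Measurable (X i))
    (hpos : ∀ n, ∀ x : Fin n → A, 0 < wordProb P X x) (m : ℕ) :
    condEntropyBits P X m = nextEntropy P X m := by
  have h2 : 0 < Real.log 2 := Real.log_pos (by norm_num)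
  unfold condEntropyBits nextEntropy
  -- the past `X 0, X (-1), …` is read backwards
  refine Fintype.sum_equiv (Equiv.arrowCongr Fin.revPerm (Equiv.refl A)) _ _ fun u => ?_
  set x : Fin m → A := (Equiv.arrowCongr Fin.revPerm (Equiv.refl A)) u with hx
  have hset : {ω | ∀ i : Fin m, X (-(i : ℤ)) ω = u i} =
      {ω | ∀ i : Fin m, X ((i : ℤ) + (1 - m)) ω = x i} := by
    ext ω
    simp only [Set.mem_ofPred_eq]
    rw [← Fin.revPerm.forall_congr_right]
    refine forall_congr' fun i => ?_
    have h1 : (-((Fin.revPerm i : Fin m) : ℤ)) = (i : ℤ) + (1 - m) := by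
      rw [Fin.revPerm_apply, Fin.val_rev]
      have := i.2
      omega
    rw [h1]
    rfl
  have hE := measurableSet_word hX (1 - (m : ℤ)) x
  rw [hset, hst.measureReal_word hX, Finset.mul_sum]
  refine Finset.sum_congr rfl fun a _ => ?_
  have h3 : P.real ({ω | ∀ i : Fin m, X ((i : ℤ) + (1 - m)) ω = x i} ∩ {ω | X 1 ω = a}) =
      wordProb P X (Fin.snoc x a : Fin (m + 1) → A) := by
    rw [← hst.measureReal_word hX _ (1 - m), setOf_word_snoc,
      show (m : ℤ) + (1 - m) = 1 by ring]
    rfl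
  rw [measureReal_cond hE, h3, hst.measureReal_word hX, Real.negMulLog,
    Real.log_div (hpos _ _).ne' (hpos _ _).ne', Real.logb, Real.logb]
  have := (hpos m x).ne'
  field_simp
  ring

theorem nextEntropy_nonneg [IsProbabilityMeasure P] (hst : IsStationarySeq P X)
    (hX : ∀ i, Measurable (X i))
    (hpos : ∀ n, ∀ x : Fin n → A, 0 < wordProb P X x) (n : ℕ) : 0 ≤ nextEntropy P X n := by
  refine Finset.sum_nonneg fun x _ => Finset.sum_nonneg fun a _ =>
    mul_nonneg (hpos _ _).le (sub_nonneg.2 ?_)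
  refine Real.logb_le_logb_of_le (by norm_num) (hpos _ _) ?_
  rw [← hst.sum_wordProb_snoc hX x]
  exact Finset.single_le_sum (f := fun a => wordProb P X (Fin.snoc x a : Fin (n + 1) → A))
    (fun _ _ => (hpos _ _).le) (Finset.mem_univ a)

theorem wordEntropy_le [IsProbabilityMeasure P] (hX : ∀ i, Measurable (X i))
    (hpos : ∀ n, ∀ x : Fin n → A, 0 < wordProb P X x) (n : ℕ) :
    wordEntropy P X n ≤ n * Real.logb 2 (Fintype.card A) := by
  have hsum := sum_wordProb (P := P) hX n
  have hN : (0 : ℝ) < (Fintype.card (Fin n → A) : ℝ) := by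
    rcases isEmpty_or_nonempty (Fin n → A) with h | h
    · simp at hsum
    · exact_mod_cast Fintype.card_pos
  refine (gibbs_inequality (q := fun _ => (Fintype.card (Fin n → A) : ℝ)⁻¹) (hpos n)
    (fun _ => inv_pos.2 hN) ?_).trans (le_of_eq ?_)
  · rw [hsum, Finset.sum_const, Finset.card_univ, nsmul_eq_mul, mul_inv_cancel₀ hN.ne']
  · rw [← Finset.sum_mul, hsum, Real.logb_inv, Fintype.card_fun, Fintype.card_fin]
    push_cast
    rw [Real.logb_pow]
    ring

theorem mul_condEntropyBits_le_wordEntropy [IsProbabilityMeasure P] {m : ℕ}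
    (hM : IsMarkovOfOrder P X m)
    (hst : IsStationarySeq P X) (hX : ∀ i, Measurable (X i))
    (hpos : ∀ n, ∀ x : Fin n → A, 0 < wordProb P X x) (n : ℕ) :
    n * condEntropyBits P X m ≤ wordEntropy P X n := by
  rw [condEntropyBits_eq_nextEntropy hst hX hpos]
  induction n with
  | zero => simp [wordEntropy_zero hX]
  | succ n ih =>
    rw [wordEntropy_succ hst hX]
    have h : nextEntropy P X m ≤ nextEntropy P X n := by
      rcases le_total m n with h | h
      · exact (nextEntropy_eq_of_le hM hst hX hpos h).ge
      · exact nextEntropy_antitone hst hX hpos h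
    push_cast
    linarith

/-- Only the first `m` letters can have more than the conditional entropy, and no letter has more
than `log₂` of the size of the alphabet. -/
theorem wordEntropy_le_mul_condEntropyBits_add [IsProbabilityMeasure P] {m : ℕ}
    (hM : IsMarkovOfOrder P X m)
    (hst : IsStationarySeq P X) (hX : ∀ i, Measurable (X i))
    (hpos : ∀ n, ∀ x : Fin n → A, 0 < wordProb P X x) (n : ℕ) :
    wordEntropy P X n ≤ n * condEntropyBits P X m + m * Real.logb 2 (Fintype.card A) := by
  rw [condEntropyBits_eq_nextEntropy hst hX hpos]
  have hH := nextEntropy_nonneg hst hX hpos m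
  have hcard : 0 ≤ Real.logb 2 (Fintype.card A) := Real.logb_nonneg (by norm_num) (by
    rcases isEmpty_or_nonempty A with h | h
    · have := sum_wordProb (P := P) hX 1
      simp at this
    · exact_mod_cast Fintype.card_pos)
  rcases le_total n m with h | h
  · have h1 := wordEntropy_le hX hpos (P := P) n
    have h2 : (n : ℝ) ≤ m := by exact_mod_cast h
    nlinarith [mul_le_mul_of_nonneg_right h2 hcard, mul_nonneg (Nat.cast_nonneg (α := ℝ) n) hH]
  · induction n, h using Nat.le_induction with
    | base =>
      have h1 := wordEntropy_le hX hpos (P := P) m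
      nlinarith [mul_nonneg (Nat.cast_nonneg (α := ℝ) m) hH]
    | succ n hn ih =>
      rw [wordEntropy_succ hst hX, nextEntropy_eq_of_le hM hst hX hpos hn]
      push_cast
      linarith

end Entropy

/-! ### Words with the same transition counts are equally likely -/

section Digits

theorem mod_div_mod_pow {l i r : ℕ} (hi : i < r) (X : ℕ) :
    X % l ^ r / l ^ i % l = X / l ^ i % l := by
  obtain ⟨e, rfl⟩ := Nat.exists_eq_add_of_lt hi
  rcases Nat.eq_zero_or_pos l with rfl | hl
  · rcases Nat.eq_zero_or_pos i with rfl | h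
    · simp
    · simp [h.ne']
  have h1 : X / l ^ i = (X % l ^ (i + e + 1)) / l ^ i +
      l * (l ^ e * (X / l ^ (i + e + 1))) := by
    conv_lhs => rw [← Nat.mod_add_div X (l ^ (i + e + 1))]
    rw [show l ^ (i + e + 1) * (X / l ^ (i + e + 1)) =
      l ^ i * (l * (l ^ e * (X / l ^ (i + e + 1)))) by ring,
      Nat.add_mul_div_left _ _ (Nat.pow_pos hl)]
  rw [h1, Nat.add_mul_mod_self_left]

theorem div_mod_eq_of_mod_pow_eq {l i r X Y : ℕ} (hi : i < r) (h : X % l ^ r = Y % l ^ r) :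
    X / l ^ i % l = Y / l ^ i % l := by
  rw [← mod_div_mod_pow hi X, ← mod_div_mod_pow hi Y, h]

theorem mod_pow_eq_of_digits_eq {l n X Y : ℕ} (h : ∀ i < n, X / l ^ i % l = Y / l ^ i % l) :
    X % l ^ n = Y % l ^ n := by
  induction n with
  | zero => simp [Nat.mod_one]
  | succ n ih =>
    rw [Nat.mod_pow_succ, Nat.mod_pow_succ, ih fun i hi => h i (by omega), h n (by omega)]

variable {A : Type u}

/-- The sequence of letters whose indices are the base-`l` digits of `Z`. -/
def digitSeq {l : ℕ} [NeZero l] (e : A ≃ Fin l) (Z : ℕ) (i : ℕ) : A :=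
  e.symm (Fin.ofNat l (Z / l ^ i))

variable {l : ℕ} [NeZero l] (e : A ≃ Fin l)

theorem digitSeq_eq_iff {Z Z' i i' : ℕ} :
    digitSeq e Z i = digitSeq e Z' i' ↔ Z / l ^ i % l = Z' / l ^ i' % l := by
  simp [digitSeq, Fin.ext_iff]

theorem digitSeq_add (Z t i : ℕ) : digitSeq e Z (t + i) = digitSeq e (Z / l ^ t) i := by
  rw [digitSeq_eq_iff, pow_add, Nat.div_div_eq_div_mul]

theorem digitSeq_eq_of_mod_eq {Z Z' r i : ℕ} (h : Z % l ^ r = Z' % l ^ r) (hi : i < r) :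
    digitSeq e Z i = digitSeq e Z' i :=
  (digitSeq_eq_iff e).2 (div_mod_eq_of_mod_pow_eq hi h)

theorem exists_digitSeq_eq {n : ℕ} (x : Fin n → A) :
    ∃ Z < l ^ n, ∀ i : Fin n, digitSeq e Z i = x i := by
  refine ⟨finFunctionFinEquiv fun i => e (x i), Fin.is_lt _, fun i => ?_⟩
  have h := congrFun (finFunctionFinEquiv.symm_apply_apply fun i => e (x i)) i
  rw [digitSeq, Equiv.symm_apply_eq]
  rw [← h]
  rfl

end Digits

section TypeClass

variable {Ω : Type v} [MeasurableSpace Ω] {A : Type u} [MeasurableSpace A]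
  [MeasurableSingletonClass A] {P : Measure Ω} {X : ℤ → Ω → A}

/-- `IsMarkovOfOrder.wordProb_mul_wordProb` for the prefixes of a sequence `s`. -/
theorem IsMarkovOfOrder.wordProb_seq_mul [IsProbabilityMeasure P] {m : ℕ}
    (hM : IsMarkovOfOrder P X m) (hst : IsStationarySeq P X) (hX : ∀ i, Measurable (X i)) {n : ℕ}
    (hmn : m ≤ n) (s : ℕ → A) :
    wordProb P X (fun i : Fin (n + 2) => s i) * wordProb P X (fun i : Fin n => s (i + 1)) =
      wordProb P X (fun i : Fin (n + 1) => s i) *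
        wordProb P X (fun i : Fin (n + 1) => s (i + 1)) := by
  have hsnoc : (fun i : Fin (n + 1) => s (i + 1)) =
      (Fin.snoc (fun i : Fin n => s (i + 1)) (s (n + 1)) : Fin (n + 1) → A) := by
    funext i
    refine Fin.lastCases ?_ (fun i => ?_) i <;> simp
  have hcons : ∀ N, (fun i : Fin (N + 1) => s i) =
      (Fin.cons (s 0) (fun i : Fin N => s (i + 1)) : Fin (N + 1) → A) := by
    intro N
    funext i
    refine Fin.cases ?_ (fun i => ?_) i <;> simp
  rw [hcons (n + 1), hcons n, hsnoc]
  exact hM.wordProb_mul_wordProb hst hX hmn _ _ _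

/-- The probability of a word of length `n ≥ m` is the product of that of its first `m` letters and
of the transition probabilities. -/
theorem IsMarkovOfOrder.wordProb_seq_eq_prod [IsProbabilityMeasure P] {m : ℕ}
    (hM : IsMarkovOfOrder P X m) (hst : IsStationarySeq P X) (hX : ∀ i, Measurable (X i))
    (hpos : ∀ n, ∀ x : Fin n → A, 0 < wordProb P X x) (N : ℕ) (s : ℕ → A) :
    wordProb P X (fun i : Fin (m + N) => s i) = wordProb P X (fun i : Fin m => s i) *
      ∏ t ∈ Finset.range N, (wordProb P X (fun i : Fin (m + 1) => s (t + i)) /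
        wordProb P X (fun i : Fin m => s (t + i))) := by
  have hratio : ∀ (N : ℕ) (s : ℕ → A), wordProb P X (fun i : Fin (m + N + 1) => s i) /
      wordProb P X (fun i : Fin (m + N) => s i) =
      wordProb P X (fun i : Fin (m + 1) => s (N + i)) /
        wordProb P X (fun i : Fin m => s (N + i)) := by
    intro N
    induction N with
    | zero => intro s; simp
    | succ N ih =>
      intro s
      have h := ih fun i => s (i + 1)
      have h2 := hM.wordProb_seq_mul hst hX (Nat.le_add_right m N) s
      have e1 : ∀ i : ℕ, N + i + 1 = N + 1 + i := fun i => by ring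
      simp only [e1] at h
      rw [← h, div_eq_div_iff (hpos _ _).ne' (hpos _ _).ne']
      exact h2.trans (mul_comm _ _)
  induction N with
  | zero => simp
  | succ N ih =>
    rw [Finset.prod_range_succ, ← mul_assoc, ← ih, ← hratio,
      mul_div_cancel₀ _ (hpos _ _).ne']
    rfl

variable {l : ℕ} [NeZero l] (e : A ≃ Fin l)

/-- The probability of a word is a product of powers of transition probabilities whose exponents are
the transition counts, hence depends on its type only. -/
theorem wordProb_digitSeq_eq [IsProbabilityMeasure P] {m : ℕ}
    (hM : IsMarkovOfOrder P X m) (hst : IsStationarySeq P X) (hX : ∀ i, Measurable (X i))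
    (hpos : ∀ n, ∀ x : Fin n → A, 0 < wordProb P X x) {n Z Z' : ℕ}
    (h : typeIndex n l m Z = typeIndex n l m Z') :
    wordProb P X (fun i : Fin n => digitSeq e Z i) =
      wordProb P X (fun i : Fin n => digitSeq e Z' i) := by
  obtain ⟨h1, h2⟩ := windowCount_eq_of_typeIndex_eq (Nat.pos_of_neZero l) h
  rcases le_total n m with hnm | hnm
  · congr 1
    funext i
    exact digitSeq_eq_of_mod_eq e h1 (i.2.trans_le hnm)
  · obtain ⟨N, rfl⟩ := Nat.exists_eq_add_of_le hnm
    rw [Nat.add_sub_cancel_left] at h2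
    set π : ℕ → ℝ := fun Y => wordProb P X (fun i : Fin (m + 1) => digitSeq e Y i) /
      wordProb P X (fun i : Fin m => digitSeq e Y i) with hπ
    have hπmod : ∀ Y, π Y = π (Y % l ^ (m + 1)) := by
      intro Y
      have hY : Y % l ^ (m + 1) = Y % l ^ (m + 1) % l ^ (m + 1) := (Nat.mod_mod _ _).symm
      have h3 : ∀ i < m + 1, digitSeq e Y i = digitSeq e (Y % l ^ (m + 1)) i := fun i hi =>
        digitSeq_eq_of_mod_eq e hY hi
      simp only [hπ]
      congr 2
      · funext i
        exact h3 i i.2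
      · funext i
        exact h3 i (by omega)
    have key : ∀ Y, wordProb P X (fun i : Fin (m + N) => digitSeq e Y i) =
        wordProb P X (fun i : Fin m => digitSeq e Y i) *
          ∏ w ∈ Finset.range (l ^ (m + 1)), π w ^ windowCount N l m Y w := by
      intro Y
      rw [hM.wordProb_seq_eq_prod hst hX hpos N (digitSeq e Y)]
      congr 1
      simp only [digitSeq_add]
      rw [← Finset.prod_fiberwise_of_maps_to (t := Finset.range (l ^ (m + 1)))
        (g := fun t => Y / l ^ t % l ^ (m + 1)) (fun t _ => Finset.mem_range.2
          (Nat.mod_lt _ (Nat.pow_pos (Nat.pos_of_neZero l))))]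
      refine Finset.prod_congr rfl fun w _ => ?_
      rw [windowCount, ← Finset.prod_const]
      refine Finset.prod_congr rfl fun t ht => ?_
      rw [← (Finset.mem_filter.1 ht).2]
      exact hπmod _
    rw [key, key, Finset.prod_congr rfl fun w hw => by rw [h2 w (Finset.mem_range.1 hw)]]
    congr 2
    funext i
    exact digitSeq_eq_of_mod_eq e h1 i.2

/-- A type class consists of equally likely words, so its size is at most the reciprocal of their
probability. -/
theorem typeClassSize_mul_wordProb_le [Fintype A] [IsProbabilityMeasure P] {m : ℕ}
    (hM : IsMarkovOfOrder P X m) (hst : IsStationarySeq P X) (hX : ∀ i, Measurable (X i))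
    (hpos : ∀ n, ∀ x : Fin n → A, 0 < wordProb P X x) (n Z : ℕ) :
    typeClassSize n l m Z * wordProb P X (fun i : Fin n => digitSeq e Z i) ≤ 1 := by
  classical
  rw [typeClassSize, ← Finset.card_filter, ← nsmul_eq_mul, ← Finset.sum_const]
  rw [Finset.sum_congr rfl fun Y hY => (wordProb_digitSeq_eq e hM hst hX hpos
    (Finset.mem_filter.1 hY).2).symm]
  have hinj : Set.InjOn (fun Y => fun i : Fin n => digitSeq e Y i)
      ((Finset.range (l ^ n)).filter fun Y => typeIndex n l m Y = typeIndex n l m Z :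
        Finset ℕ) := by
    intro Y hY Y' hY' h
    have h1 : Y < l ^ n := Finset.mem_range.1 (Finset.mem_filter.1 hY).1
    have h2 : Y' < l ^ n := Finset.mem_range.1 (Finset.mem_filter.1 hY').1
    have h3 := mod_pow_eq_of_digits_eq (l := l) (n := n) (X := Y) (Y := Y') fun i hi =>
      (digitSeq_eq_iff e).1 (congrFun h ⟨i, hi⟩)
    rwa [Nat.mod_eq_of_lt h1, Nat.mod_eq_of_lt h2] at h3
  rw [← Finset.sum_image (f := fun x => wordProb P X x) hinj, ← sum_wordProb (P := P) hX n]
  exact Finset.sum_le_sum_of_subset_of_nonneg (Finset.subset_univ _) fun x _ _ => (hpos n x).le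

end TypeClass

/-! ### Bounds for the complexity of words -/

section WordComplexity

variable {U : List Bool →. List Bool}

theorem kolmogorov_rep_le {A : Type u} [Fintype A] (rep : A → List Bool) (a : A) :
    kolmogorov U (rep a) ≤ maxLetterComplexity U rep :=
  Finset.le_sup (f := fun a => kolmogorov U (rep a)) (Finset.mem_univ a)

/-- Up to constants, the complexity of a word of a stationary Markov process exceeds its information
content by at most the cost of describing the alphabet, the order and the transition counts. -/
theorem IsUniversalPrefixMachine.exists_wordComplexity_le (hU : IsUniversalPrefixMachine U) :
    ∃ C : ℕ, ∀ (A : Type u) [Fintype A] [MeasurableSpace A] [MeasurableSingletonClass A]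
      (rep : A → List Bool) (Ω : Type v) [MeasurableSpace Ω] (P : Measure Ω)
      [IsProbabilityMeasure P] (X : ℤ → Ω → A) (m : ℕ), (∀ i, Measurable (X i)) →
      IsStationarySeq P X → IsMarkovOfOrder P X m →
      (∀ n, ∀ x : Fin n → A, 0 < wordProb P X x) → ∀ (n : ℕ) (x : Fin n → A),
      (wordComplexity U rep x : ℝ) ≤
        Fintype.card A * (maxLetterComplexity U rep + C) + logStar n +
          logStar (Fintype.card A) + logStar m + m * Real.logb 2 (Fintype.card A) +
          ((Fintype.card A ^ (m + 1) - 1 : ℕ) : ℝ) * Real.logb 2 (n + 1) +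
          -Real.logb 2 (wordProb P X x) + C := by
  obtain ⟨C1, h1⟩ := hU.exists_kolmogorov_binaryRep_le
  obtain ⟨C2, h2⟩ := hU.exists_complexity_digits_le
  refine ⟨C1 + C2, fun A _ _ _ rep Ω _ P _ X m hX hst hM hpos n x => ?_⟩
  have hA : Nonempty A := by
    by_contra h
    rw [not_nonempty_iff] at h
    have := sum_wordProb (P := P) hX 1
    simp at this
  set l := Fintype.card A with hl
  have : NeZero l := ⟨Fintype.card_ne_zero⟩
  have hl0 : 0 < l := Fintype.card_pos
  let e : A ≃ Fin l := Fintype.equivFin A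
  obtain ⟨Z, hZ, hZx⟩ := exists_digitSeq_eq e x
  set L : List (List Bool) := List.ofFn fun j : Fin l => rep (e.symm j) with hL
  have hword : ((List.range n).map fun t => Z / l ^ t % l).map (fun i => L.getD i []) =
      List.ofFn fun i => rep (x i) := by
    refine List.ext_getElem (by simp) fun i hi hi' => ?_
    simp only [List.length_map, List.length_range] at hi
    have h3 : Z / l ^ i % l < l := Nat.mod_lt _ hl0
    simp only [List.getElem_map, List.getElem_range, List.getElem_ofFn]
    rw [List.getD_eq_getElem _ _ (by simpa [hL] using h3)]
    simp only [hL, List.getElem_ofFn]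
    rw [← hZx ⟨i, hi⟩]
    rfl
  have e1 := h1 L ((List.range n).map fun t => Z / l ^ t % l)
  rw [hword] at e1
  have e2 := h2 n l m Z hl0 hZ
  have e3 : (L.map fun w => kolmogorov U w + C1).sum ≤ l * (maxLetterComplexity U rep + C1) := by
    have h := List.sum_le_card_nsmul (L.map fun w => kolmogorov U w + C1)
      (maxLetterComplexity U rep + C1) (by
        intro k hk
        simp only [hL, List.mem_map, List.mem_ofFn, exists_exists_eq_and] at hk
        obtain ⟨j, rfl⟩ := hk
        exact Nat.add_le_add_right (kolmogorov_rep_le rep _) _)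
    simpa [hL] using h
  have e4 : (wordComplexity U rep x : ℝ) ≤ l * (maxLetterComplexity U rep + C1) +
      complexity U ((List.range n).map fun t => Z / l ^ t % l) + C1 := by
    have : wordComplexity U rep x ≤ l * (maxLetterComplexity U rep + C1) +
      complexity U ((List.range n).map fun t => Z / l ^ t % l) + C1 := by
      unfold wordComplexity
      omega
    exact_mod_cast this
  have hwz : wordProb P X x = wordProb P X fun i : Fin n => digitSeq e Z i := by
    congr 1
    exact funext fun i => (hZx i).symm
  have e5 : Real.logb 2 (typeClassSize n l m Z) ≤ -Real.logb 2 (wordProb P X x) := by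
    rw [← Real.logb_inv]
    have hS : 0 < typeClassSize n l m Z :=
      Finset.sum_pos' (fun _ _ => Nat.zero_le _) ⟨Z, Finset.mem_range.2 hZ, by simp⟩
    refine Real.logb_le_logb_of_le (by norm_num) (by exact_mod_cast hS) ?_
    rw [← one_div, le_div_iff₀ (hpos n x), hwz]
    exact typeClassSize_mul_wordProb_le e hM hst hX hpos n Z
  have e6 : Real.logb 2 (typeBound n l m) = m * Real.logb 2 l +
      ((l ^ (m + 1) - 1 : ℕ) : ℝ) * Real.logb 2 (n + 1) := by
    have h3 : (l : ℝ) ≠ 0 := by exact_mod_cast hl0.ne'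
    have h4 : (n : ℝ) + 1 ≠ 0 := by positivity
    rw [typeBound, Nat.cast_mul, Nat.cast_pow, Nat.cast_pow, Nat.cast_add, Nat.cast_one,
      Real.logb_mul (pow_ne_zero _ h3) (pow_ne_zero _ h4), Real.logb_pow, Real.logb_pow]
  rw [e6] at e2
  push_cast
  have h7 : (0 : ℝ) ≤ l * C2 := by positivity
  linarith

/-- A short word is described by the list of its distinct letters and the sequence of their
indices, for which there are boundedly many possibilities. -/
theorem IsUniversalPrefixMachine.exists_wordComplexity_le_of_length_le
    (hU : IsUniversalPrefixMachine U) (N : ℕ) :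
    ∃ C : ℕ, ∀ (A : Type u) [Fintype A] (rep : A → List Bool) (n : ℕ), n ≤ N →
      ∀ x : Fin n → A,
        wordComplexity U rep x ≤ Fintype.card A * maxLetterComplexity U rep + C := by
  classical
  obtain ⟨C1, h1⟩ := hU.exists_kolmogorov_binaryRep_le
  obtain ⟨C2, h2⟩ : ∃ C2, ∀ J : List (Fin N), J.length ≤ N →
      complexity U (J.map Fin.val) ≤ C2 := by
    have hfin := (List.finite_length_le (Fin N) N).image
      fun J => complexity U (J.map Fin.val)
    obtain ⟨C2, hC2⟩ := hfin.bddAbove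
    exact ⟨C2, fun J hJ => hC2 ⟨J, hJ, rfl⟩⟩
  refine ⟨N * C1 + C2 + C1, fun A _ rep n hn x => ?_⟩
  set D : List A := (List.ofFn x).dedup with hD
  have hDn : D.length ≤ n := by
    have h := (List.dedup_sublist (List.ofFn x)).length_le
    simpa using h
  have hDl : D.length ≤ Fintype.card A := (List.nodup_dedup _).length_le_card
  have hmem : ∀ i, x i ∈ D := fun i => List.mem_dedup.2 (by simp)
  have hidx : ∀ i, D.idxOf (x i) < D.length := fun i => List.idxOf_lt_length_iff.2 (hmem i)
  set J : List (Fin N) := List.ofFn fun i => ⟨D.idxOf (x i), by have := hidx i; omega⟩ with hJ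
  have hword : (J.map Fin.val).map (fun i => (D.map rep).getD i []) =
      List.ofFn fun i => rep (x i) := by
    refine List.ext_getElem (by simp [hJ]) fun i hi hi' => ?_
    simp only [hJ, List.getElem_map, List.getElem_ofFn]
    rw [List.getD_eq_getElem _ _ (by simpa using hidx _)]
    simp
  have e1 := h1 (D.map rep) (J.map Fin.val)
  rw [hword] at e1
  have e2 := h2 J (by simpa [hJ] using hn)
  have e3 : ((D.map rep).map fun w => kolmogorov U w + C1).sum ≤
      D.length * (maxLetterComplexity U rep + C1) := by
    have h := List.sum_le_card_nsmul ((D.map rep).map fun w => kolmogorov U w + C1)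
      (maxLetterComplexity U rep + C1) (by
        intro k hk
        simp only [List.map_map, List.mem_map, Function.comp] at hk
        obtain ⟨a, _, rfl⟩ := hk
        exact Nat.add_le_add_right (kolmogorov_rep_le rep _) _)
    simpa using h
  have e4 : D.length * (maxLetterComplexity U rep + C1) ≤
      Fintype.card A * maxLetterComplexity U rep + N * C1 := by
    rw [mul_add]
    exact Nat.add_le_add (Nat.mul_le_mul_right _ hDl) (Nat.mul_le_mul_right _ (hDn.trans hn))
  unfold wordComplexity
  omega

/-- The complexity has bounded differences: changing a letter costs a description of its position
and of the new letter. -/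
theorem IsUniversalPrefixMachine.exists_abs_wordComplexity_sub_le
    (hU : IsUniversalPrefixMachine U) :
    ∃ C : ℕ, ∀ (A : Type u) [Fintype A] (rep : A → List Bool) (n : ℕ) (x x' : Fin n → A)
      (k : Fin n), (∀ j, j ≠ k → x j = x' j) →
      |(wordComplexity U rep x : ℝ) - wordComplexity U rep x'| ≤
        C + logStar n + maxLetterComplexity U rep := by
  obtain ⟨C, hC⟩ := hU.exists_kolmogorov_set_le
  refine ⟨C, fun A _ rep n => ?_⟩
  have key : ∀ (x x' : Fin n → A) (k : Fin n), (∀ j, j ≠ k → x j = x' j) →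
      (wordComplexity U rep x : ℝ) - wordComplexity U rep x' ≤
        C + logStar n + maxLetterComplexity U rep := by
    intro x x' k h
    have hset : (List.ofFn fun i => rep (x i)) =
        (List.ofFn fun i => rep (x' i)).set k (rep (x k)) := by
      refine List.ext_getElem (by simp) fun i hi hi' => ?_
      simp only [List.length_ofFn] at hi
      rw [List.getElem_set]
      simp only [List.getElem_ofFn]
      split_ifs with hik
      · congr 2
        exact Fin.ext hik.symm
      · rw [h ⟨i, hi⟩ fun h' => hik (by rw [← h'])]
    have h1 := hC (List.ofFn fun i => rep (x' i)) k (rep (x k))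
    rw [← hset] at h1
    have h2 : (kolmogorov U (rep (x k)) : ℝ) ≤ maxLetterComplexity U rep := by
      exact_mod_cast kolmogorov_rep_le rep (x k)
    have h3 : logStar (k : ℕ) ≤ logStar n := logStar_mono (by exact_mod_cast k.2.le)
    unfold wordComplexity
    linarith
  intro x x' k h
  rw [abs_sub_le_iff]
  exact ⟨key x x' k h, key x' x k fun j hj => (h j hj).symm⟩

end WordComplexity

/-! ### Orders of magnitude -/

section Asymptotic

theorem tendsto_logStar : Tendsto (fun n : ℕ => logStar n) atTop atTop := by
  have h : Tendsto (fun n : ℕ => Real.logb 2 (n : ℝ)) atTop atTop :=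
    (Real.tendsto_logb_atTop (by norm_num)).comp tendsto_natCast_atTop_atTop
  refine tendsto_atTop_mono' _ ?_ h
  filter_upwards [eventually_ge_atTop 1] with n hn
  exact logb_two_le_logStar (by exact_mod_cast hn)

theorem isLittleO_const_logStar (a : ℝ) :
    (fun _ : ℕ => a) =o[atTop] fun n : ℕ => logStar n :=
  isLittleO_const_left.2 (Or.inr (tendsto_norm_atTop_atTop.comp tendsto_logStar))

theorem isBigO_add_mul_logStar_div (a b : ℝ) :
    (fun n : ℕ => (a + b * logStar n) / n) =O[atTop] fun n : ℕ => logStar n / n := by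
  have h : (fun n : ℕ => a + b * logStar n) =O[atTop] fun n : ℕ => logStar n :=
    (isLittleO_const_logStar a).isBigO.add ((isBigO_refl _ _).const_mul_left b)
  exact h.mul (isBigO_refl (fun n : ℕ => ((n : ℝ))⁻¹) atTop)

theorem isBigO_logStar_log : (fun n : ℕ => logStar n) =O[atTop] fun n : ℕ => Real.log n := by
  refine IsBigO.of_bound (4 / Real.log 2) ?_
  filter_upwards [eventually_ge_atTop 1] with n hn
  have hn1 : (1 : ℝ) ≤ n := by exact_mod_cast hn
  rw [Real.norm_of_nonneg (logStar_nonneg _), Real.norm_of_nonneg (Real.log_nonneg hn1)]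
  refine (logStar_le_mul_logb hn1).trans (le_of_eq ?_)
  rw [Real.logb]
  ring

theorem isLittleO_logStar_div_rpow {r : ℝ} (hr : 0 < r) :
    (fun n : ℕ => logStar n / n) =o[atTop] fun n : ℕ => (n : ℝ) ^ (r - 1) := by
  have h : (fun n : ℕ => logStar n) =o[atTop] fun n : ℕ => (n : ℝ) ^ r :=
    isBigO_logStar_log.trans_isLittleO
      ((isLittleO_log_rpow_atTop hr).comp_tendsto tendsto_natCast_atTop_atTop)
  refine (h.mul_isBigO (isBigO_refl (fun n : ℕ => ((n : ℝ))⁻¹) atTop)).congr'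
    (Eventually.of_forall fun n => rfl) ?_
  filter_upwards [eventually_ge_atTop 1] with n hn
  have hn0 : (0 : ℝ) < n := by exact_mod_cast hn
  rw [Real.rpow_sub_one hn0.ne', div_eq_mul_inv]

theorem isBigO_gammaPrime (c : ℝ) (m l κ : ℕ) (h : ℝ) :
    (fun n : ℕ => gammaPrime c m l κ h n) =O[atTop] fun n : ℕ => logStar n / n := by
  refine (isBigO_add_mul_logStar_div (c + logStar m + l * κ + m * logStar l + m * h)
    ((l : ℝ) ^ (m + 1))).congr_left fun n => ?_
  unfold gammaPrime
  ring

theorem tendsto_gammaPrime (c : ℝ) (m l κ : ℕ) (h : ℝ) :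
    Tendsto (fun n : ℕ => gammaPrime c m l κ h n) atTop (𝓝 0) := by
  refine (isBigO_gammaPrime c m l κ h).trans_tendsto ?_
  have h1 := (isLittleO_logStar_div_rpow (r := 1 / 2) (by norm_num)).isBigO
  refine h1.trans_tendsto ?_
  have h2 := (tendsto_rpow_neg_atTop (y := 1 / 2) (by norm_num)).comp
    (tendsto_natCast_atTop_atTop (R := ℝ))
  refine h2.congr fun n => ?_
  norm_num [Function.comp]

theorem isEquivalent_complexityVar (c : ℝ) (κ : ℕ) (Δ : ℝ) :
    (fun n : ℕ => complexityVar c κ Δ n) ~[atTop] fun n : ℕ => 2 * Δ ^ 2 * logStar n ^ 2 := by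
  have h1 : (fun n : ℕ => c + logStar n + κ) ~[atTop] fun n : ℕ => logStar n := by
    have h : (fun n : ℕ => logStar n + (c + κ)) ~[atTop] fun n : ℕ => logStar n :=
      IsEquivalent.refl.add_isLittleO (isLittleO_const_logStar (c + κ))
    exact h.congr_left (Eventually.of_forall fun n => by simp only; ring)
  exact (IsEquivalent.refl (u := fun _ : ℕ => 2 * Δ ^ 2)).mul (h1.pow 2)

theorem isEquivalent_exponent (c : ℝ) (m l κ : ℕ) (h Δ : ℝ) {t : ℝ} (ht : 0 < t) :
    (fun n : ℕ => n * (t - gammaPrime c m l κ h n) ^ 2 / complexityVar c κ Δ n) ~[atTop]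
      fun n : ℕ => n * t ^ 2 / (2 * Δ ^ 2 * logStar n ^ 2) := by
  have h1 : (fun n : ℕ => t - gammaPrime c m l κ h n) ~[atTop] fun _ : ℕ => t := by
    refine (isEquivalent_const_iff_tendsto ht.ne').2 ?_
    simpa using (tendsto_gammaPrime c m l κ h).const_sub t
  exact ((IsEquivalent.refl (u := fun n : ℕ => (n : ℝ))).mul (h1.pow 2)).div
    (isEquivalent_complexityVar c κ Δ)

theorem isBigO_gammaSeq (c : ℝ) (m l κ : ℕ) (h : ℝ) {η : ℝ} (hη : η < 1 / 2) :
    (fun n : ℕ => gammaSeq c m l κ h η n) =O[atTop]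
      fun n : ℕ => (n : ℝ) ^ (-(1 / 2 : ℝ) - η) := by
  have h1 : (fun n : ℕ => (c + logStar m + l * κ - m * logStar l + m * h +
      (l : ℝ) ^ (m + 1) * logStar n) / n) =O[atTop]
      fun n : ℕ => (n : ℝ) ^ (-(1 / 2 : ℝ) - η) := by
    refine (isBigO_add_mul_logStar_div _ _).trans ?_
    have h2 := (isLittleO_logStar_div_rpow (r := 1 / 2 - η) (by linarith)).isBigO
    rwa [show (1 / 2 : ℝ) - η - 1 = -(1 / 2) - η by ring] at h2
  refine (h1.add (isBigO_refl _ _)).congr_left fun n => ?_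
  unfold gammaSeq overheadConst
  ring

end Asymptotic

/-! ### Deviation of the complexity from the entropy -/

section Deviation

theorem expNegDiv_mul_left {a : ℝ} (ha : 0 < a) (s K : ℝ) :
    expNegDiv (a * s) (a * K) = expNegDiv s K := by
  unfold expNegDiv
  by_cases hK : K = 0
  · simp [hK]
  · rw [if_neg (mul_ne_zero ha.ne' hK), if_neg hK, mul_div_mul_left _ _ ha.ne']

/-- For long words the slack between `log* n` and `log₂ (n + 1)`, which occurs once for each
transition, absorbs all other overheads that depend on `l` and `m`. -/
theorem overhead_le {C B n l m : ℕ} (hB : 2 * (C + 8) ≤ B) (hn : 2 ^ 2 ^ (B + 1) ≤ n)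
    (hl : 1 ≤ l) :
    l * C + logStar l + 2 * (m * Real.logb 2 l) + m * logStar l + logStar n +
      ((l ^ (m + 1) - 1 : ℕ) : ℝ) * Real.logb 2 (n + 1) ≤ (l : ℝ) ^ (m + 1) * logStar n + C := by
  rcases hl.eq_or_lt with rfl | hl
  · simp [logStar_of_le_one, add_comm]
  · have h1 := logb_add_one_add_le_logStar hn
    have hl0 : (2 : ℝ) ≤ l := by exact_mod_cast hl
    have h2 : logStar l ≤ 3 * l := logStar_le (by linarith)
    have h3 : Real.logb 2 l ≤ l := (logb_two_le (by linarith)).trans (by linarith)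
    have hk1 : 1 ≤ l ^ (m + 1) := Nat.one_le_pow _ _ (by omega)
    rw [Nat.cast_sub hk1]
    push_cast
    set k : ℝ := (l : ℝ) ^ (m + 1) with hk
    have hm : ((m : ℝ) + 1) ≤ (l : ℝ) ^ m := by
      have h4 : m + 1 ≤ l ^ m := (Nat.lt_two_pow_self (n := m)).trans_le
        (Nat.pow_le_pow_left hl m)
      exact_mod_cast h4
    have hkm : (l : ℝ) * (m + 1) ≤ k := by
      rw [hk, pow_succ']
      exact mul_le_mul_of_nonneg_left hm (by linarith)
    have hm0 : (0 : ℝ) ≤ m := Nat.cast_nonneg m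
    have hk2 : (2 : ℝ) ≤ k := by nlinarith
    have hB' : 2 * ((C : ℝ) + 8) ≤ B := by exact_mod_cast hB
    have h5 : (k - 1) * Real.logb 2 (n + 1) ≤ (k - 1) * (logStar n - B) :=
      mul_le_mul_of_nonneg_left (by linarith) (by linarith)
    have h6 : (k - 1) * (2 * ((C : ℝ) + 8)) ≤ (k - 1) * B :=
      mul_le_mul_of_nonneg_left hB' (by linarith)
    have h7 : (l : ℝ) * (m + 1) * (C + 8) ≤ k * (C + 8) :=
      mul_le_mul_of_nonneg_right hkm (by positivity)
    have h8 : k * ((C : ℝ) + 8) ≤ (k - 1) * (2 * (C + 8)) := by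
      nlinarith [mul_nonneg (show (0 : ℝ) ≤ k - 2 by linarith) (show (0 : ℝ) ≤ C + 8 by positivity)]
    have h9 := mul_le_mul_of_nonneg_left h3 hm0
    have h10 := mul_le_mul_of_nonneg_left h2 hm0
    have h11 : (0 : ℝ) ≤ l * m * C := by positivity
    have h12 : (0 : ℝ) ≤ l * m := by positivity
    nlinarith

variable {Ω : Type v} [MeasurableSpace Ω] {A : Type u} {P : Measure Ω} {X : ℤ → Ω → A}

theorem logDiff_le_stabilityCoeff [DecidableEq A] {n : ℕ} {x x' : Fin n → A}
    (h : hammingDist x x' ≤ 1) :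
    logDiff (wordProb P X x) (wordProb P X x') ≤ stabilityCoeff P X :=
  le_iSup_of_le n <| le_iSup_of_le x <| le_iSup_of_le x' <|
    le_iSup (fun _ : hammingDist x x' ≤ 1 => logDiff (wordProb P X x) (wordProb P X x')) h

/-- A word is at distance `0` from itself, so a finite stability coefficient excludes words of
probability `0`. -/
theorem wordProb_pos_of_stabilityCoeff_ne_top [DecidableEq A] (h : stabilityCoeff P X ≠ ⊤) {n : ℕ}
    (x : Fin n → A) : 0 < wordProb P X x := by
  refine lt_of_le_of_ne measureReal_nonneg fun h0 => h ?_
  rw [eq_top_iff]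
  refine le_trans (le_of_eq ?_) (logDiff_le_stabilityCoeff (x := x) (x' := x) (by simp))
  rw [logDiff, if_pos (Or.inl h0.symm)]

theorem abs_logb_wordProb_sub_le [DecidableEq A] (h : stabilityCoeff P X ≠ ⊤) {n : ℕ}
    {x x' : Fin n → A} {k : Fin n} (hk : ∀ j, j ≠ k → x j = x' j) :
    |-Real.logb 2 (wordProb P X x) - -Real.logb 2 (wordProb P X x')| ≤
      (stabilityCoeff P X).toReal := by
  have : Nonempty (Fin n) := ⟨k⟩
  have hd : hammingDist x x' ≤ 1 := by
    rw [hammingDist, Finset.card_le_one_iff_subset_singleton]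
    refine ⟨k, fun j hj => ?_⟩
    by_contra hjk
    exact (Finset.mem_filter.1 hj).2 (hk j (by simpa using hjk))
  have h1 := logDiff_le_stabilityCoeff (P := P) (X := X) hd
  rw [logDiff, if_neg (by
    rw [not_or]
    exact ⟨(wordProb_pos_of_stabilityCoeff_ne_top h x).ne',
      (wordProb_pos_of_stabilityCoeff_ne_top h x').ne'⟩)] at h1
  rw [neg_sub_neg, abs_sub_comm]
  exact (ENNReal.ofReal_le_iff_le_toReal h).1 h1

theorem entropyBits_nonneg [Fintype A] [IsProbabilityMeasure P] : 0 ≤ entropyBits P X := by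
  refine Finset.sum_nonneg fun a _ => div_nonneg (Real.negMulLog_nonneg measureReal_nonneg
    measureReal_le_one) (Real.log_nonneg (by norm_num))

variable [Fintype A] {U : List Bool →. List Bool}

theorem IsUniversalPrefixMachine.sum_two_pow_neg_wordComplexity_le
    (hU : IsUniversalPrefixMachine U) {rep : A → List Bool} (hrep : Function.Injective rep)
    (n : ℕ) : ∑ x : Fin n → A, (1 / 2 : ℝ) ^ wordComplexity U rep x ≤ 1 := by
  refine hU.sum_two_pow_neg_kolmogorov_le Finset.univ
    (f := fun x : Fin n → A => binaryRep (List.ofFn fun i => rep (x i))) fun x y h => ?_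
  have h1 := List.ofFn_injective (binaryRep_injective h)
  exact funext fun i => hrep (congrFun h1 i)

theorem logb_one_half_pow (k : ℕ) : -Real.logb 2 ((1 / 2 : ℝ) ^ k) = k := by
  rw [Real.logb_pow, one_div, Real.logb_inv, Real.logb_self_eq_one (by norm_num)]
  ring

variable [MeasurableSpace A] [MeasurableSingletonClass A]

/-- Noiseless coding: by the Kraft inequality and Gibbs' inequality, the mean complexity is at least
the entropy. -/
theorem wordEntropy_le_mean_wordComplexity [IsProbabilityMeasure P]
    (hU : IsUniversalPrefixMachine U) {rep : A → List Bool} (hrep : Function.Injective rep)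
    (hX : ∀ i, Measurable (X i)) {n : ℕ} (hpos : ∀ x : Fin n → A, 0 < wordProb P X x) :
    wordEntropy P X n ≤ ∑ x : Fin n → A, wordProb P X x * wordComplexity U rep x := by
  have h := gibbs_inequality (q := fun x => (1 / 2 : ℝ) ^ wordComplexity U rep x) hpos
    (fun _ => by positivity) (by
      rw [sum_wordProb hX]
      exact hU.sum_two_pow_neg_wordComplexity_le hrep n)
  simp only [logb_one_half_pow] at h
  exact h

/-- By the Kraft inequality, the complexity of a word is rarely much smaller than its information
content. -/
theorem measureReal_wordComplexity_le [IsProbabilityMeasure P] (hU : IsUniversalPrefixMachine U)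
    {rep : A → List Bool} (hrep : Function.Injective rep) (hX : ∀ i, Measurable (X i)) {n : ℕ}
    (hpos : ∀ x : Fin n → A, 0 < wordProb P X x) (r : ℝ) :
    P.real {ω | (wordComplexity U rep (wordOf X n ω) : ℝ) ≤
      -Real.logb 2 (wordProb P X (wordOf X n ω)) - r} ≤ (2 : ℝ) ^ (-r) := by
  classical
  rw [measureReal_wordOf hX fun x => (wordComplexity U rep x : ℝ) ≤
    -Real.logb 2 (wordProb P X x) - r]
  calc _ ≤ ∑ x : Fin n → A, (2 : ℝ) ^ (-r) * (1 / 2 : ℝ) ^ wordComplexity U rep x := by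
        refine Finset.sum_le_sum fun x _ => ?_
        split_ifs with h
        · have h1 : Real.logb 2 (wordProb P X x) ≤ -r + -(wordComplexity U rep x : ℝ) := by
            linarith
          rw [Real.logb_le_iff_le_rpow (by norm_num) (hpos x), Real.rpow_add (by norm_num),
            Real.rpow_neg (by norm_num) (wordComplexity U rep x : ℝ), Real.rpow_natCast] at h1
          simpa using h1
        · positivity
    _ ≤ (2 : ℝ) ^ (-r) := by
        rw [← Finset.mul_sum]
        exact mul_le_of_le_one_right (by positivity)
          (hU.sum_two_pow_neg_wordComplexity_le hrep n)

/-- Concentration of the complexity itself, whose bounded differences are the cost of describing a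
position and a letter, around its mean, which is close to `n H`. -/
theorem measureReal_complexity_deviation_le [IsProbabilityMeasure P]
    (hX : ∀ i, Measurable (X i)) (hφ : Summable (phiMixing P X)) {n : ℕ} (hn : 1 ≤ n)
    (hpos : ∀ x : Fin n → A, 0 < wordProb P X x) {f : (Fin n → A) → ℝ} {c H g t : ℝ} (hc : 0 < c)
    (hf : ∀ y y' k, (∀ j, j ≠ k → y j = y' j) → |f y - f y'| ≤ c)
    (hg : 0 ≤ g) (hlow : n * H ≤ ∑ x, wordProb P X x * f x)
    (hup : ∑ x, wordProb P X x * f x ≤ n * H + n * g) (ht : g < t) :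
    P.real {ω | t < |f (wordOf X n ω) / n - H|} ≤
      2 * Real.exp (-(n * (t - g) ^ 2 / (2 * mixingConst P X ^ 2 * c ^ 2))) := by
  have hn0 : (0 : ℝ) < n := by exact_mod_cast hn
  have hs : 0 < n * (t - g) := mul_pos hn0 (by linarith)
  have hΔ : (0 : ℝ) < mixingConst P X := zero_lt_one.trans_le one_le_mixingConst
  have hexp : expNegDiv ((n * (t - g)) ^ 2) (2 * n * (c * mixingConst P X) ^ 2) =
      Real.exp (-(n * (t - g) ^ 2 / (2 * mixingConst P X ^ 2 * c ^ 2))) := by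
    rw [show ((n : ℝ) * (t - g)) ^ 2 = n * (n * (t - g) ^ 2) by ring,
      show 2 * n * (c * mixingConst P X) ^ 2 = n * (2 * mixingConst P X ^ 2 * c ^ 2) by ring,
      expNegDiv_mul_left hn0, expNegDiv, if_neg (by positivity)]
  have h1 := measureReal_deviation_le hX hφ hn hpos hc.le hf hs
  have h2 := measureReal_deviation_le hX hφ hn hpos hc.le (f := fun y => -f y)
    (fun y y' k h => by rw [neg_sub_neg, abs_sub_comm]; exact hf y y' k h) hs
  simp only [mul_neg, Finset.sum_neg_distrib] at h2
  rw [hexp] at h1 h2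
  set μ := ∑ x, wordProb P X x * f x with hμ
  have hsub : {ω | t < |f (wordOf X n ω) / n - H|} ⊆
      {ω | n * (t - g) ≤ f (wordOf X n ω) - μ} ∪ {ω | n * (t - g) ≤ -f (wordOf X n ω) - -μ} := by
    intro ω hω
    have hng : 0 ≤ n * g := mul_nonneg hn0.le hg
    simp only [Set.mem_ofPred_eq] at hω
    rcases lt_abs.1 hω with h | h
    · left
      have h3 := mul_lt_mul_of_pos_left h hn0
      rw [mul_sub, mul_div_cancel₀ _ hn0.ne'] at h3
      change n * (t - g) ≤ f (wordOf X n ω) - μ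
      linarith
    · right
      have h3 := mul_lt_mul_of_pos_left h hn0
      rw [neg_sub, mul_sub, mul_div_cancel₀ _ hn0.ne'] at h3
      change n * (t - g) ≤ -f (wordOf X n ω) - -μ
      linarith
  refine (measureReal_mono hsub).trans ((measureReal_union_le _ _).trans ?_)
  linarith

/-- If the complexity of a word exceeds its information content by at most `V`, it is as
concentrated as the information content. -/
theorem measureReal_complexity_deviation_le_of_stable [IsProbabilityMeasure P] [DecidableEq A]
    (hU : IsUniversalPrefixMachine U) {rep : A → List Bool} (hrep : Function.Injective rep)
    (hX : ∀ i, Measurable (X i)) (hφ : Summable (phiMixing P X))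
    (hstab : stabilityCoeff P X ≠ ⊤) {n : ℕ} (hn : 1 ≤ n) {H V r b t : ℝ}
    (hup : ∀ x : Fin n → A, (wordComplexity U rep x : ℝ) ≤
      V - b - Real.logb 2 (wordProb P X x))
    (hEup : wordEntropy P X n ≤ n * H + b) (hElow : n * H ≤ wordEntropy P X n)
    (hV : 0 ≤ V) (hr : 0 ≤ r) (ht : V + r < n * t) :
    P.real {ω | t ≤ |(wordComplexity U rep (wordOf X n ω) : ℝ) / n - H|} ≤
      2 * expNegDiv (n * (t - (V + r) / n) ^ 2)
        (2 * (stabilityCoeff P X).toReal ^ 2 * mixingConst P X ^ 2) + (2 : ℝ) ^ (-r) := by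
  have hpos : ∀ x : Fin n → A, 0 < wordProb P X x :=
    wordProb_pos_of_stabilityCoeff_ne_top hstab
  have hn0 : (0 : ℝ) < n := by exact_mod_cast hn
  set M := (stabilityCoeff P X).toReal with hM
  set f : (Fin n → A) → ℝ := fun x => -Real.logb 2 (wordProb P X x) with hf
  have hs : 0 < n * t - (V + r) := by linarith
  have hexp : expNegDiv ((n * t - (V + r)) ^ 2) (2 * n * (M * mixingConst P X) ^ 2) =
      expNegDiv (n * (t - (V + r) / n) ^ 2) (2 * M ^ 2 * mixingConst P X ^ 2) := by
    have h : n * (t - (V + r) / n) = n * t - (V + r) := by field_simp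
    rw [← h, show ((n : ℝ) * (t - (V + r) / n)) ^ 2 = n * (n * (t - (V + r) / n) ^ 2) by ring,
      show 2 * n * (M * mixingConst P X) ^ 2 = n * (2 * M ^ 2 * mixingConst P X ^ 2) by ring,
      expNegDiv_mul_left hn0]
  have h1 := measureReal_deviation_le hX hφ hn hpos (f := f) (c := M) ENNReal.toReal_nonneg
    (fun y y' k h => abs_logb_wordProb_sub_le hstab h) hs
  have h2 := measureReal_deviation_le hX hφ hn hpos (f := fun y => -f y) (c := M)
    ENNReal.toReal_nonneg (fun y y' k h => by
      rw [neg_sub_neg, abs_sub_comm]; exact abs_logb_wordProb_sub_le hstab h) hs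
  have h3 := measureReal_wordComplexity_le hU hrep hX hpos r
  have hE : ∑ y, wordProb P X y * f y = wordEntropy P X n := rfl
  simp only [mul_neg, Finset.sum_neg_distrib] at h2
  rw [hE, hexp] at h1 h2
  have hsub : {ω | t ≤ |(wordComplexity U rep (wordOf X n ω) : ℝ) / n - H|} ⊆
      ({ω | n * t - (V + r) ≤ f (wordOf X n ω) - wordEntropy P X n} ∪
        {ω | n * t - (V + r) ≤ -f (wordOf X n ω) - -wordEntropy P X n}) ∪
      {ω | (wordComplexity U rep (wordOf X n ω) : ℝ) ≤
        -Real.logb 2 (wordProb P X (wordOf X n ω)) - r} := by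
    intro ω hω
    simp only [Set.mem_ofPred_eq] at hω
    rcases le_abs.1 hω with h | h
    · left; left
      have h4 := mul_le_mul_of_nonneg_left h hn0.le
      rw [mul_sub, mul_div_cancel₀ _ hn0.ne'] at h4
      have h5 := hup (wordOf X n ω)
      change n * t - (V + r) ≤ -Real.logb 2 (wordProb P X (wordOf X n ω)) - wordEntropy P X n
      linarith
    · have h4 := mul_le_mul_of_nonneg_left h hn0.le
      rw [neg_sub, mul_sub, mul_div_cancel₀ _ hn0.ne'] at h4
      by_cases hbad : (wordComplexity U rep (wordOf X n ω) : ℝ) ≤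
        -Real.logb 2 (wordProb P X (wordOf X n ω)) - r
      · exact Or.inr hbad
      · left; right
        change n * t - (V + r) ≤ - -Real.logb 2 (wordProb P X (wordOf X n ω)) - -wordEntropy P X n
        linarith
  refine (measureReal_mono hsub).trans ((measureReal_union_le _ _).trans ?_)
  have h4 := measureReal_union_le (μ := P)
    {ω | n * t - (V + r) ≤ f (wordOf X n ω) - wordEntropy P X n}
    {ω | n * t - (V + r) ≤ -f (wordOf X n ω) - -wordEntropy P X n}
  linarith

end Deviation

/-! ### The two bounds -/

/-- The coding theorem in terms of `overheadConst`, for words that are long compared with the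
constants of the machine. -/
theorem IsUniversalPrefixMachine.exists_wordComplexity_le_overheadConst
    {U : List Bool →. List Bool} (hU : IsUniversalPrefixMachine U) :
    ∃ C N : ℕ, ∀ (A : Type u) [Fintype A] [MeasurableSpace A] [MeasurableSingletonClass A]
      (rep : A → List Bool) (Ω : Type v) [MeasurableSpace Ω] (P : Measure Ω)
      [IsProbabilityMeasure P] (X : ℤ → Ω → A) (m : ℕ), (∀ i, Measurable (X i)) →
      IsStationarySeq P X → IsMarkovOfOrder P X m →
      (∀ n, ∀ x : Fin n → A, 0 < wordProb P X x) → ∀ n, N ≤ n →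
      0 ≤ overheadConst C m (Fintype.card A) (maxLetterComplexity U rep) n ∧
      ∀ x : Fin n → A, (wordComplexity U rep x : ℝ) ≤
        overheadConst C m (Fintype.card A) (maxLetterComplexity U rep) n -
          m * Real.logb 2 (Fintype.card A) - Real.logb 2 (wordProb P X x) := by
  obtain ⟨C, hC⟩ := hU.exists_wordComplexity_le.{u, v}
  refine ⟨2 * C, 2 ^ 2 ^ (2 * (C + 8) + 1), fun A _ _ _ rep Ω _ P _ X m hX hst hM hpos n hn => ?_⟩
  have hΩ : Nonempty Ω := nonempty_of_isProbabilityMeasure P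
  have hA : 1 ≤ Fintype.card A := Fintype.card_pos_iff.2 ⟨X 0 hΩ.some⟩
  have hA' : (1 : ℝ) ≤ Fintype.card A := by exact_mod_cast hA
  have h1 := overhead_le (C := C) (m := m) le_rfl hn hA
  have h2 : (0 : ℝ) ≤ m * Real.logb 2 (Fintype.card A) :=
    mul_nonneg (Nat.cast_nonneg m) (Real.logb_nonneg (by norm_num) hA')
  have h3 : (0 : ℝ) ≤ Fintype.card A * (C : ℝ) := by positivity
  have h4 : (0 : ℝ) ≤ Fintype.card A * (maxLetterComplexity U rep : ℝ) := by positivity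
  have h5 : (0 : ℝ) ≤ ((Fintype.card A ^ (m + 1) - 1 : ℕ) : ℝ) * Real.logb 2 (n + 1) :=
    mul_nonneg (Nat.cast_nonneg _) (Real.logb_nonneg (by norm_num)
      (by linarith [(Nat.cast_nonneg n : (0 : ℝ) ≤ n)]))
  have h6 := logStar_nonneg (Fintype.card A)
  have h7 := logStar_nonneg n
  have h8 := logStar_nonneg m
  have h9 : (0 : ℝ) ≤ C := Nat.cast_nonneg C
  unfold overheadConst
  push_cast
  refine ⟨by linarith, fun x => ?_⟩
  have h10 := hC A rep Ω P X m hX hst hM hpos n x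
  linarith

/-- On words of bounded length the error term `n ζ 2 ^ (-n ^ (1/2 - η))` exceeds `1`. -/
theorem one_le_mul_two_rpow_neg {n N : ℕ} (hn : 1 ≤ n) (hN : n ≤ N) {ζ r : ℝ}
    (hζ : (2 : ℝ) ^ N ≤ ζ) (hr : r ≤ n) : 1 ≤ n * ζ * (2 : ℝ) ^ (-r) := by
  have h1 : (2 : ℝ) ^ (-(N : ℝ)) ≤ (2 : ℝ) ^ (-r) :=
    Real.rpow_le_rpow_of_exponent_le (by norm_num)
      (by linarith [(Nat.cast_le.2 hN : (n : ℝ) ≤ N)])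
  rw [Real.rpow_neg (by norm_num), Real.rpow_natCast] at h1
  have h2 : (1 : ℝ) ≤ n := by exact_mod_cast hn
  have h3 : (2 : ℝ) ^ N ≤ n * ζ := by
    have : (0 : ℝ) < 2 ^ N := by positivity
    nlinarith
  calc (1 : ℝ) = 2 ^ N * (2 ^ N)⁻¹ := (mul_inv_cancel₀ (by positivity)).symm
    _ ≤ n * ζ * (2 : ℝ) ^ (-r) :=
      mul_le_mul h3 h1 (by positivity) (le_trans (by positivity) h3)

theorem expNegDiv_nonneg (s K : ℝ) : 0 ≤ expNegDiv s K := by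
  unfold expNegDiv
  split_ifs
  · exact le_rfl
  · exact (Real.exp_pos _).le

theorem overheadConst_mono {c c' : ℝ} (h : c ≤ c') (m l κ n : ℕ) :
    overheadConst c m l κ n ≤ overheadConst c' m l κ n := by
  unfold overheadConst
  linarith

theorem mainTheorem2 (U : List Bool →. List Bool) (hU : IsUniversalPrefixMachine U) :
    ∃ C' : ℝ, 0 < C' ∧
      ∀ (A : Type u) [Fintype A] [DecidableEq A] [MeasurableSpace A] [MeasurableSingletonClass A]
        (rep : A → List Bool), Function.Injective rep →
      ∀ (l κ : ℕ), l = Fintype.card A → κ = maxLetterComplexity U rep →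
      ∃ ζ : ℝ, ζ ≤ C' + κ ∧
      ∀ (Ω : Type v) [MeasurableSpace Ω] (P : Measure Ω) [IsProbabilityMeasure P]
        (X : ℤ → Ω → A) (m : ℕ),
        (∀ i, Measurable (X i)) →
        IsStationarySeq P X →
        IsMarkovOfOrder P X m →
        stabilityCoeff P X ≠ ⊤ →
        Summable (phiMixing P X) →
      ∀ (M Δ H H₁ : ℝ), M = (stabilityCoeff P X).toReal → Δ = mixingConst P X →
        H = condEntropyBits P X m → H₁ = entropyBits P X →
        -- the first bound
        (∀ (n : ℕ) (t : ℝ), 1 ≤ n → gammaPrime C' m l κ H₁ n < t →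
          P.real {ω | t < |(wordComplexity U rep (wordOf X n ω) : ℝ) / n - H|} ≤
            2 * Real.exp (-(n * (t - gammaPrime C' m l κ H₁ n) ^ 2 / complexityVar C' κ Δ n))) ∧
        -- the orders of magnitude of its terms
        (fun n : ℕ => gammaPrime C' m l κ H₁ n) =O[atTop] (fun n : ℕ => logStar n / n) ∧
        (fun n : ℕ => complexityVar C' κ Δ n) ~[atTop]
          (fun n : ℕ => 2 * Δ ^ 2 * logStar n ^ 2) ∧
        (∀ t : ℝ, 0 < t →
          (fun n : ℕ => n * (t - gammaPrime C' m l κ H₁ n) ^ 2 / complexityVar C' κ Δ n) ~[atTop]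
            (fun n : ℕ => n * t ^ 2 / (2 * Δ ^ 2 * logStar n ^ 2))) ∧
        -- the second bound
        ∀ η : ℝ, 0 < η → η < 1 / 2 →
          (∀ (n : ℕ) (t : ℝ), 1 ≤ n → gammaSeq C' m l κ H η n < t →
            P.real {ω | t ≤ |(wordComplexity U rep (wordOf X n ω) : ℝ) / n - H|} ≤
              2 * expNegDiv (n * (t - gammaSeq C' m l κ H η n) ^ 2) (2 * M ^ 2 * Δ ^ 2) +
                n * ζ * (2 : ℝ) ^ (-(n : ℝ) ^ (1 / 2 - η))) ∧
          (fun n : ℕ => gammaSeq C' m l κ H η n) =O[atTop]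
            (fun n : ℕ => (n : ℝ) ^ (-(1 / 2 : ℝ) - η)) := by
  obtain ⟨C₀, N, hC₀⟩ := hU.exists_wordComplexity_le_overheadConst.{u, v}
  obtain ⟨C₁, hC₁⟩ := hU.exists_wordComplexity_le_of_length_le.{u} N
  obtain ⟨C₂, hC₂⟩ := hU.exists_abs_wordComplexity_sub_le.{u}
  -- `C₁` covers the short words in the first bound; `2 ^ N` makes the second bound trivial for
  -- them.
  refine ⟨C₀ + C₁ + C₂ + 2 ^ N, by positivity, ?_⟩
  set C' : ℝ := C₀ + C₁ + C₂ + 2 ^ N with hC'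
  have hC₀0 : (0 : ℝ) ≤ C₀ := Nat.cast_nonneg _
  have hC₁0 : (0 : ℝ) ≤ C₁ := Nat.cast_nonneg _
  have hC₂0 : (0 : ℝ) ≤ C₂ := Nat.cast_nonneg _
  have hN1 : (1 : ℝ) ≤ 2 ^ N := one_le_pow₀ (by norm_num)
  intro A _ _ _ _ rep hrep l κ hl hκ
  refine ⟨C' + κ, le_rfl, ?_⟩
  intro Ω _ P _ X m hX hst hM hstab hφ M Δ H H₁ hMeq hΔ hH hH₁
  have hpos : ∀ n, ∀ x : Fin n → A, 0 < wordProb P X x := fun n =>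
    wordProb_pos_of_stabilityCoeff_ne_top hstab
  have hΩ : Nonempty Ω := nonempty_of_isProbabilityMeasure P
  have hl1 : 1 ≤ l := hl ▸ Fintype.card_pos_iff.2 ⟨X 0 hΩ.some⟩
  have hlog : (0 : ℝ) ≤ m * Real.logb 2 l :=
    mul_nonneg (Nat.cast_nonneg m) (Real.logb_nonneg (by norm_num) (by exact_mod_cast hl1))
  have hH0 : 0 ≤ H := by
    rw [hH, condEntropyBits_eq_nextEntropy hst hX hpos m]
    exact nextEntropy_nonneg hst hX hpos m
  have hH₁0 : 0 ≤ m * H₁ := mul_nonneg (Nat.cast_nonneg m) (hH₁ ▸ entropyBits_nonneg)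
  have hκ0 : (0 : ℝ) ≤ κ := Nat.cast_nonneg κ
  have hlκ : (0 : ℝ) ≤ l * (κ : ℝ) := by positivity
  have hm0 := logStar_nonneg m
  have hml : 0 ≤ m * logStar l := mul_nonneg (Nat.cast_nonneg m) (logStar_nonneg l)
  have hln (n : ℕ) : 0 ≤ (l : ℝ) ^ (m + 1) * logStar n :=
    mul_nonneg (by positivity) (logStar_nonneg n)
  have hElow (n : ℕ) : n * H ≤ wordEntropy P X n := by
    rw [hH]
    exact mul_condEntropyBits_le_wordEntropy hM hst hX hpos n
  have hEup (n : ℕ) : wordEntropy P X n ≤ n * H + m * Real.logb 2 l := by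
    rw [hH, hl]
    exact wordEntropy_le_mul_condEntropyBits_add hM hst hX hpos n
  have hcode (n : ℕ) (hn : N ≤ n) := hC₀ A rep Ω P X m hX hst hM hpos n hn
  rw [← hl, ← hκ] at hcode
  have hsum (n : ℕ) : ∑ x : Fin n → A, wordProb P X x = 1 := sum_wordProb hX n
  refine ⟨fun n t hn ht => ?_, isBigO_gammaPrime C' m l κ H₁, isEquivalent_complexityVar C' κ Δ,
    fun t ht => isEquivalent_exponent C' m l κ H₁ Δ ht, fun η hη0 hη => ⟨fun n t hn ht => ?_,
    isBigO_gammaSeq C' m l κ H hη⟩⟩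
  · have hn0 : (0 : ℝ) < n := by exact_mod_cast hn
    have hng : n * gammaPrime C' m l κ H₁ n =
        C' + logStar m + l * κ + (l : ℝ) ^ (m + 1) * logStar n + m * logStar l + m * H₁ :=
      mul_div_cancel₀ _ hn0.ne'
    have hg : 0 ≤ gammaPrime C' m l κ H₁ n := by
      refine div_nonneg ?_ hn0.le
      linarith [hln n]
    have hc : 0 < C' + logStar n + κ := by linarith [logStar_nonneg n]
    have hf (y y' : Fin n → A) (k : Fin n) (h : ∀ j, j ≠ k → y j = y' j) :
        |(wordComplexity U rep y : ℝ) - wordComplexity U rep y'| ≤ C' + logStar n + κ := by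
      have := hC₂ A rep n y y' k h
      rw [← hκ] at this
      linarith
    have hup : ∑ x : Fin n → A, wordProb P X x * (wordComplexity U rep x : ℝ) ≤
        n * H + n * gammaPrime C' m l κ H₁ n := by
      rw [hng]
      rcases le_total N n with hN | hN
      · calc ∑ x : Fin n → A, wordProb P X x * (wordComplexity U rep x : ℝ)
            ≤ ∑ x : Fin n → A, (wordProb P X x * (overheadConst C₀ m l κ n - m * Real.logb 2 l) +
                wordProb P X x * -Real.logb 2 (wordProb P X x)) := by
              refine Finset.sum_le_sum fun x _ => ?_
              rw [← mul_add]
              exact mul_le_mul_of_nonneg_left ((hcode n hN).2 x) (hpos n x).le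
          _ = overheadConst C₀ m l κ n - m * Real.logb 2 l + wordEntropy P X n := by
              rw [Finset.sum_add_distrib, ← Finset.sum_mul, hsum, one_mul]
              rfl
          _ ≤ _ := by
              unfold overheadConst
              linarith [hEup n]
      · calc ∑ x : Fin n → A, wordProb P X x * (wordComplexity U rep x : ℝ)
            ≤ ∑ x : Fin n → A, wordProb P X x * (l * κ + C₁) := by
              refine Finset.sum_le_sum fun x _ => mul_le_mul_of_nonneg_left ?_ (hpos n x).le
              rw [hl, hκ]
              exact_mod_cast hC₁ A rep n hN x
          _ = l * κ + C₁ := by rw [← Finset.sum_mul, hsum, one_mul]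
          _ ≤ _ := by
              have : 0 ≤ n * H := mul_nonneg hn0.le hH0
              linarith [hln n]
    rw [complexityVar, hΔ]
    exact measureReal_complexity_deviation_le hX hφ hn (hpos n) hc hf hg
      ((hElow n).trans (wordEntropy_le_mean_wordComplexity hU hrep hX (hpos n))) hup ht
  · have hn0 : (0 : ℝ) < n := by exact_mod_cast hn
    have hn1 : (1 : ℝ) ≤ n := by exact_mod_cast hn
    have hrn : (n : ℝ) ^ (1 / 2 - η) ≤ n := by
      simpa using Real.rpow_le_rpow_of_exponent_le hn1 (show 1 / 2 - η ≤ 1 by linarith)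
    have hexp := expNegDiv_nonneg (n * (t - gammaSeq C' m l κ H η n) ^ 2) (2 * M ^ 2 * Δ ^ 2)
    rcases le_total n N with hN | hN
    · have h1 := one_le_mul_two_rpow_neg hn hN (ζ := C' + κ) (by linarith) hrn
      refine measureReal_le_one.trans ?_
      linarith
    · have hmH : 0 ≤ m * H := mul_nonneg (Nat.cast_nonneg m) hH0
      have hmono : overheadConst C₀ m l κ n ≤ overheadConst C' m l κ n :=
        overheadConst_mono (by linarith) m l κ n
      have hV := (hcode n hN).1
      have hγ : (overheadConst C' m l κ n + m * H + (n : ℝ) ^ (1 / 2 - η)) / n =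
          gammaSeq C' m l κ H η n := by
        rw [gammaSeq, add_div, add_div, mul_div_right_comm, ← Real.rpow_sub_one hn0.ne',
          show (1 / 2 - η - 1 : ℝ) = -(1 / 2) - η by ring]
      rw [← hγ, div_lt_iff₀ hn0, mul_comm t] at ht
      have h1 := measureReal_complexity_deviation_le_of_stable hU hrep hX hφ hstab hn
        (H := H) (V := overheadConst C' m l κ n + m * H) (b := m * Real.logb 2 l)
        (fun x => ((hcode n hN).2 x).trans (by linarith)) (hEup n) (hElow n) (by linarith)
        (Real.rpow_nonneg hn0.le (1 / 2 - η)) ht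
      rw [hγ, ← hMeq, ← hΔ] at h1
      have h2 : (2 : ℝ) ^ (-(n : ℝ) ^ (1 / 2 - η)) ≤
          n * (C' + κ) * (2 : ℝ) ^ (-(n : ℝ) ^ (1 / 2 - η)) :=
        le_mul_of_one_le_left (by positivity) (one_le_mul_of_one_le_of_one_le hn1 (by linarith))
      linarith
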